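/- Let $n\ge 1$ and let $\mathbb{H}^{n+1}=\{X=(x,x_{n+1})\in\mathbb{R}^{n+1}\times\mathbb{R}:\langle X,X\rangle=-1,\ x_{n+1}>0\}$ be hyperbolic space in the hyperboloid model, where $\langle X,Y\rangle=x\cdot y-x_{n+1}y_{n+1}$. For $z\in\mathbb{S}^n\subset\mathbb{R}^{n+1}$ and $r\in\mathbb{R}$ let $H_z(r)=\{X\in\mathbb{H}^{n+1}:\log(-\langle X,(z,1)\rangle)=r\}$ be a horosphere and $\overline{B}_z(r)=\{X\in\mathbb{H}^{n+1}:\log(-\langle X,(z,1)\rangle)\le r\}$ the closed horo-ball that it bounds. An h-convex bounded domain is a compact set $\Omega\subset\mathbb{H}^{n+1}$ which has non-empty interior or is a single point (a degenerate domain), such that for every $X\in\partial\Omega$ there are $z,r$ with $\Omega\subset\overline{B}_z(r)$ and $X\in H_z(r)$. The horospherical support function of $\Omega$ is $u_\Omega(z)=\inf\{s\in\mathbb{R}:\Omega\subset\overline{B}_z(s)\}$, $z\in\mathbb{S}^n$. A smooth uniformly h-convex bounded domain is a compact connected set with non-empty interior and smooth boundary such that, for some $\delta>0$, all principal curvatures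 of the boundary (with respect to the outward unit normal) are everywhere greater than $1+\delta$. Let $\frac12\le p\le 2$, $a\ge 0$, $b\ge 0$, $a+b\ge 1$, and let each of $K,L\subset\mathbb{H}^{n+1}$ be a smooth uniformly h-convex bounded domain or a single point. Put $$u(z)=\frac1p\log\left(a\,e^{p\,u_K(z)}+b\,e^{p\,u_L(z)}\right),\qquad \varphi(z)=e^{u(z)}=\left(a\,e^{p\,u_K(z)}+b\,e^{p\,u_L(z)}\right)^{1/p},\qquad z\in\mathbb{S}^n .$$ Then $u$ is smooth on $\mathbb{S}^n$, and there is a unique h-convex bounded domain $\Omega$ with horospherical support function $u_\Omega=u$. Its boundary $\partial\Omega$ is exactly the image of $\mathbb{S}^n$ under the map $$X(z)=\frac12\varphi(z)\,(-z,1)+\frac12\left(\frac{|D\varphi(z)|^2}{\varphi(z)}+\frac1{\varphi(z)}\right)(z,1)-(D\varphi(z),0),$$ where $D$ denotes the gradient on the round sphere $\mathbb{S}^n$. Moreover, $\Omega$ is a smooth, non-degenerate and uniformly h-convex bounded domain, except possibly in the following cases: 1. $a=1$, $b=0$ and $K$ is a point; 2. $a=0$, $b=1$ and $L$ is a point; 3.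 $p\in\{\frac12,2\}$, $a>0$, $b>0$, $a+b=1$, and both $K$ and $L$ are points; 4. $a>0$, $b>0$, $a+b=1$, and $K=L$ is a single point. -/

import Mathlib

open scoped Manifold ContDiff Topology

noncomputable section

namespace HypSum

/-- The Euclidean space `ℝ^{n+1}`. -/
abbrev Euc (n : ℕ) : Type := EuclideanSpace ℝ (Fin (n + 1))

/-- The unit sphere `𝕊ⁿ ⊂ ℝ^{n+1}`. -/
abbrev Sph (n : ℕ) : Type := Metric.sphere (0 : Euc n) 1

/-- The vector space underlying Minkowski space `ℝ^{n+1,1}`; a vector is `(x, x_{n+1})`. -/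
abbrev Mink (n : ℕ) : Type := Euc n × ℝ

/-- The Lorentzian inner product `⟨X, Y⟩ = ∑ xᵢ yᵢ - x_{n+1} y_{n+1}`. -/
def lor {n : ℕ} (X Y : Mink n) : ℝ := inner ℝ X.1 Y.1 - X.2 * Y.2

/-- Hyperbolic space `ℍ^{n+1}` (hyperboloid model), with the topology induced from `ℝ^{n+1,1}`. -/
abbrev Hyp (n : ℕ) : Type := {X : Mink n // lor X X = -1 ∧ 0 < X.2}

/-- The null vector `(z, 1)` attached to `z ∈ 𝕊ⁿ`. -/
def nullVec {n : ℕ} (z : Sph n) : Mink n := ((z : Euc n), 1)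

/-- The horosphere `H_z(r)`. -/
def horosphere {n : ℕ} (z : Sph n) (r : ℝ) : Set (Hyp n) :=
  {X | Real.log (-lor X.1 (nullVec z)) = r}

/-- The closed horo-ball bounded by `H_z(r)`. -/
def closedHoroball {n : ℕ} (z : Sph n) (r : ℝ) : Set (Hyp n) :=
  {X | Real.log (-lor X.1 (nullVec z)) ≤ r}

/-- The horospherical support function `u_Ω(z) = inf {s : Ω ⊆ closed horo-ball of z and s}`. -/
def supportFn {n : ℕ} (Ω : Set (Hyp n)) (z : Sph n) : ℝ :=
  sInf {s : ℝ | Ω ⊆ closedHoroball z s}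

/-- `Ω` is a single point (a degenerate domain). -/
def IsPoint {n : ℕ} (Ω : Set (Hyp n)) : Prop := ∃ X : Hyp n, Ω = {X}

/-- h-convex bounded domains, single points being allowed as degenerate ones: compact sets that
have non-empty interior or are a single point, and that have at every boundary point a supporting
horosphere. -/
structure IsHConvexDomain {n : ℕ} (Ω : Set (Hyp n)) : Prop where
  isCompact : IsCompact Ω
  interior_or_point : (interior Ω).Nonempty ∨ IsPoint Ω
  supporting : ∀ X ∈ frontier Ω, ∃ (z : Sph n) (r : ℝ),
    Ω ⊆ closedHoroball z r ∧ X ∈ horosphere z r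

/-! ### Smooth domains and principal curvatures -/

/-- The gradient of `ρ` on `ℝ^{n+1,1}` for the Lorentzian inner product: the vector `V` with
`⟨V, W⟩ = dρ(W)` for all `W`. -/
def lorGrad {n : ℕ} (ρ : Mink n → ℝ) (Y : Mink n) : Mink n :=
  ((InnerProductSpace.toDual ℝ (Euc n)).symm
      ((fderiv ℝ ρ Y).comp (ContinuousLinearMap.inl ℝ (Euc n) ℝ)),
    -fderiv ℝ ρ Y (0, 1))

/-- The gradient on `ℍ^{n+1}` of the restriction of `ρ`: the projection of the Lorentzian gradient
to the tangent space `T_Y ℍ^{n+1} = {V : ⟨Y, V⟩ = 0}`. -/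
def hypGrad {n : ℕ} (ρ : Mink n → ℝ) (Y : Mink n) : Mink n :=
  lorGrad ρ Y + lor (lorGrad ρ Y) Y • Y

/-- The unit normal `∇ρ / |∇ρ|` in `ℍ^{n+1}` to the level sets of `ρ`. -/
def unitNormal {n : ℕ} (ρ : Mink n → ℝ) (Y : Mink n) : Mink n :=
  (Real.sqrt (lor (hypGrad ρ Y) (hypGrad ρ Y)))⁻¹ • hypGrad ρ Y

/-- `ρ` is a smooth local defining function of `Ω` near the boundary point `X`: near `X` the set
`Ω` is `{ρ ≤ 0}`, `ρ(X) = 0`, and the gradient of `ρ` on `ℍ^{n+1}` does not vanish at `X`. -/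
structure IsLocalDefiningFn {n : ℕ} (Ω : Set (Hyp n)) (X : Hyp n) (ρ : Mink n → ℝ) : Prop where
  smooth : ∃ U ∈ 𝓝 (X : Mink n), ContDiffOn ℝ ∞ ρ U
  mem_iff : ∀ᶠ Y : Hyp n in 𝓝 X, (Y ∈ Ω ↔ ρ Y ≤ 0)
  eq_zero : ρ X = 0
  grad_ne_zero : hypGrad ρ X ≠ 0

/-- A (non-degenerate) smooth bounded domain: compact, connected, with non-empty interior and
smooth boundary. -/
structure IsSmoothDomain {n : ℕ} (Ω : Set (Hyp n)) : Prop where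
  isCompact : IsCompact Ω
  isConnected : IsConnected Ω
  interior_nonempty : (interior Ω).Nonempty
  smooth_boundary : ∀ X ∈ frontier Ω, ∃ ρ : Mink n → ℝ, IsLocalDefiningFn Ω X ρ

/-- `κ` is a principal curvature of `∂Ω` at `X` for the outward unit normal `ν`, that is, an
eigenvalue of the Weingarten map `v ↦ D_v ν` on the tangent space
`T_X ∂Ω = {v : ⟨X, v⟩ = 0, ⟨ν, v⟩ = 0}`. Along `∂Ω` the field `unitNormal ρ` is the outward unit
normal, whatever local defining function `ρ` is used. -/
def IsPrincipalCurvature {n : ℕ} (Ω : Set (Hyp n)) (X : Hyp n) (κ : ℝ) : Prop :=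
  ∃ ρ : Mink n → ℝ, IsLocalDefiningFn Ω X ρ ∧
    ∃ v : Mink n, v ≠ 0 ∧ lor X.1 v = 0 ∧ lor (unitNormal ρ X) v = 0 ∧
      fderiv ℝ (unitNormal ρ) X v = κ • v

/-- Smooth (non-degenerate) uniformly h-convex bounded domains: the principal curvatures of the
boundary are everywhere greater than `1 + δ` for some `δ > 0`. -/
structure IsUniformlyHConvex {n : ℕ} (Ω : Set (Hyp n)) : Prop where
  isSmoothDomain : IsSmoothDomain Ω
  curvature : ∃ δ : ℝ, 0 < δ ∧
    ∀ X ∈ frontier Ω, ∀ κ : ℝ, IsPrincipalCurvature Ω X κ → 1 + δ < κ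

/-! ### The map from the sphere given by a positive function -/

/-- The extension `x ↦ f(x / |x|)` of a function on the sphere (with value `0` at `x = 0`). -/
def radialExt {n : ℕ} (f : Sph n → ℝ) (x : Euc n) : ℝ :=
  if h : x = 0 then 0
  else f ⟨‖x‖⁻¹ • x, by
    rw [mem_sphere_zero_iff_norm, norm_smul, norm_inv, norm_norm,
      inv_mul_cancel₀ (norm_ne_zero_iff.mpr h)]⟩

/-- The gradient `Df(z) ∈ T_z 𝕊ⁿ ⊂ ℝ^{n+1}` of a differentiable function on the round sphere. -/
def sphGrad {n : ℕ} (f : Sph n → ℝ) (z : Sph n) : Euc n := gradient (radialExt f) (z : Euc n)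

/-- `X(z) = ½ φ (-z, 1) + ½ (|Dφ|² / φ + 1 / φ) (z, 1) - (Dφ, 0)`. -/
def boundaryMap {n : ℕ} (φ : Sph n → ℝ) (z : Sph n) : Mink n :=
  (φ z / 2) • ((-(z : Euc n), 1) : Mink n)
    + ((‖sphGrad φ z‖ ^ 2 / φ z + 1 / φ z) / 2) • nullVec z
    - ((sphGrad φ z, 0) : Mink n)

/-- `u(z) = (1/p) log (a e^{p u_K(z)} + b e^{p u_L(z)})`. -/
def pSumFn {n : ℕ} (p a b : ℝ) (K L : Set (Hyp n)) (z : Sph n) : ℝ :=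
  1 / p * Real.log (a * Real.exp (p * supportFn K z) + b * Real.exp (p * supportFn L z))

/-- `φ(z) = (a φ_K(z)^p + b φ_L(z)^p)^{1/p}` with `φ_K = e^{u_K}` and `φ_L = e^{u_L}`. -/
def pSumExp {n : ℕ} (p a b : ℝ) (K L : Set (Hyp n)) (z : Sph n) : ℝ :=
  (a * Real.exp (supportFn K z) ^ p + b * Real.exp (supportFn L z) ^ p) ^ (1 / p)

end HypSum

end

open scoped Manifold ContDiff Topology
open Filter Set

noncomputable section

namespace HypSum

variable {n : ℕ}

/-! ### The Lorentzian inner product -/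

/-! Put h_z(X) = -⟨X,(z,1)⟩, so that e^{u_Ω(z)} is the maximum of h_z on Ω. If X in Ω attains it and
u_Ω is differentiable at z, the functions log h_w(X) ≤ u_Ω(w) of w touch at w = z, so X is
determined by the 1-jet of u_Ω at z; it is the point X(z) of the theorem (`eq_bptH_of_le`). Hence a
smooth u is a horospherical support function exactly when h_z(X(w)) ≤ e^{u(z)} for all w, z
(`HSupport`). The domain is then the intersection of the prescribed horo-balls; it is unique by
`eq_horoHull`, and its boundary consists of the points X(z) (`frontier_horoHull`).

For w ≠ z, `hfn_bpt` gives h_z(X(w)) = ½(1 - w·z) e^{u(w)} (e^{-2u(w)} + |Du(w) + y|²), where y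
depends only on w and z. For a p-sum u of g and h, Du = α Dg + β Dh with weights α = a e^{p(g-u)}
and β = b e^{p(h-u)} of sum 1. After taking p-th powers, the two-point inequality for u follows from
those for g and h by `rpow_comb_le`: this combines convexity of x^p (if p ≥ 1) or of x^{2p} (if 1/2
≤ p ≤ 1) with Jensen's inequality for e^{-2u} or e^{-u}, where p ≤ 2 and a + b ≥ 1 enter.

Regularity is governed by the form A[u] = D²u + Du⊗Du + ½(1 - |Du|² - e^{-2u})g (`hessForm`), which
is non-negative under `HSupport`. Each principal curvature κ satisfies (κ - 1) e^{2u} A(ξ,ξ) = |ξ|²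
for some tangent ξ ≠ 0. If A is positive, the boundary map is an injective immersion, the boundary
is smooth, and an upper bound for A on the sphere bounds κ - 1 from below. By `hessForm_pLog`, A[u]
is α A[g] + β A[h] plus non-negative terms; outside the exceptional cases one of these contributions
is positive.

Finally, the support function of a uniformly h-convex K must be shown to be smooth with A positive.
The crux is that h_z has only one maximum point on K. In the half-space model with z at infinity,
curvature greater than 1 becomes local strict Euclidean convexity. Minimising the energy of chains
globalises this on a compact connected set (`exists_mem_interior_of_local`): the line through two
lowest points would meet the interior, which is impossible. The inverse function theorem applied to
the Gauss map then gives smoothness. -/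

lemma lor_comm (X Y : Mink n) : lor X Y = lor Y X := by
  simp only [lor, real_inner_comm, mul_comm]

lemma lor_add_left (X Y Z : Mink n) : lor (X + Y) Z = lor X Z + lor Y Z := by
  simp only [lor, Prod.fst_add, Prod.snd_add, inner_add_left]; ring

lemma lor_add_right (X Y Z : Mink n) : lor X (Y + Z) = lor X Y + lor X Z := by
  simp only [lor, Prod.fst_add, Prod.snd_add, inner_add_right]; ring

lemma lor_sub_left (X Y Z : Mink n) : lor (X - Y) Z = lor X Z - lor Y Z := by
  simp only [lor, Prod.fst_sub, Prod.snd_sub, inner_sub_left]; ring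

lemma lor_sub_right (X Y Z : Mink n) : lor X (Y - Z) = lor X Y - lor X Z := by
  simp only [lor, Prod.fst_sub, Prod.snd_sub, inner_sub_right]; ring

lemma lor_smul_left (r : ℝ) (X Y : Mink n) : lor (r • X) Y = r * lor X Y := by
  simp only [lor, Prod.smul_fst, Prod.smul_snd, real_inner_smul_left, smul_eq_mul]; ring

lemma lor_smul_right (r : ℝ) (X Y : Mink n) : lor X (r • Y) = r * lor X Y := by
  simp only [lor, Prod.smul_fst, Prod.smul_snd, real_inner_smul_right, smul_eq_mul]; ring

lemma lor_zero_left (X : Mink n) : lor 0 X = 0 := by simp [lor]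

lemma lor_zero_right (X : Mink n) : lor X 0 = 0 := by simp [lor]

lemma contDiff_lor : ContDiff ℝ ∞ fun P : Mink n × Mink n => lor P.1 P.2 := by
  unfold lor
  exact (contDiff_fst.fst.inner ℝ contDiff_snd.fst).sub (contDiff_fst.snd.mul contDiff_snd.snd)

lemma continuous_lor : Continuous fun P : Mink n × Mink n => lor P.1 P.2 :=
  contDiff_lor.continuous

lemma _root_.HasDerivAt.lor {f g : ℝ → Mink n} {f' g' : Mink n} {s : ℝ}
    (hf : HasDerivAt f f' s) (hg : HasDerivAt g g' s) :
    HasDerivAt (fun s => lor (f s) (g s)) (lor f' (g s) + lor (f s) g') s := by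
  unfold HypSum.lor
  have h1 := (hasFDerivAt_fst (𝕜 := ℝ) (p := f s)).comp_hasDerivAt s hf
  have h2 := (hasFDerivAt_snd (𝕜 := ℝ) (p := f s)).comp_hasDerivAt s hf
  have h3 := (hasFDerivAt_fst (𝕜 := ℝ) (p := g s)).comp_hasDerivAt s hg
  have h4 := (hasFDerivAt_snd (𝕜 := ℝ) (p := g s)).comp_hasDerivAt s hg
  have := (h1.inner ℝ h3).sub (h2.mul h4)
  convert! this using 1
  simp; ring

/-! ### The function `h_z(X) = -⟨X, (z, 1)⟩` -/

/-- `h_z(X) = -⟨X, (z, 1)⟩`. -/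
def hfn (X : Mink n) (z : Euc n) : ℝ := X.2 - inner ℝ X.1 z

lemma hfn_eq (X : Mink n) (z : Euc n) : hfn X z = -lor X (z, 1) := by simp [hfn, lor]

lemma hfn_eq_nullVec (X : Mink n) (z : Sph n) : -lor X (nullVec z) = hfn X z := by
  simp [hfn, lor, nullVec]

lemma hfn_add (X Y : Mink n) (z : Euc n) : hfn (X + Y) z = hfn X z + hfn Y z := by
  simp only [hfn, Prod.fst_add, Prod.snd_add, inner_add_left]; ring

lemma hfn_smul (r : ℝ) (X : Mink n) (z : Euc n) : hfn (r • X) z = r * hfn X z := by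
  simp only [hfn, Prod.smul_fst, Prod.smul_snd, real_inner_smul_left, smul_eq_mul]; ring

lemma contDiff_hfn : ContDiff ℝ ∞ fun P : Mink n × Euc n => hfn P.1 P.2 := by
  unfold hfn
  exact contDiff_fst.snd.sub (contDiff_fst.fst.inner ℝ contDiff_snd)

lemma continuous_hfn : Continuous fun P : Mink n × Euc n => hfn P.1 P.2 :=
  contDiff_hfn.continuous

lemma sph_norm (z : Sph n) : ‖(z : Euc n)‖ = 1 := mem_sphere_zero_iff_norm.mp z.2

lemma sph_inner (z : Sph n) : inner ℝ (z : Euc n) (z : Euc n) = 1 := by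
  rw [real_inner_self_eq_norm_sq, sph_norm]; norm_num

lemma sph_ne_zero (z : Sph n) : (z : Euc n) ≠ 0 := by
  intro h; have := sph_norm z; rw [h] at this; simp at this

/-! ### Hyperbolic space -/

lemma hyp_sq (X : Hyp n) : X.1.2 ^ 2 = ‖X.1.1‖ ^ 2 + 1 := by
  have := X.2.1
  simp only [lor, real_inner_self_eq_norm_sq] at this
  linarith [sq X.1.2]

lemma hyp_norm_lt (X : Hyp n) : ‖X.1.1‖ < X.1.2 := by
  have := hyp_sq X
  nlinarith [X.2.2, norm_nonneg X.1.1]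

lemma one_le_hyp_snd (X : Hyp n) : 1 ≤ X.1.2 := by
  nlinarith [hyp_sq X, X.2.2, sq_nonneg ‖X.1.1‖]

lemma hfn_pos (X : Hyp n) (z : Sph n) : 0 < hfn X.1 z := by
  have h1 := real_inner_le_norm X.1.1 (z : Euc n)
  rw [sph_norm, mul_one] at h1
  have := hyp_norm_lt X
  unfold hfn; linarith

lemma hfn_pos' {X : Mink n} (h : ‖X.1‖ < X.2) (z : Sph n) : 0 < hfn X z := by
  have h1 := real_inner_le_norm X.1 (z : Euc n)
  rw [sph_norm, mul_one] at h1
  unfold hfn; linarith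

/-- Vectors orthogonal to a point of hyperbolic space are spacelike. -/
lemma lor_self_bound {X : Hyp n} {v : Mink n} (h : lor X.1 v = 0) :
    ‖v.1‖ ^ 2 ≤ X.1.2 ^ 2 * lor v v := by
  have h1 : inner ℝ X.1.1 v.1 = X.1.2 * v.2 := by unfold lor at h; linarith
  have h2 := real_inner_mul_inner_self_le X.1.1 v.1
  rw [real_inner_self_eq_norm_sq, real_inner_self_eq_norm_sq, h1] at h2
  have h3 := hyp_sq X
  have h4 : lor v v = ‖v.1‖ ^ 2 - v.2 ^ 2 := by
    simp only [lor, real_inner_self_eq_norm_sq]; ring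
  rw [h4]
  nlinarith

lemma lor_self_nonneg {X : Hyp n} {v : Mink n} (h : lor X.1 v = 0) : 0 ≤ lor v v := by
  have h1 := lor_self_bound h
  have h2 := one_le_hyp_snd X
  by_contra! h3
  nlinarith [sq_nonneg ‖v.1‖, mul_pos (X.2.2) X.2.2]

lemma eq_zero_of_lor_self {X : Hyp n} {v : Mink n} (h : lor X.1 v = 0) (hv : lor v v ≤ 0) :
    v = 0 := by
  have h1 := lor_self_bound h
  have h0 : ‖v.1‖ ^ 2 ≤ 0 := by nlinarith [sq_nonneg X.1.2]
  have h2 : v.1 = 0 := by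
    rw [← norm_eq_zero]; nlinarith [norm_nonneg v.1]
  have h3 : v.2 = 0 := by
    simp only [lor, h2, inner_zero_right] at h
    have := X.2.2
    have : X.1.2 * v.2 = 0 := by linarith
    rcases mul_eq_zero.mp this with h | h
    · linarith
    · exact h
  exact Prod.ext h2 h3

lemma lor_self_pos {X : Hyp n} {v : Mink n} (h : lor X.1 v = 0) (hv : v ≠ 0) : 0 < lor v v := by
  by_contra! h3
  exact hv (eq_zero_of_lor_self h h3)

/-- Cauchy–Schwarz on tangent spaces of hyperbolic space, with a unit vector. -/
lemma lor_sq_le {X : Hyp n} {v w : Mink n} (hv : lor X.1 v = 0) (hw : lor X.1 w = 0)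
    (hw1 : lor w w = 1) : lor v w ^ 2 ≤ lor v v := by
  have : lor X.1 (v - lor v w • w) = 0 := by
    rw [lor_sub_right, lor_smul_right, hv, hw]; ring
  have := lor_self_nonneg this
  simp only [lor_sub_left, lor_sub_right, lor_smul_left, lor_smul_right, hw1, lor_comm w v] at this
  nlinarith

lemma lor_neg_of_norm_lt {X Y : Mink n} (hX : ‖X.1‖ < X.2) (hY : ‖Y.1‖ < Y.2) : lor X Y < 0 := by
  have h1 := real_inner_le_norm X.1 Y.1
  have h2 : ‖X.1‖ * ‖Y.1‖ < X.2 * Y.2 :=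
    mul_lt_mul'' hX hY (norm_nonneg _) (norm_nonneg _)
  unfold lor; linarith

lemma hyp_lor_neg (X Y : Hyp n) : lor X.1 Y.1 < 0 :=
  lor_neg_of_norm_lt (hyp_norm_lt X) (hyp_norm_lt Y)

/-- Reverse Cauchy–Schwarz inequality. -/
lemma hyp_lor_le (X Y : Hyp n) : lor X.1 Y.1 ≤ -1 := by
  set c := lor X.1 Y.1 with hc
  have h : lor X.1 (Y.1 + c • X.1) = 0 := by
    rw [lor_add_right, lor_smul_right, X.2.1]; linarith
  have h1 := lor_self_nonneg h
  simp only [lor_add_left, lor_add_right, lor_smul_left, lor_smul_right, X.2.1, Y.2.1,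
    lor_comm Y.1 X.1, ← hc] at h1
  have := hyp_lor_neg X Y
  nlinarith

lemma eq_of_lor_eq {X Y : Hyp n} (hXY : -1 ≤ lor X.1 Y.1) : X = Y := by
  have h0 : lor X.1 Y.1 = -1 := le_antisymm (hyp_lor_le X Y) hXY
  have h : lor X.1 (Y.1 - X.1) = 0 := by
    rw [lor_sub_right, X.2.1]; linarith
  have h1 : lor (Y.1 - X.1) (Y.1 - X.1) ≤ 0 := by
    simp only [lor_sub_left, lor_sub_right, X.2.1, Y.2.1, lor_comm Y.1 X.1, h0]; norm_num
  exact Subtype.ext (sub_eq_zero.mp (eq_zero_of_lor_self h h1)).symm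

lemma lor_self_neg {Y : Mink n} (h : ‖Y.1‖ < Y.2) : lor Y Y < 0 :=
  lor_neg_of_norm_lt h h

/-- The point of hyperbolic space on the ray of a timelike future vector. -/
def normalize (Y : Mink n) (h : ‖Y.1‖ < Y.2) : Hyp n :=
  ⟨(Real.sqrt (-lor Y Y))⁻¹ • Y, by
    have h0 : 0 < -lor Y Y := neg_pos.mpr (lor_self_neg h)
    have h1 := Real.sqrt_pos.mpr h0
    refine ⟨?_, mul_pos (inv_pos.mpr h1) ((norm_nonneg _).trans_lt h)⟩
    have h2 := (lor_self_neg h).ne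
    rw [lor_smul_left, lor_smul_right, ← mul_assoc, ← mul_inv, Real.mul_self_sqrt h0.le]
    field_simp⟩

lemma norm_lt_add {X Y : Mink n} {a b : ℝ} (ha : 0 ≤ a) (hb : 0 ≤ b) (hab : 0 < a + b)
    (hX : ‖X.1‖ < X.2) (hY : ‖Y.1‖ < Y.2) : ‖(a • X + b • Y).1‖ < (a • X + b • Y).2 := by
  simp only [Prod.fst_add, Prod.snd_add, Prod.smul_fst, Prod.smul_snd, smul_eq_mul]
  have h1 := norm_add_le (a • X.1) (b • Y.1)
  rw [norm_smul, norm_smul, Real.norm_of_nonneg ha, Real.norm_of_nonneg hb] at h1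
  rcases ha.eq_or_lt with rfl | ha
  · have hb : 0 < b := by linarith
    nlinarith [mul_lt_mul_of_pos_left hY hb]
  · nlinarith [mul_lt_mul_of_pos_left hX ha, mul_le_mul_of_nonneg_left hY.le hb]

/-- The value on segments: `-⟨Y, Y⟩ ≥ (a + b)²` for `Y = a X₁ + b X₂`. -/
lemma lor_comb (X Y : Hyp n) (a b : ℝ) :
    -lor (a • X.1 + b • Y.1) (a • X.1 + b • Y.1)
      = (a + b) ^ 2 + 2 * a * b * (-lor X.1 Y.1 - 1) := by
  simp only [lor_add_left, lor_add_right, lor_smul_left, lor_smul_right, X.2.1, Y.2.1,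
    lor_comm Y.1 X.1]
  ring

/-! ### Horo-balls -/

lemma mem_closedHoroball {X : Hyp n} {z : Sph n} {r : ℝ} :
    X ∈ closedHoroball z r ↔ hfn X.1 z ≤ Real.exp r := by
  rw [closedHoroball, mem_ofPred_eq, hfn_eq_nullVec, Real.log_le_iff_le_exp (hfn_pos X z)]

lemma mem_horosphere {X : Hyp n} {z : Sph n} {r : ℝ} :
    X ∈ horosphere z r ↔ hfn X.1 z = Real.exp r := by
  rw [horosphere, mem_ofPred_eq, hfn_eq_nullVec]
  constructor
  · rintro rfl; rw [Real.exp_log (hfn_pos X z)]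
  · intro h; rw [h, Real.log_exp]

/-- The admissible levels form the closed half-line starting at the maximum, so no default value of
`sInf` enters. -/
lemma supportFn_eq_of_isMax {Ω : Set (Hyp n)} {z : Sph n} {X : Hyp n} (hX : X ∈ Ω)
    (hmax : ∀ Y ∈ Ω, hfn Y.1 z ≤ hfn X.1 z) : supportFn Ω z = Real.log (hfn X.1 z) := by
  have : {s : ℝ | Ω ⊆ closedHoroball z s} = Ici (Real.log (hfn X.1 z)) := by
    ext s
    simp only [mem_ofPred_eq, mem_Ici, Real.log_le_iff_le_exp (hfn_pos X z)]
    exact ⟨fun h => mem_closedHoroball.mp (h hX),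
      fun h Y hY => mem_closedHoroball.mpr ((hmax Y hY).trans h)⟩
  rw [supportFn, this, csInf_Ici]

lemma exists_hfn_max {Ω : Set (Hyp n)} (hc : IsCompact Ω) (hne : Ω.Nonempty) (z : Sph n) :
    ∃ X ∈ Ω, ∀ Y ∈ Ω, hfn Y.1 z ≤ hfn X.1 z :=
  hc.exists_isMaxOn hne (continuous_hfn.comp
    (continuous_subtype_val.prodMk continuous_const)).continuousOn

lemma hfn_le_exp_supportFn {Ω : Set (Hyp n)} (hc : IsCompact Ω) {X : Hyp n} (hX : X ∈ Ω)
    (z : Sph n) : hfn X.1 z ≤ Real.exp (supportFn Ω z) := by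
  obtain ⟨Y, hY, hm⟩ := exists_hfn_max hc ⟨X, hX⟩ z
  rw [supportFn_eq_of_isMax hY hm, Real.exp_log (hfn_pos Y z)]
  exact hm X hX

lemma exists_hfn_eq_exp_supportFn {Ω : Set (Hyp n)} (hc : IsCompact Ω) (hne : Ω.Nonempty)
    (z : Sph n) : ∃ X ∈ Ω, hfn X.1 z = Real.exp (supportFn Ω z) := by
  obtain ⟨Y, hY, hm⟩ := exists_hfn_max hc hne z
  exact ⟨Y, hY, by rw [supportFn_eq_of_isMax hY hm, Real.exp_log (hfn_pos Y z)]⟩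

/-- A point is determined by an upper bound for its horospherical support function. -/
lemma eq_of_hfn_le {X Y : Hyp n} (h : ∀ z : Sph n, hfn Y.1 z ≤ hfn X.1 z) : Y = X := by
  -- With x, y the spatial parts, the direction z = -(y - x)/|y - x| is the worst one and shows that
  -- X - Y is causal, whereas a difference of two points of the hyperboloid is spacelike or zero.
  have key : ‖Y.1.1 - X.1.1‖ ≤ X.1.2 - Y.1.2 := by
    by_cases h0 : Y.1.1 - X.1.1 = 0
    · have hz := h ⟨EuclideanSpace.single 0 1, by simp⟩
      have : Y.1.1 = X.1.1 := sub_eq_zero.mp h0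
      simp only [hfn, this] at hz
      rw [h0]; simp only [norm_zero]; linarith
    · have hn := norm_pos_iff.mpr h0
      have hz := h ⟨-(‖Y.1.1 - X.1.1‖⁻¹ • (Y.1.1 - X.1.1)), by
        rw [mem_sphere_zero_iff_norm, norm_neg, norm_smul, norm_inv, norm_norm,
          inv_mul_cancel₀ hn.ne']⟩
      have hi : inner ℝ (Y.1.1 - X.1.1) (‖Y.1.1 - X.1.1‖⁻¹ • (Y.1.1 - X.1.1))
          = ‖Y.1.1 - X.1.1‖ := by
        rw [real_inner_smul_right, real_inner_self_eq_norm_sq]; field_simp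
      rw [inner_sub_left] at hi
      simp only [hfn, inner_neg_right] at hz
      linarith
  have h1 : lor (X.1 - Y.1) (X.1 - Y.1) ≤ 0 := by
    simp only [lor, Prod.fst_sub, Prod.snd_sub, real_inner_self_eq_norm_sq]
    rw [norm_sub_rev]
    nlinarith [norm_nonneg (Y.1.1 - X.1.1)]
  simp only [lor_sub_left, lor_sub_right, X.2.1, Y.2.1, lor_comm Y.1 X.1] at h1
  exact (eq_of_lor_eq (by linarith)).symm

/-! ### Functions on the sphere and their radial extensions -/

/-- The radial projection to the sphere. -/
def sphProj (x : Euc n) (hx : x ≠ 0) : Sph n :=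
  ⟨‖x‖⁻¹ • x, by
    rw [mem_sphere_zero_iff_norm, norm_smul, norm_inv, norm_norm,
      inv_mul_cancel₀ (norm_ne_zero_iff.mpr hx)]⟩

lemma radialExt_of_ne (f : Sph n → ℝ) {x : Euc n} (hx : x ≠ 0) :
    radialExt f x = f (sphProj x hx) := by
  simp [radialExt, hx, sphProj]

lemma sphProj_smul (z : Sph n) {s : ℝ} (hs : 0 < s) (h : s • (z : Euc n) ≠ 0) :
    sphProj (s • (z : Euc n)) h = z := by
  apply Subtype.ext
  simp only [sphProj, norm_smul, sph_norm, mul_one, Real.norm_of_nonneg hs.le, smul_smul,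
    inv_mul_cancel₀ hs.ne', one_smul]

lemma sphProj_coe (z : Sph n) : sphProj (z : Euc n) (sph_ne_zero z) = z := by
  apply Subtype.ext
  simp [sphProj]

lemma radialExt_coe (f : Sph n → ℝ) (z : Sph n) : radialExt f (z : Euc n) = f z := by
  rw [radialExt_of_ne f (sph_ne_zero z), sphProj_coe]

lemma radialExt_smul (f : Sph n → ℝ) (z : Sph n) {s : ℝ} (hs : 0 < s) :
    radialExt f (s • (z : Euc n)) = f z := by
  have h : s • (z : Euc n) ≠ 0 := smul_ne_zero hs.ne' (sph_ne_zero z)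
  rw [radialExt_of_ne f h, sphProj_smul z hs]

/-- `u` is smooth on the sphere, in terms of its radial extension. -/
def SmoothSph (u : Sph n → ℝ) : Prop := ∀ x : Euc n, x ≠ 0 → ContDiffAt ℝ ∞ (radialExt u) x

lemma SmoothSph.contDiffAt {u : Sph n → ℝ} (hu : SmoothSph u) (z : Sph n) :
    ContDiffAt ℝ ∞ (radialExt u) (z : Euc n) := hu _ (sph_ne_zero z)

lemma SmoothSph.differentiableAt {u : Sph n → ℝ} (hu : SmoothSph u) (z : Sph n) :
    DifferentiableAt ℝ (radialExt u) (z : Euc n) :=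
  (hu.contDiffAt z).differentiableAt (by simp)

lemma SmoothSph.contMDiff {u : Sph n → ℝ} (hu : SmoothSph u) :
    ContMDiff (𝓡 n) 𝓘(ℝ, ℝ) ∞ u := by
  intro z
  have := Fact.mk (@finrank_euclideanSpace_fin ℝ _ (n + 1))
  have h1 : ContMDiffAt 𝓘(ℝ, Euc n) 𝓘(ℝ, ℝ) ∞ (radialExt u) (z : Euc n) :=
    (hu.contDiffAt z).contMDiffAt
  have h2 : ContMDiffAt (𝓡 n) 𝓘(ℝ, Euc n) ∞ ((↑) : Sph n → Euc n) z :=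
    (contMDiff_coe_sphere (E := Euc n) (n := n) (m := ∞)).contMDiffAt
  have h3 := h1.comp z h2
  convert! h3 using 1
  ext w
  exact (radialExt_coe u w).symm

lemma contDiffAt_proj {x : Euc n} (hx : x ≠ 0) :
    ContDiffAt ℝ ∞ (fun x : Euc n => ‖x‖⁻¹ • x) x :=
  ((contDiffAt_norm ℝ hx).inv (norm_ne_zero_iff.mpr hx)).smul contDiffAt_id

lemma smoothSph_of_local {u : Sph n → ℝ}
    (h : ∀ z : Sph n, ∃ F : Euc n → ℝ, ContDiffAt ℝ ∞ F z ∧ ∀ᶠ w : Sph n in 𝓝 z, u w = F w) :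
    SmoothSph u := by
  intro x hx
  obtain ⟨F, hF, hev⟩ := h (sphProj x hx)
  have h1 : ContDiffAt ℝ ∞ (fun y : Euc n => F (‖y‖⁻¹ • y)) x :=
    ContDiffAt.comp x (g := F) hF (contDiffAt_proj hx)
  refine h1.congr_of_eventuallyEq ?_
  rw [nhds_subtype_eq_comap, eventually_comap] at hev
  have h2 : Tendsto (fun y : Euc n => ‖y‖⁻¹ • y) (𝓝 x) (𝓝 (‖x‖⁻¹ • x)) :=
    (contDiffAt_proj hx).continuousAt
  filter_upwards [h2.eventually hev, isOpen_ne.mem_nhds hx] with y hy hy0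
  rw [radialExt_of_ne u hy0]
  exact hy (sphProj y hy0) rfl

lemma SmoothSph.comp₂ {u v : Sph n → ℝ} (hu : SmoothSph u) (hv : SmoothSph v) {F : ℝ × ℝ → ℝ}
    (hF : ∀ z, ContDiffAt ℝ ∞ F (u z, v z)) : SmoothSph (fun z => F (u z, v z)) := by
  intro x hx
  have h1 : ContDiffAt ℝ ∞ (fun y => F (radialExt u y, radialExt v y)) x := by
    refine ContDiffAt.comp x (g := F) ?_ ((hu x hx).prodMk (hv x hx))
    rw [radialExt_of_ne u hx, radialExt_of_ne v hx]; exact hF _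
  refine h1.congr_of_eventuallyEq ?_
  filter_upwards [isOpen_ne.mem_nhds hx] with y hy
  rw [radialExt_of_ne _ hy, radialExt_of_ne _ hy, radialExt_of_ne _ hy]

lemma radialExt_comp_eventuallyEq (u : Sph n → ℝ) (F : ℝ → ℝ) {x : Euc n} (hx : x ≠ 0) :
    radialExt (fun z => F (u z)) =ᶠ[𝓝 x] fun y => F (radialExt u y) := by
  filter_upwards [isOpen_ne.mem_nhds hx] with y hy
  rw [radialExt_of_ne _ hy, radialExt_of_ne _ hy]

lemma SmoothSph.continuous {u : Sph n → ℝ} (hu : SmoothSph u) : Continuous u := by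
  rw [continuous_iff_continuousAt]
  intro z
  have h1 : ContinuousAt (fun w : Sph n => radialExt u (w : Euc n)) z :=
    ContinuousAt.comp (g := radialExt u) (hu.contDiffAt z).continuousAt
      continuous_subtype_val.continuousAt
  simpa only [radialExt_coe] using h1

lemma inner_sphGrad (u : Sph n → ℝ) (z : Sph n) (ζ : Euc n) :
    inner ℝ (sphGrad u z) ζ = fderiv ℝ (radialExt u) (z : Euc n) ζ := by
  rw [sphGrad, inner_gradient_left]

/-- The radial extension is constant along rays. Where it is not differentiable, the gradient is
zero by convention. -/
lemma inner_sphGrad_self (u : Sph n → ℝ) (z : Sph n) : inner ℝ (sphGrad u z) (z : Euc n) = 0 := by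
  rw [inner_sphGrad]
  by_cases hd : DifferentiableAt ℝ (radialExt u) (z : Euc n)
  · have h1 : HasDerivAt (fun s : ℝ => (z : Euc n) + s • (z : Euc n)) (z : Euc n) 0 := by
      simpa using ((hasDerivAt_id (0 : ℝ)).smul_const (z : Euc n)).const_add (z : Euc n)
    have h2 : HasDerivAt (fun s : ℝ => radialExt u ((z : Euc n) + s • (z : Euc n)))
        (fderiv ℝ (radialExt u) (z : Euc n) z) 0 := by
      refine HasFDerivAt.comp_hasDerivAt (l := radialExt u) (0 : ℝ) ?_ h1
      simpa using hd.hasFDerivAt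
    have h3 : HasDerivAt (fun s : ℝ => radialExt u ((z : Euc n) + s • (z : Euc n))) 0 0 := by
      refine (hasDerivAt_const (0 : ℝ) (u z)).congr_of_eventuallyEq ?_
      filter_upwards [lt_mem_nhds (show (-1 : ℝ) < 0 by norm_num)] with s hs
      have : (z : Euc n) + s • (z : Euc n) = (1 + s) • (z : Euc n) := by rw [add_smul, one_smul]
      rw [this, radialExt_smul u z (by linarith)]
    exact h2.unique h3
  · rw [fderiv_zero_of_not_differentiableAt hd]; simp

/-- Two differentiable functions on the sphere that touch have the same gradient. -/
lemma sphGrad_eq_of_le {f g : Sph n → ℝ} {z : Sph n}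
    (hf : DifferentiableAt ℝ (radialExt f) (z : Euc n))
    (hg : DifferentiableAt ℝ (radialExt g) (z : Euc n)) (hle : ∀ w, f w ≤ g w) (heq : f z = g z) :
    sphGrad f z = sphGrad g z := by
  have hmin : IsLocalMin (fun x => radialExt g x - radialExt f x) (z : Euc n) := by
    filter_upwards [isOpen_ne.mem_nhds (sph_ne_zero z)] with y hy
    rw [radialExt_coe, radialExt_coe, radialExt_of_ne _ hy, radialExt_of_ne _ hy, heq]
    linarith [hle (sphProj y hy)]
  have h := hmin.fderiv_eq_zero
  rw [fderiv_fun_sub hg hf, sub_eq_zero] at h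
  rw [sphGrad, sphGrad, gradient, gradient, h]

lemma smoothSph_log_hfn (X : Hyp n) : SmoothSph fun z : Sph n => Real.log (hfn X.1 z) := by
  refine smoothSph_of_local fun z => ⟨fun x => Real.log (hfn X.1 x), ?_, .of_forall fun _ => rfl⟩
  refine ContDiffAt.log ?_ (hfn_pos X z).ne'
  exact (contDiff_hfn.comp (contDiff_const.prodMk contDiff_id)).contDiffAt

lemma sphGrad_log_hfn (X : Hyp n) (z : Sph n) :
    sphGrad (fun w : Sph n => Real.log (hfn X.1 w)) z
      = -((hfn X.1 z)⁻¹ • (X.1.1 - (inner ℝ X.1.1 (z : Euc n)) • (z : Euc n))) := by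
  refine HasGradientAt.gradient ?_
  have hz := sph_norm z
  have h0 : HasFDerivAt (fun x : Euc n => X.1.2 - ‖x‖⁻¹ * inner ℝ X.1.1 x)
      (-(‖(z : Euc n)‖⁻¹ • innerSL ℝ X.1.1
        + (inner ℝ X.1.1 (z : Euc n)) • (-innerSL ℝ (z : Euc n)))) (z : Euc n) := by
    have hn : HasFDerivAt (fun x : Euc n => ‖x‖⁻¹) (-innerSL ℝ (z : Euc n)) (z : Euc n) := by
      have h1 := (hasStrictFDerivAt_norm_sq (z : Euc n)).hasFDerivAt
      have h2 := h1.sqrt (by rw [hz]; norm_num)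
      have h3 := (hasDerivAt_inv (show Real.sqrt (‖(z : Euc n)‖ ^ 2) ≠ 0 by
        rw [hz]; norm_num)).comp_hasFDerivAt (z : Euc n) h2
      simp only [Function.comp_def, Real.sqrt_sq (norm_nonneg _)] at h3
      convert! h3 using 1
      ext v
      simp [hz]
    exact (hn.mul (innerSL ℝ X.1.1).hasFDerivAt).const_sub X.1.2
  have hv : X.1.2 - ‖(z : Euc n)‖⁻¹ * inner ℝ X.1.1 (z : Euc n) = hfn X.1 z := by
    rw [hz, hfn]; ring
  have h1 := (Real.hasDerivAt_log (x := X.1.2 - ‖(z : Euc n)‖⁻¹ * inner ℝ X.1.1 (z : Euc n))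
    (by rw [hv]; exact (hfn_pos X z).ne')).comp_hasFDerivAt (z : Euc n) h0
  rw [hasGradientAt_iff_hasFDerivAt]
  have h2 : (fun x : Euc n => Real.log (X.1.2 - ‖x‖⁻¹ * inner ℝ X.1.1 x))
      =ᶠ[𝓝 (z : Euc n)] radialExt (fun w : Sph n => Real.log (hfn X.1 w)) := by
    filter_upwards [isOpen_ne.mem_nhds (sph_ne_zero z)] with y hy
    rw [radialExt_of_ne _ hy]
    simp [sphProj, hfn, real_inner_smul_right]
  refine HasFDerivAt.congr_of_eventuallyEq ?_ h2.symm
  convert! h1 using 1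
  rw [hv]
  ext v
  simp [hz]
  ring

/-! ### The boundary point with given support function -/

/-- The point of hyperbolic space determined by the value and the gradient of `u` at `z`. -/
def bpt (u : Sph n → ℝ) (z : Sph n) : Mink n :=
  Real.exp (u z) • ((1 / 2 : ℝ) • ((-(z : Euc n), 1) : Mink n)
    + ((‖sphGrad u z‖ ^ 2 + Real.exp (-2 * u z)) / 2) • ((z : Euc n), 1)
    - ((sphGrad u z, 0) : Mink n))

lemma bpt_fst (u : Sph n → ℝ) (z : Sph n) : (bpt u z).1 = Real.exp (u z) •
    (((‖sphGrad u z‖ ^ 2 + Real.exp (-2 * u z) - 1) / 2) • (z : Euc n) - sphGrad u z) := by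
  simp only [bpt, Prod.smul_fst, Prod.fst_add, Prod.fst_sub]
  module

lemma bpt_snd (u : Sph n → ℝ) (z : Sph n) : (bpt u z).2 = Real.exp (u z) *
    ((‖sphGrad u z‖ ^ 2 + Real.exp (-2 * u z) + 1) / 2) := by
  simp only [bpt, Prod.smul_snd, Prod.snd_add, Prod.snd_sub, smul_eq_mul]
  ring

lemma sphGrad_exp {u : Sph n → ℝ} {z : Sph n}
    (hu : DifferentiableAt ℝ (radialExt u) (z : Euc n)) :
    sphGrad (fun w => Real.exp (u w)) z = Real.exp (u z) • sphGrad u z := by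
  refine HasGradientAt.gradient ?_
  have h1 := hu.hasGradientAt.hasFDerivAt.exp
  refine HasFDerivAt.congr_of_eventuallyEq ?_
    (radialExt_comp_eventuallyEq u Real.exp (sph_ne_zero z))
  convert! h1 using 1
  rw [radialExt_coe, sphGrad, map_smul]

lemma boundaryMap_exp {u : Sph n → ℝ} {z : Sph n}
    (hu : DifferentiableAt ℝ (radialExt u) (z : Euc n)) :
    boundaryMap (fun w => Real.exp (u w)) z = bpt u z := by
  have h0 : Real.exp (-2 * u z) = (Real.exp (u z))⁻¹ ^ 2 := by
    rw [← Real.exp_neg, ← Real.exp_nat_mul]; congr 1; push_cast; ring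
  have hp := Real.exp_pos (u z)
  have h1 : (‖Real.exp (u z) • sphGrad u z‖ ^ 2 / Real.exp (u z) + 1 / Real.exp (u z)) / 2
      = Real.exp (u z) * ((‖sphGrad u z‖ ^ 2 + Real.exp (-2 * u z)) / 2) := by
    rw [norm_smul, Real.norm_of_nonneg hp.le, h0]
    field_simp
  have h2 : ((Real.exp (u z) • sphGrad u z, 0) : Mink n)
      = Real.exp (u z) • ((sphGrad u z, 0) : Mink n) := by simp
  simp only [boundaryMap, sphGrad_exp hu, h1, nullVec, h2, bpt]
  module

lemma hfn_bpt_self (u : Sph n → ℝ) (z : Sph n) : hfn (bpt u z) z = Real.exp (u z) := by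
  rw [hfn, bpt_fst, bpt_snd, real_inner_smul_left, inner_sub_left, real_inner_smul_left,
    sph_inner, inner_sphGrad_self]
  ring

lemma bpt_mem (u : Sph n → ℝ) (z : Sph n) :
    lor (bpt u z) (bpt u z) = -1 ∧ 0 < (bpt u z).2 := by
  constructor
  · rw [lor, bpt_fst, bpt_snd, real_inner_self_eq_norm_sq, norm_smul, norm_sub_rev, mul_pow,
      norm_sub_sq_real, real_inner_smul_right, inner_sphGrad_self, norm_smul, sph_norm,
      Real.norm_eq_abs, Real.norm_eq_abs, mul_one, sq_abs, sq_abs]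
    have h0 : Real.exp (u z) * Real.exp (u z) * Real.exp (-2 * u z) = 1 := by
      rw [← Real.exp_add, ← Real.exp_add, ← Real.exp_zero]; congr 1; ring
    linear_combination -h0
  · rw [bpt_snd]; positivity

/-- `bpt` as a point of hyperbolic space. -/
def bptH (u : Sph n → ℝ) (z : Sph n) : Hyp n := ⟨bpt u z, bpt_mem u z⟩

/-- A point touching a horospherical support function from below is given by `bpt`. -/
lemma eq_bptH_of_le {u : Sph n → ℝ} {z : Sph n} {X : Hyp n}
    (hu : DifferentiableAt ℝ (radialExt u) (z : Euc n))
    (hle : ∀ w : Sph n, hfn X.1 w ≤ Real.exp (u w)) (heq : hfn X.1 z = Real.exp (u z)) :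
    X = bptH u z := by
  have hg := sphGrad_eq_of_le ((smoothSph_log_hfn X).differentiableAt z) hu
    (fun w => (Real.log_le_iff_le_exp (hfn_pos X w)).mpr (hle w))
    (by rw [heq, Real.log_exp])
  rw [sphGrad_log_hfn, heq] at hg
  have hp := Real.exp_pos (u z)
  have h0 : Real.exp (-2 * u z) = (Real.exp (u z))⁻¹ ^ 2 := by
    rw [← Real.exp_neg, ← Real.exp_nat_mul]; congr 1; push_cast; ring
  set y := X.1.1 - (inner ℝ X.1.1 (z : Euc n)) • (z : Euc n) with hy
  have hy2 : ‖y‖ ^ 2 = ‖X.1.1‖ ^ 2 - (inner ℝ X.1.1 (z : Euc n)) ^ 2 := by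
    rw [hy, norm_sub_sq_real, norm_smul, real_inner_smul_right, sph_norm, Real.norm_eq_abs,
      mul_one, sq_abs]
    ring
  have hgn : ‖sphGrad u z‖ ^ 2
      = (Real.exp (u z))⁻¹ ^ 2 * (‖X.1.1‖ ^ 2 - (inner ℝ X.1.1 (z : Euc n)) ^ 2) := by
    rw [← hg, norm_neg, norm_smul, mul_pow, hy2, Real.norm_of_nonneg (inv_pos.mpr hp).le]
  have hs := hyp_sq X
  have hx2 : X.1.2 = Real.exp (u z) + inner ℝ X.1.1 (z : Euc n) := by
    unfold hfn at heq; linarith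
  set E := Real.exp (u z)
  set c := inner ℝ X.1.1 (z : Euc n)
  -- This is ⟨X,X⟩ = -1 solved for the component c of X along z. The tangential part of X is read
  -- off from the gradient and the last coordinate from h_z(X) = E.
  have hsum : ‖sphGrad u z‖ ^ 2 + E⁻¹ ^ 2 = 1 + 2 * c / E := by
    rw [hgn]
    have : ‖X.1.1‖ ^ 2 = (E + c) ^ 2 - 1 := by rw [← hx2]; linarith
    rw [this]; field_simp; ring
  refine Subtype.ext (Prod.ext ?_ ?_)
  · change _ = (bpt u z).1
    rw [bpt_fst, h0, hsum, ← hg, smul_sub, smul_neg, smul_smul, smul_smul]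
    have e1 : E * E⁻¹ = 1 := by field_simp
    have e2 : E * ((1 + 2 * c / E - 1) / 2) = c := by field_simp; ring
    rw [e1, e2, hy]; module
  · change _ = (bpt u z).2
    rw [bpt_snd, h0, hsum, hx2]; field_simp; ring

/-- The values of the support function of the point given by a 1-jet. -/
lemma hfn_bpt (u : Sph n → ℝ) (w z : Sph n) (hc : 1 - inner ℝ (w : Euc n) (z : Euc n) ≠ 0) :
    hfn (bpt u w) z = (1 - inner ℝ (w : Euc n) (z : Euc n)) / 2 * Real.exp (u w) *
      (Real.exp (-u w) ^ 2 + ‖sphGrad u w + (1 - inner ℝ (w : Euc n) (z : Euc n))⁻¹ •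
        ((z : Euc n) - inner ℝ (w : Euc n) (z : Euc n) • (w : Euc n))‖ ^ 2) := by
  set c := inner ℝ (w : Euc n) (z : Euc n) with hcdef
  have h0 : Real.exp (-2 * u w) = Real.exp (-u w) ^ 2 := by
    rw [← Real.exp_nat_mul]; congr 1; push_cast; ring
  rw [hfn, bpt_fst, bpt_snd, real_inner_smul_left, inner_sub_left, real_inner_smul_left,
    ← hcdef, h0, norm_add_sq_real, norm_smul, real_inner_smul_right, inner_sub_right,
    real_inner_smul_right, inner_sphGrad_self, mul_pow, norm_sub_sq_real, norm_smul,
    real_inner_smul_right, sph_norm, sph_norm, real_inner_comm (w : Euc n) (z : Euc n), ← hcdef,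
    Real.norm_eq_abs, Real.norm_eq_abs, mul_one, sq_abs, sq_abs]
  field_simp
  ring

lemma eq_of_inner_eq_one (w z : Sph n)
    (hc : 1 - inner ℝ (w : Euc n) (z : Euc n) = 0) : z = w := by
  have := (inner_eq_one_iff_of_norm_eq_one (𝕜 := ℝ) (sph_norm w) (sph_norm z)).mp (by linarith)
  exact Subtype.ext this.symm

/-- `u` is smooth and all points `bptH u w` lie in all horo-balls determined by `u`. -/
structure HSupport (u : Sph n → ℝ) : Prop where
  smooth : SmoothSph u
  le : ∀ w z : Sph n, hfn (bpt u w) z ≤ Real.exp (u z)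

/-- A touching point at w is forced to be `bptH u w`, so the mere existence of supporting points
yields the two-point inequality. -/
lemma hSupport_of_touching {u : Sph n → ℝ} (hu : SmoothSph u)
    (h : ∀ w : Sph n, ∃ X : Hyp n, (∀ z : Sph n, hfn X.1 z ≤ Real.exp (u z)) ∧
      hfn X.1 w = Real.exp (u w)) : HSupport u := by
  refine ⟨hu, fun w z => ?_⟩
  obtain ⟨X, hX, hw⟩ := h w
  have := eq_bptH_of_le (hu.differentiableAt w) hX hw
  have h2 : bpt u w = X.1 := by rw [this]; rfl
  rw [h2]; exact hX z

/-! ### Inequalities for `p`-sums -/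

/-- The `p`-sum of two values of support functions. -/
def pLog (p a b g h : ℝ) : ℝ := 1 / p * Real.log (a * Real.exp (p * g) + b * Real.exp (p * h))

section Scalar

variable {p a b : ℝ}

lemma pLog_arg_pos (ha : 0 ≤ a) (hb : 0 ≤ b) (hab : 1 ≤ a + b) (x y : ℝ) :
    0 < a * Real.exp x + b * Real.exp y := by
  have hx := Real.exp_pos x
  have hy := Real.exp_pos y
  rcases ha.eq_or_lt with rfl | ha
  · have : 0 < b := by linarith
    nlinarith [mul_pos this hy]
  · nlinarith [mul_pos ha hx, mul_nonneg hb hy.le]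

lemma exp_mul_pLog (hp : 0 < p) (ha : 0 ≤ a) (hb : 0 ≤ b) (hab : 1 ≤ a + b) (g h : ℝ) :
    Real.exp (p * pLog p a b g h) = a * Real.exp (p * g) + b * Real.exp (p * h) := by
  rw [pLog, ← mul_assoc, mul_one_div_cancel hp.ne', one_mul,
    Real.exp_log (pLog_arg_pos ha hb hab _ _)]

/-- These weights are the partial derivatives of the p-sum in its two arguments, so the gradient of
a p-sum is a convex combination of gradients. -/
lemma pLog_weights (hp : 0 < p) (ha : 0 ≤ a) (hb : 0 ≤ b) (hab : 1 ≤ a + b) (g h : ℝ) :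
    a * Real.exp (p * (g - pLog p a b g h)) + b * Real.exp (p * (h - pLog p a b g h)) = 1 := by
  have h1 := exp_mul_pLog hp ha hb hab g h
  rw [mul_sub, mul_sub, Real.exp_sub, Real.exp_sub, h1]
  have := pLog_arg_pos ha hb hab (p * g) (p * h)
  field_simp

lemma exp_rpow (x y : ℝ) : Real.exp x ^ y = Real.exp (x * y) := (Real.exp_mul x y).symm

lemma jensen_aux {r g h u : ℝ} (hp : 0 < p) :
    a * Real.exp (p * (g - u)) * Real.exp (-r * g) + b * Real.exp (p * (h - u)) * Real.exp (-r * h)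
      = Real.exp (-r * u) * (a * Real.exp (p * (g - u)) * Real.exp (p * (u - g)) ^ (r / p)
        + b * Real.exp (p * (h - u)) * Real.exp (p * (u - h)) ^ (r / p)) := by
  have e : ∀ t, Real.exp (p * (u - t)) ^ (r / p) = Real.exp (r * (u - t)) := by
    intro t; rw [exp_rpow]; congr 1; field_simp
  have e2 : ∀ t, Real.exp (-r * t) = Real.exp (-r * u) * Real.exp (r * (u - t)) := by
    intro t; rw [← Real.exp_add]; congr 1; ring
  rw [e, e, e2 g, e2 h]; ring

lemma jensen_sum {g h u : ℝ} :
    a * Real.exp (p * (g - u)) * Real.exp (p * (u - g))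
      + b * Real.exp (p * (h - u)) * Real.exp (p * (u - h)) = a + b := by
  rw [mul_assoc, mul_assoc, ← Real.exp_add, ← Real.exp_add]
  ring_nf; simp

/-- Jensen's inequality for t^{r/p} at the points e^{p(u-g)} and e^{p(u-h)}, whose weighted mean is
a + b ≥ 1. -/
lemma jensen_exp {r g h u : ℝ} (hp : 0 < p) (ha : 0 ≤ a) (hb : 0 ≤ b) (hab : 1 ≤ a + b)
    (hr : p ≤ r) (hu : a * Real.exp (p * (g - u)) + b * Real.exp (p * (h - u)) = 1) :
    Real.exp (-r * u) ≤ a * Real.exp (p * (g - u)) * Real.exp (-r * g)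
      + b * Real.exp (p * (h - u)) * Real.exp (-r * h) := by
  have h1 := (convexOn_rpow ((one_le_div hp).mpr hr)).2
    (Real.exp_pos (p * (u - g))).le (Real.exp_pos (p * (u - h))).le
    (mul_nonneg ha (Real.exp_pos (p * (g - u))).le) (mul_nonneg hb (Real.exp_pos (p * (h - u))).le)
    hu
  simp only [smul_eq_mul] at h1
  rw [jensen_sum] at h1
  have h2 : 1 ≤ (a + b) ^ (r / p) := Real.one_le_rpow hab (div_pos (hp.trans_le hr) hp).le
  rw [jensen_aux hp]
  nlinarith [Real.exp_pos (-r * u)]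

/-- Strictness has two sources: either the mean a + b exceeds 1, or t^{r/p} is strictly convex, both
weights are positive and the two points differ. -/
lemma jensen_exp_strict {r g h u : ℝ} (hp : 0 < p) (ha : 0 ≤ a) (hb : 0 ≤ b) (hab : 1 ≤ a + b)
    (hr : p ≤ r) (hu : a * Real.exp (p * (g - u)) + b * Real.exp (p * (h - u)) = 1)
    (hs : 1 < a + b ∨ (0 < a ∧ 0 < b ∧ p < r ∧ g ≠ h)) :
    Real.exp (-r * u) < a * Real.exp (p * (g - u)) * Real.exp (-r * g)
      + b * Real.exp (p * (h - u)) * Real.exp (-r * h) := by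
  rw [jensen_aux hp]
  have h1 := (convexOn_rpow ((one_le_div hp).mpr hr)).2
    (Real.exp_pos (p * (u - g))).le (Real.exp_pos (p * (u - h))).le
    (mul_nonneg ha (Real.exp_pos (p * (g - u))).le) (mul_nonneg hb (Real.exp_pos (p * (h - u))).le)
    hu
  simp only [smul_eq_mul] at h1
  rw [jensen_sum] at h1
  have h2 : 1 ≤ (a + b) ^ (r / p) := Real.one_le_rpow hab (div_pos (hp.trans_le hr) hp).le
  rcases hs with hs | ⟨ha, hb, hr, hgh⟩
  · have h2 : 1 < (a + b) ^ (r / p) := Real.one_lt_rpow hs (div_pos (hp.trans_le hr) hp)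
    nlinarith [Real.exp_pos (-r * u)]
  · have h1 := (strictConvexOn_rpow ((one_lt_div hp).mpr hr)).2
      (Real.exp_pos (p * (u - g))).le (Real.exp_pos (p * (u - h))).le
      (by intro he
          have := mul_left_cancel₀ hp.ne' (Real.exp_injective he)
          exact hgh (by linarith))
      (mul_pos ha (Real.exp_pos (p * (g - u)))) (mul_pos hb (Real.exp_pos (p * (h - u)))) hu
    simp only [smul_eq_mul] at h1
    rw [jensen_sum] at h1
    nlinarith [Real.exp_pos (-r * u)]

/-- The defect of convexity is recorded exactly: it is discarded in `rpow_comb_le`, but in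
`hessForm_pLog` it yields the term in |Dg - Dh|². -/
lemma norm_comb_sq {V : Type*} [NormedAddCommGroup V] [InnerProductSpace ℝ V] {α β : ℝ}
    (h1 : α + β = 1) (v w : V) :
    ‖α • v + β • w‖ ^ 2 = α * ‖v‖ ^ 2 + β * ‖w‖ ^ 2 - α * β * ‖v - w‖ ^ 2 := by
  rw [norm_add_sq_real, norm_sub_sq_real, norm_smul, norm_smul, mul_pow, mul_pow,
    real_inner_smul_left, real_inner_smul_right, Real.norm_eq_abs, Real.norm_eq_abs, sq_abs, sq_abs]
  obtain rfl : β = 1 - α := by linarith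
  ring

/-- The convexity behind the two-point inequality for p-sums. For p ≥ 1 the squared norm is convex,
x^p is convex and increasing, and Jensen with exponent 2 handles e^{-2u}. -/
lemma rpow_comb_le {V : Type*} [NormedAddCommGroup V] [InnerProductSpace ℝ V] {g h u : ℝ}
    (hp₁ : 1 / 2 ≤ p) (hp₂ : p ≤ 2) (ha : 0 ≤ a) (hb : 0 ≤ b) (hab : 1 ≤ a + b)
    (hu : a * Real.exp (p * (g - u)) + b * Real.exp (p * (h - u)) = 1) (v w : V) :
    (Real.exp (-u) ^ 2 + ‖(a * Real.exp (p * (g - u))) • v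
        + (b * Real.exp (p * (h - u))) • w‖ ^ 2) ^ p
      ≤ a * Real.exp (p * (g - u)) * (Real.exp (-g) ^ 2 + ‖v‖ ^ 2) ^ p
        + b * Real.exp (p * (h - u)) * (Real.exp (-h) ^ 2 + ‖w‖ ^ 2) ^ p := by
  have hp : 0 < p := by linarith
  have hα : 0 ≤ a * Real.exp (p * (g - u)) := by positivity
  have hβ : 0 ≤ b * Real.exp (p * (h - u)) := by positivity
  rcases le_total 1 p with h1 | h1
  · have hJ := jensen_exp hp ha hb hab hp₂ hu
    set α := a * Real.exp (p * (g - u))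
    set β := b * Real.exp (p * (h - u))
    have e : ∀ t : ℝ, Real.exp (-2 * t) = Real.exp (-t) ^ 2 := by
      intro t; rw [← Real.exp_nat_mul]; congr 1; push_cast; ring
    rw [e, e, e] at hJ
    have hc := (convexOn_rpow h1).2 (x := Real.exp (-g) ^ 2 + ‖v‖ ^ 2)
      (y := Real.exp (-h) ^ 2 + ‖w‖ ^ 2) (by simp only [mem_Ici]; positivity)
      (by simp only [mem_Ici]; positivity) hα hβ hu
    simp only [smul_eq_mul] at hc
    refine le_trans (Real.rpow_le_rpow (by positivity) ?_ hp.le) hc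
    rw [norm_comb_sq hu]
    nlinarith [mul_nonneg (mul_nonneg hα hβ) (sq_nonneg ‖v - w‖)]
  · have hJ := jensen_exp hp ha hb hab h1 hu
    set α := a * Real.exp (p * (g - u))
    set β := b * Real.exp (p * (h - u))
    have e : ∀ t : ℝ, Real.exp (-1 * t) = Real.exp (-t) := fun t => by rw [neg_one_mul]
    rw [e, e, e] at hJ
    set s := Real.exp (-g)
    set t := Real.exp (-h)
    have hs : 0 ≤ s := (Real.exp_pos _).le
    have ht : 0 ≤ t := (Real.exp_pos _).le
    set A := s ^ 2 + ‖v‖ ^ 2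
    set B := t ^ 2 + ‖w‖ ^ 2
    have hA : 0 ≤ A := by positivity
    have hB : 0 ≤ B := by positivity
    -- For p ≤ 1 the power x^p is not convex in general, but 2p ≥ 1: convexity is applied to the
    -- norms √A and √B rather than to their squares.
    have e2 : ∀ x : ℝ, 0 ≤ x → x ^ p = Real.sqrt x ^ (2 * p) := by
      intro x hx
      rw [Real.rpow_mul (Real.sqrt_nonneg x), Real.rpow_two, Real.sq_sqrt hx]
    have hc := (convexOn_rpow (p := 2 * p) (by linarith)).2 (x := Real.sqrt A) (y := Real.sqrt B)
      (Real.sqrt_nonneg A) (Real.sqrt_nonneg B) hα hβ hu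
    simp only [smul_eq_mul] at hc
    rw [e2 A hA, e2 B hB, e2 _ (by positivity)]
    refine le_trans (Real.rpow_le_rpow (Real.sqrt_nonneg _) ?_ (by linarith)) hc
    refine Real.sqrt_le_iff.mpr ⟨by positivity, ?_⟩
    -- Cauchy–Schwarz for the plane vectors (s, ‖v‖) and (t, ‖w‖); this is the triangle inequality
    -- for √A and √B in squared form.
    have hcs : s * t + ‖v‖ * ‖w‖ ≤ Real.sqrt A * Real.sqrt B := by
      rw [← Real.sqrt_mul hA]
      refine Real.le_sqrt_of_sq_le ?_
      simp only [A, B]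
      nlinarith [sq_nonneg (s * ‖w‖ - t * ‖v‖)]
    have hn : ‖α • v + β • w‖ ≤ α * ‖v‖ + β * ‖w‖ := by
      refine (norm_add_le _ _).trans_eq ?_
      rw [norm_smul, norm_smul, Real.norm_of_nonneg hα, Real.norm_of_nonneg hβ]
    have h3 : Real.exp (-u) ^ 2 ≤ (α * s + β * t) ^ 2 :=
      pow_le_pow_left₀ (Real.exp_pos _).le hJ 2
    have h4 : ‖α • v + β • w‖ ^ 2 ≤ (α * ‖v‖ + β * ‖w‖) ^ 2 :=
      pow_le_pow_left₀ (norm_nonneg _) hn 2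
    have h5 : (α * Real.sqrt A + β * Real.sqrt B) ^ 2
        = α ^ 2 * A + β ^ 2 * B + 2 * (α * β) * (Real.sqrt A * Real.sqrt B) := by
      have := Real.sq_sqrt hA
      have := Real.sq_sqrt hB
      nlinarith
    rw [h5]
    have h6 := mul_le_mul_of_nonneg_left hcs (mul_nonneg hα hβ)
    simp only [A, B] at h6 ⊢
    nlinarith

lemma contDiffAt_pLog (ha : 0 ≤ a) (hb : 0 ≤ b) (hab : 1 ≤ a + b) (P : ℝ × ℝ) :
    ContDiffAt ℝ ∞ (fun P : ℝ × ℝ => pLog p a b P.1 P.2) P := by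
  unfold pLog
  refine contDiffAt_const.mul (ContDiffAt.log ?_ (pLog_arg_pos ha hb hab _ _).ne')
  fun_prop

end Scalar

/-! ### p-sums of horospherical support functions -/

section PSum

variable {p a b : ℝ} {g h : Sph n → ℝ}

lemma smoothSph_pLog (ha : 0 ≤ a) (hb : 0 ≤ b) (hab : 1 ≤ a + b)
    (hg : SmoothSph g) (hh : SmoothSph h) : SmoothSph fun z => pLog p a b (g z) (h z) :=
  hg.comp₂ hh (F := fun P => pLog p a b P.1 P.2) fun _ => contDiffAt_pLog ha hb hab _

lemma hasDerivAt_pLog (hp : 0 < p) (ha : 0 ≤ a) (hb : 0 ≤ b) (hab : 1 ≤ a + b)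
    {g h : ℝ → ℝ} {g' h' s : ℝ} (hg : HasDerivAt g g' s) (hh : HasDerivAt h h' s) :
    HasDerivAt (fun s => pLog p a b (g s) (h s))
      (a * Real.exp (p * (g s - pLog p a b (g s) (h s))) * g'
        + b * Real.exp (p * (h s - pLog p a b (g s) (h s))) * h') s := by
  have h1 := (((((hg.const_mul p).exp.const_mul a).add ((hh.const_mul p).exp.const_mul b)).log
    (pLog_arg_pos ha hb hab _ _).ne').const_mul (1 / p))
  convert! h1 using 1
  rw [mul_sub, mul_sub, Real.exp_sub, Real.exp_sub, exp_mul_pLog hp ha hb hab]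
  have := pLog_arg_pos ha hb hab (p * g s) (p * h s)
  simp only [Pi.add_apply]
  field_simp

lemma fderiv_radialExt_eq {u : Sph n → ℝ} (hu : SmoothSph u) (z : Sph n) (ζ : Euc n) :
    HasDerivAt (fun s : ℝ => radialExt u ((z : Euc n) + s • ζ))
      (fderiv ℝ (radialExt u) (z : Euc n) ζ) 0 := by
  have h1 : HasDerivAt (fun s : ℝ => (z : Euc n) + s • ζ) ζ 0 := by
    simpa using ((hasDerivAt_id (0 : ℝ)).smul_const ζ).const_add (z : Euc n)
  refine HasFDerivAt.comp_hasDerivAt (l := radialExt u) (0 : ℝ) ?_ h1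
  simpa using (hu.differentiableAt z).hasFDerivAt

lemma line_ne_zero (z : Sph n) (ζ : Euc n) : ∀ᶠ s : ℝ in 𝓝 0, (z : Euc n) + s • ζ ≠ 0 := by
  have : ContinuousAt (fun s : ℝ => (z : Euc n) + s • ζ) 0 := by fun_prop
  exact this.eventually_ne (by simpa using sph_ne_zero z)

lemma sphGrad_pLog (hp : 0 < p) (ha : 0 ≤ a) (hb : 0 ≤ b) (hab : 1 ≤ a + b)
    (hg : SmoothSph g) (hh : SmoothSph h) (z : Sph n) :
    sphGrad (fun z => pLog p a b (g z) (h z)) z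
      = (a * Real.exp (p * (g z - pLog p a b (g z) (h z)))) • sphGrad g z
        + (b * Real.exp (p * (h z - pLog p a b (g z) (h z)))) • sphGrad h z := by
  refine ext_inner_right ℝ fun ζ => ?_
  rw [inner_add_left, real_inner_smul_left, real_inner_smul_left, inner_sphGrad, inner_sphGrad,
    inner_sphGrad]
  have h1 := fderiv_radialExt_eq (smoothSph_pLog (p := p) ha hb hab hg hh) z ζ
  have h2 := hasDerivAt_pLog hp ha hb hab (fderiv_radialExt_eq hg z ζ) (fderiv_radialExt_eq hh z ζ)
  simp only [zero_smul, add_zero, radialExt_coe] at h2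
  refine h1.unique (h2.congr_of_eventuallyEq ?_)
  filter_upwards [line_ne_zero z ζ] with s hs
  simp only [radialExt_of_ne _ hs]

/-- `p`-sums of horospherical support functions are horospherical support functions. -/
theorem hSupport_pLog (hp₁ : 1 / 2 ≤ p) (hp₂ : p ≤ 2) (ha : 0 ≤ a) (hb : 0 ≤ b) (hab : 1 ≤ a + b)
    (hg : HSupport g) (hh : HSupport h) : HSupport fun z => pLog p a b (g z) (h z) := by
  have hp : 0 < p := by linarith
  refine ⟨smoothSph_pLog ha hb hab hg.smooth hh.smooth, fun w z => ?_⟩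
  -- The formula for h_z(X(w)) degenerates at w = z, where both sides equal e^{u(z)}.
  by_cases hc : 1 - inner ℝ (w : Euc n) (z : Euc n) = 0
  · rw [eq_of_inner_eq_one w z hc, hfn_bpt_self]
  have hc0 : 0 < 1 - inner ℝ (w : Euc n) (z : Euc n) := by
    refine lt_of_le_of_ne ?_ (Ne.symm hc)
    have := real_inner_le_norm (w : Euc n) (z : Euc n)
    rw [sph_norm, sph_norm] at this; linarith
  have h1 := hg.le w z
  have h2 := hh.le w z
  rw [hfn_bpt _ _ _ hc] at h1 h2 ⊢
  rw [sphGrad_pLog hp ha hb hab hg.smooth hh.smooth]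
  set c := 1 - inner ℝ (w : Euc n) (z : Euc n)
  set y := c⁻¹ • ((z : Euc n) - inner ℝ (w : Euc n) (z : Euc n) • (w : Euc n))
  have hw := pLog_weights hp ha hb hab (g w) (h w)
  have hwe := exp_mul_pLog hp ha hb hab (g w) (h w)
  have hze := exp_mul_pLog hp ha hb hab (g z) (h z)
  set u := pLog p a b (g w) (h w)
  set uz := pLog p a b (g z) (h z)
  -- Since the weights sum to one, the shift y distributes over the convex combination.
  have hy : (a * Real.exp (p * (g w - u))) • sphGrad g w
      + (b * Real.exp (p * (h w - u))) • sphGrad h w + y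
      = (a * Real.exp (p * (g w - u))) • (sphGrad g w + y)
      + (b * Real.exp (p * (h w - u))) • (sphGrad h w + y) := by
    have : y = (a * Real.exp (p * (g w - u)) + b * Real.exp (p * (h w - u))) • y := by
      rw [hw, one_smul]
    nth_rw 1 [this]; module
  rw [hy, ← Real.rpow_le_rpow_iff (by positivity) (by positivity) hp]
  have key := rpow_comb_le hp₁ hp₂ ha hb hab hw (sphGrad g w + y) (sphGrad h w + y)
  rw [Real.mul_rpow (by positivity) (by positivity), Real.mul_rpow (by positivity) (by positivity),
    exp_rpow, exp_rpow, mul_comm uz p, hze, mul_comm u p]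
  have e1 := Real.rpow_le_rpow (by positivity) h1 hp.le
  have e2 := Real.rpow_le_rpow (by positivity) h2 hp.le
  rw [Real.mul_rpow (by positivity) (by positivity), Real.mul_rpow (by positivity) (by positivity),
    exp_rpow, exp_rpow, mul_comm _ p, mul_comm _ p] at e1 e2
  have f : ∀ t, Real.exp (p * u) * Real.exp (p * (t - u)) = Real.exp (p * t) := by
    intro t; rw [← Real.exp_add]; congr 1; ring
  refine (mul_le_mul_of_nonneg_left key (by positivity)).trans ?_
  have := add_le_add (mul_le_mul_of_nonneg_left e1 ha) (mul_le_mul_of_nonneg_left e2 hb)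
  refine le_of_eq_of_le ?_ this
  rw [← f (g w), ← f (h w)]
  ring

end PSum

lemma hSupport_point (X : Hyp n) : HSupport fun z : Sph n => Real.log (hfn X.1 z) :=
  hSupport_of_touching (smoothSph_log_hfn X) fun w =>
    ⟨X, fun z => by rw [Real.exp_log (hfn_pos X z)], by rw [Real.exp_log (hfn_pos X w)]⟩

lemma supportFn_singleton (X : Hyp n) : supportFn {X} = fun z : Sph n => Real.log (hfn X.1 z) := by
  ext z
  exact supportFn_eq_of_isMax (mem_singleton X) (by rintro Y rfl; rfl)

/-! ### Normalization of timelike vectors -/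

/-- The rescaling of a timelike vector to `⟨Y, Y⟩ = -1`. -/
def nrm (Y : Mink n) : Mink n := (Real.sqrt (-lor Y Y))⁻¹ • Y

lemma normalize_val (Y : Mink n) (h : ‖Y.1‖ < Y.2) : (normalize Y h).1 = nrm Y := rfl

lemma nrm_hyp (X : Hyp n) : nrm X.1 = X.1 := by
  rw [nrm, X.2.1]; simp

lemma contDiffAt_nrm {Y : Mink n} (h : ‖Y.1‖ < Y.2) : ContDiffAt ℝ ∞ nrm Y := by
  have h0 : 0 < -lor Y Y := neg_pos.mpr (lor_self_neg h)
  have h1 : ContDiffAt ℝ ∞ (fun Y : Mink n => -lor Y Y) Y :=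
    (contDiff_lor.comp (contDiff_id.prodMk contDiff_id)).contDiffAt.neg
  exact ((h1.sqrt h0.ne').inv (Real.sqrt_pos.mpr h0).ne').smul contDiffAt_id

lemma isOpen_future : IsOpen {Y : Mink n | ‖Y.1‖ < Y.2} :=
  isOpen_lt (by fun_prop) (by fun_prop)

lemma eventually_normalize_mem {X : Hyp n} {U : Set (Hyp n)} (hU : U ∈ 𝓝 X) :
    ∀ᶠ Y in 𝓝 X.1, ∃ h : ‖Y.1‖ < Y.2, normalize Y h ∈ U := by
  obtain ⟨V, hV, hVU⟩ := mem_nhds_subtype _ _ _ |>.mp hU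
  have h1 : Tendsto nrm (𝓝 X.1) (𝓝 X.1) := by
    have := (contDiffAt_nrm (hyp_norm_lt X)).continuousAt.tendsto
    rwa [nrm_hyp] at this
  filter_upwards [isOpen_future.mem_nhds (hyp_norm_lt X), h1 hV] with Y hY hYV
  exact ⟨hY, hVU hYV⟩

/-- Passing to X - s(z,1) keeps h_z but lowers -⟨·,·⟩ to 1 - 2s h_z(X), so rescaling to the
hyperboloid increases h_z. Thus h_z has no interior maximum. -/
lemma exists_hfn_gt (X : Hyp n) (z : Sph n) {U : Set (Hyp n)} (hU : U ∈ 𝓝 X) :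
    ∃ Y ∈ U, hfn X.1 z < hfn Y.1 z := by
  have hc : Tendsto (fun s : ℝ => X.1 - s • ((z : Euc n), (1 : ℝ))) (𝓝 0) (𝓝 X.1) := by
    have : ContinuousAt (fun s : ℝ => X.1 - s • ((z : Euc n), (1 : ℝ))) 0 := by fun_prop
    simpa [ContinuousAt] using this
  have h1 : ∀ᶠ s : ℝ in 𝓝[>] 0, 0 < s := self_mem_nhdsWithin
  obtain ⟨s, ⟨h, hs⟩, hs0⟩ :=
    (((hc.eventually (eventually_normalize_mem hU)).filter_mono nhdsWithin_le_nhds).and h1).exists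
  refine ⟨_, hs, ?_⟩
  set Z : Mink n := ((z : Euc n), (1 : ℝ)) with hZ
  have hX := hfn_pos X z
  have hXZ : lor X.1 Z = -hfn X.1 z := by rw [hfn_eq]; ring
  have hZZ : lor Z Z = 0 := by simp [lor, hZ]
  have hl : -lor (X.1 - s • Z) (X.1 - s • Z) = 1 - 2 * s * hfn X.1 z := by
    simp only [lor_sub_left, lor_sub_right, lor_smul_left, lor_smul_right, X.2.1, hXZ, hZZ,
      lor_comm Z X.1]
    ring
  have h0 : 0 < -lor (X.1 - s • Z) (X.1 - s • Z) := neg_pos.mpr (lor_self_neg h)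
  have hv : hfn (X.1 - s • Z) z = hfn X.1 z := by
    simp only [hfn_eq, lor_sub_left, lor_smul_left]
    rw [← hZ, hZZ]; ring
  rw [normalize_val, nrm, hfn_smul, hv]
  have h2 : Real.sqrt (-lor (X.1 - s • Z) (X.1 - s • Z)) < 1 := by
    rw [Real.sqrt_lt' one_pos, hl]; nlinarith
  have h3 := (one_lt_inv₀ (Real.sqrt_pos.mpr h0)).mpr h2
  nlinarith

/-- The point on the geodesic from `X` to `Y`. -/
def geo (X Y : Hyp n) (t : Icc (0 : ℝ) 1) : Hyp n :=
  normalize ((1 - t.1) • X.1 + t.1 • Y.1)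
    (norm_lt_add (by linarith [t.2.2]) t.2.1 (by linarith) (hyp_norm_lt X) (hyp_norm_lt Y))

lemma continuous_geo (X Y : Hyp n) : Continuous (geo X Y) := by
  refine Continuous.subtype_mk ?_ _
  rw [continuous_iff_continuousAt]
  intro t
  have h1 := (contDiffAt_nrm (norm_lt_add (a := 1 - t.1) (b := t.1) (by linarith [t.2.2]) t.2.1
    (by linarith) (hyp_norm_lt X) (hyp_norm_lt Y))).continuousAt
  exact ContinuousAt.comp (g := nrm) (f := fun t : Icc (0 : ℝ) 1 => (1 - t.1) • X.1 + t.1 • Y.1)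
    h1 (by fun_prop)

lemma geo_zero (X Y : Hyp n) : geo X Y ⟨0, by simp⟩ = X := by
  apply Subtype.ext; simp [geo, normalize_val, nrm_hyp]

lemma geo_one (X Y : Hyp n) : geo X Y ⟨1, by simp⟩ = Y := by
  apply Subtype.ext; simp [geo, normalize_val, nrm_hyp]

/-- h_z is linear on Minkowski space, and vectors Y on a chord of the hyperboloid satisfy -⟨Y,Y⟩ ≥
1, so the radial projection to the geodesic can only decrease h_z. -/
lemma hfn_geo_le (X Y : Hyp n) (t : Icc (0 : ℝ) 1) (z : Sph n) :
    hfn (geo X Y t).1 z ≤ (1 - t.1) * hfn X.1 z + t.1 * hfn Y.1 z := by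
  have ht0 := t.2.1
  have ht1 := t.2.2
  have hX := hfn_pos X z
  have hY := hfn_pos Y z
  rw [geo, normalize_val, nrm, hfn_smul, hfn_add, hfn_smul, hfn_smul]
  have h1 : 1 ≤ Real.sqrt (-lor ((1 - t.1) • X.1 + t.1 • Y.1) ((1 - t.1) • X.1 + t.1 • Y.1)) := by
    rw [Real.one_le_sqrt, lor_comb]
    have h3 := hyp_lor_le X Y
    have h4 : 0 ≤ 2 * (1 - t.1) * t.1 * (-lor X.1 Y.1 - 1) :=
      mul_nonneg (by nlinarith) (by linarith)
    nlinarith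
  have h2 := inv_le_one_of_one_le₀ h1
  have h3 : 0 ≤ (1 - t.1) * hfn X.1 z + t.1 * hfn Y.1 z :=
    add_nonneg (mul_nonneg (by linarith) hX.le) (mul_nonneg ht0 hY.le)
  nlinarith

/-- For distinct endpoints the normalising factor is strictly below one. This strictness gives
interior points to a hull that is not a single point. -/
lemma hfn_geo_half_lt {X Y : Hyp n} (hXY : X ≠ Y) (z : Sph n) :
    hfn (geo X Y ⟨1 / 2, by norm_num, by norm_num⟩).1 z
      < 1 / 2 * hfn X.1 z + 1 / 2 * hfn Y.1 z := by
  have hX := hfn_pos X z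
  have hY := hfn_pos Y z
  rw [geo, normalize_val, nrm, hfn_smul, hfn_add, hfn_smul, hfn_smul]
  have h1 : 1 < Real.sqrt (-lor ((1 - 1 / 2 : ℝ) • X.1 + (1 / 2 : ℝ) • Y.1)
      ((1 - 1 / 2 : ℝ) • X.1 + (1 / 2 : ℝ) • Y.1)) := by
    rw [Real.lt_sqrt one_pos.le, lor_comb]
    have h3 : lor X.1 Y.1 < -1 := by
      by_contra! h; exact hXY (eq_of_lor_eq h)
    linarith
  have h2 := inv_lt_one_of_one_lt₀ h1
  simp only at h2 ⊢
  nlinarith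

/-! ### The intersection of horo-balls -/

/-- The intersection of all horo-balls prescribed by `u`. -/
def horoHull (u : Sph n → ℝ) : Set (Hyp n) := {X | ∀ z : Sph n, hfn X.1 z ≤ Real.exp (u z)}

lemma mem_interior_horoHull {u : Sph n → ℝ} (hu : Continuous u) {X : Hyp n}
    (h : ∀ z : Sph n, hfn X.1 z < Real.exp (u z)) : X ∈ interior (horoHull u) := by
  rw [mem_interior_iff_mem_nhds]
  have h1 := isCompact_univ.eventually_forall_of_forall_eventually (x₀ := X)
    (P := fun (Y : Hyp n) (z : Sph n) => hfn Y.1 z < Real.exp (u z)) (K := univ) (fun z _ => by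
      have hc : Continuous fun q : Hyp n × Sph n => hfn q.1.1 q.2 :=
        continuous_hfn.comp ((continuous_subtype_val.comp continuous_fst).prodMk
          (continuous_subtype_val.comp continuous_snd))
      have hc2 : Continuous fun q : Hyp n × Sph n => Real.exp (u q.2) :=
        Real.continuous_exp.comp (hu.comp continuous_snd)
      exact (isOpen_lt hc hc2).mem_nhds (h z))
  filter_upwards [h1] with Y hY z
  exact (hY z (mem_univ z)).le

lemma exists_eq_of_mem_frontier_horoHull {u : Sph n → ℝ} (hu : Continuous u) {X : Hyp n}
    (hX : X ∈ horoHull u) (hf : X ∈ frontier (horoHull u)) :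
    ∃ z : Sph n, hfn X.1 z = Real.exp (u z) := by
  by_contra! h
  exact hf.2 (mem_interior_horoHull hu fun z => lt_of_le_of_ne (hX z) (h z))

lemma isCompact_horoHull {u : Sph n → ℝ} (hu : Continuous u) : IsCompact (horoHull u) := by
  rw [Subtype.isCompact_iff]
  have himg : (Subtype.val '' horoHull u : Set (Mink n))
      = {Y | lor Y Y = -1} ∩ {Y | 0 ≤ Y.2} ∩ ⋂ z : Sph n, {Y | hfn Y z ≤ Real.exp (u z)} := by
    ext Y
    simp only [mem_image, mem_inter_iff, mem_ofPred_eq, mem_iInter]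
    constructor
    · rintro ⟨X, hX, rfl⟩
      exact ⟨⟨X.2.1, X.2.2.le⟩, hX⟩
    · rintro ⟨⟨h1, h2⟩, h3⟩
      refine ⟨⟨Y, h1, lt_of_le_of_ne h2 ?_⟩, h3, rfl⟩
      intro h0
      simp only [lor, ← h0, real_inner_self_eq_norm_sq] at h1
      nlinarith [norm_nonneg Y.1]
  obtain ⟨z₀, -, hM⟩ := isCompact_univ.exists_isMaxOn (s := (univ : Set (Sph n)))
    ⟨⟨EuclideanSpace.single 0 1, by simp⟩, mem_univ _⟩ hu.continuousOn
  refine Metric.isCompact_of_isClosed_isBounded ?_ ?_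
  · rw [himg]
    refine ((isClosed_eq ?_ continuous_const).inter (isClosed_le continuous_const
      continuous_snd)).inter (isClosed_iInter fun z => isClosed_le ?_ continuous_const)
    · exact continuous_lor.comp (continuous_id.prodMk continuous_id)
    · exact continuous_hfn.comp (continuous_id.prodMk continuous_const)
  · refine (Metric.isBounded_closedBall (x := (0 : Mink n)) (r := Real.exp (u z₀))).subset ?_
    rintro _ ⟨X, hX, rfl⟩
    have hn := hyp_norm_lt X
    have hX2 := X.2.2
    -- In the direction -x/|x| the value of h is x_{n+1} + |x|, so the largest prescribed level
    -- bounds the last coordinate.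
    have key : X.1.2 ≤ Real.exp (u z₀) := by
      by_cases h0 : X.1.1 = 0
      · refine le_trans (le_of_eq ?_) (hX z₀)
        simp [hfn, h0]
      · have hx := norm_pos_iff.mpr h0
        have h1 := hX (sphProj (-X.1.1) (neg_ne_zero.mpr h0))
        have h2 : u (sphProj (-X.1.1) (neg_ne_zero.mpr h0)) ≤ u z₀ := hM (mem_univ _)
        have h3 := Real.exp_le_exp.mpr h2
        have h4 : (0 : ℝ) ≤ ‖X.1.1‖⁻¹ * (‖X.1.1‖ ^ 2) := by positivity
        have h5 : hfn X.1 (sphProj (-X.1.1) (neg_ne_zero.mpr h0))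
            = X.1.2 + ‖X.1.1‖⁻¹ * (‖X.1.1‖ ^ 2) := by
          simp only [hfn, sphProj, norm_neg, smul_neg, inner_neg_right, real_inner_smul_right,
            real_inner_self_eq_norm_sq]
          ring
        linarith
    rw [mem_closedBall_zero_iff, Prod.norm_def, max_le_iff, Real.norm_of_nonneg hX2.le]
    exact ⟨hn.le.trans key, key⟩

lemma HSupport.bptH_mem {u : Sph n → ℝ} (hu : HSupport u) (z : Sph n) : bptH u z ∈ horoHull u :=
  fun w => hu.le z w

lemma supportFn_horoHull {u : Sph n → ℝ} (hu : HSupport u) : supportFn (horoHull u) = u := by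
  ext z
  have h : hfn (bptH u z).1 z = Real.exp (u z) := hfn_bpt_self u z
  rw [supportFn_eq_of_isMax (hu.bptH_mem z) (fun Y hY => by rw [h]; exact hY z), h, Real.log_exp]

/-- The midpoint of two distinct points of the hull lies strictly inside every horo-ball, so the
hull has interior unless it is a point. By compactness of the sphere, a boundary point must lie on
one of the prescribed horospheres. -/
lemma isHConvexDomain_horoHull {u : Sph n → ℝ} (hu : HSupport u) :
    IsHConvexDomain (horoHull u) := by
  have hcu := hu.smooth.continuous
  have hc := isCompact_horoHull hcu
  refine ⟨hc, ?_, fun X hX => ?_⟩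
  · by_cases hsub : (horoHull u).Subsingleton
    · right
      have z : Sph n := ⟨EuclideanSpace.single 0 1, by simp⟩
      exact ⟨bptH u z, hsub.eq_singleton_of_mem (hu.bptH_mem z)⟩
    · left
      rw [not_subsingleton_iff] at hsub
      obtain ⟨X, hX, Y, hY, hXY⟩ := hsub
      refine ⟨_, mem_interior_horoHull hcu (X := geo X Y ⟨1 / 2, by norm_num, by norm_num⟩) ?_⟩
      intro z
      have := hfn_geo_half_lt hXY z
      linarith [hX z, hY z]
  · have hXm := hc.isClosed.frontier_subset hX
    obtain ⟨z, hz⟩ := exists_eq_of_mem_frontier_horoHull hcu hXm hX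
    exact ⟨z, u z, fun Y hY => mem_closedHoroball.mpr (hY z), mem_horosphere.mpr hz⟩

/-- If Y is in the hull but not in Ω, the geodesic from an interior point O to Y crosses ∂Ω before
Y. At the crossing there is a supporting horosphere; O lies strictly inside it and Y not outside,
contradicting the convexity of h_z along the geodesic. -/
lemma eq_horoHull {Ω : Set (Hyp n)} (hΩ : IsHConvexDomain Ω) : Ω = horoHull (supportFn Ω) := by
  have hc := hΩ.isCompact
  refine Subset.antisymm (fun X hX z => hfn_le_exp_supportFn hc hX z) fun Y hY => ?_
  by_contra hYΩ
  rcases hΩ.interior_or_point with ⟨O, hO⟩ | ⟨X, rfl⟩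
  · obtain ⟨t, ht⟩ : (frontier (geo O Y ⁻¹' Ω)).Nonempty := by
      have : PreconnectedSpace (Icc (0 : ℝ) 1) :=
        Subtype.preconnectedSpace isPreconnected_Icc
      refine nonempty_frontier_iff.mpr ⟨⟨⟨0, by simp⟩, ?_⟩, fun h => hYΩ ?_⟩
      · rw [mem_preimage, geo_zero]; exact interior_subset hO
      · have h2 : (⟨1, by simp⟩ : Icc (0 : ℝ) 1) ∈ geo O Y ⁻¹' Ω := by rw [h]; exact mem_univ _
        rwa [mem_preimage, geo_one] at h2
    have hX := (continuous_geo O Y).frontier_preimage_subset Ω ht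
    rw [mem_preimage] at hX
    have ht : t.1 < 1 := by
      refine lt_of_le_of_ne t.2.2 fun h => hYΩ ?_
      have hXm := hc.isClosed.frontier_subset hX
      have : t = ⟨1, by simp⟩ := Subtype.ext h
      rwa [this, geo_one] at hXm
    obtain ⟨z, r, hsub, hXz⟩ := hΩ.supporting _ hX
    rw [mem_horosphere] at hXz
    obtain ⟨X', hX', hX'z⟩ := exists_hfn_eq_exp_supportFn hc ⟨O, interior_subset hO⟩ z
    have h1 : hfn Y.1 z ≤ Real.exp r := by
      refine (hY z).trans ?_
      rw [← hX'z]; exact mem_closedHoroball.mp (hsub hX')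
    have h2 : hfn O.1 z < Real.exp r := by
      obtain ⟨O', hO', hlt⟩ := exists_hfn_gt O z (mem_interior_iff_mem_nhds.mp hO)
      exact hlt.trans_le (mem_closedHoroball.mp (hsub hO'))
    have h3 := hfn_geo_le O Y t z
    rw [hXz] at h3
    nlinarith [t.2.1, Real.exp_pos r]
  · refine hYΩ (mem_singleton_iff.mpr (eq_of_hfn_le fun z => ?_))
    have := hY z
    rwa [supportFn_singleton, Real.exp_log (hfn_pos X z)] at this

lemma mem_frontier_of_hfn_eq {Ω : Set (Hyp n)} {u : Sph n → ℝ} (hΩ : Ω ⊆ horoHull u) {X : Hyp n}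
    (hX : X ∈ Ω) {z : Sph n} (h : hfn X.1 z = Real.exp (u z)) : X ∈ frontier Ω := by
  refine ⟨subset_closure hX, fun hi => ?_⟩
  obtain ⟨Y, hY, hlt⟩ := exists_hfn_gt X z (mem_interior_iff_mem_nhds.mp hi)
  have := hΩ hY z
  linarith

lemma frontier_horoHull {u : Sph n → ℝ} (hu : HSupport u) :
    frontier (horoHull u) = range (bptH u) := by
  have hcu := hu.smooth.continuous
  ext X
  constructor
  · intro hX
    have hXm := (isCompact_horoHull hcu).isClosed.frontier_subset hX
    obtain ⟨z, hz⟩ := exists_eq_of_mem_frontier_horoHull hcu hXm hX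
    exact ⟨z, (eq_bptH_of_le (hu.smooth.differentiableAt z) hXm hz).symm⟩
  · rintro ⟨z, rfl⟩
    exact mem_frontier_of_hfn_eq subset_rfl (hu.bptH_mem z) (hfn_bpt_self u z)

lemma isConnected_horoHull {u : Sph n → ℝ} (hu : HSupport u) : IsConnected (horoHull u) := by
  have z : Sph n := ⟨EuclideanSpace.single 0 1, by simp⟩
  refine ⟨⟨_, hu.bptH_mem z⟩, isPreconnected_of_forall_pair fun X hX Y hY => ?_⟩
  refine ⟨range (geo X Y), ?_, ⟨_, geo_zero X Y⟩, ⟨_, geo_one X Y⟩,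
    isPreconnected_range (continuous_geo X Y)⟩
  rintro _ ⟨t, rfl⟩ z
  have h := hfn_geo_le X Y t z
  nlinarith [hX z, hY z, t.2.1, t.2.2]

/-! ### The Hessian form of a horospherical support function -/

/-- The bilinear form `D²u + Du ⊗ Du + ½ (1 - |Du|² - e^{-2u}) g` on the sphere. -/
def hessForm (u : Sph n → ℝ) (z : Sph n) (ζ ξ : Euc n) : ℝ :=
  fderiv ℝ (fderiv ℝ (radialExt u)) (z : Euc n) ζ ξ
    + inner ℝ (sphGrad u z) ζ * inner ℝ (sphGrad u z) ξ
    + (1 - ‖sphGrad u z‖ ^ 2 - Real.exp (-2 * u z)) / 2 * inner ℝ ζ ξ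

/-- `hessForm u` is positive definite on the tangent spaces of the sphere. -/
def HessPos (u : Sph n → ℝ) : Prop :=
  ∀ (z : Sph n) (ζ : Euc n), inner ℝ (z : Euc n) ζ = 0 → ζ ≠ 0 → 0 < hessForm u z ζ ζ

/-- If f'' were negative, 0 would be a local maximum as well, so f would vanish near 0 and f'' with
it. -/
lemma nonneg_second_deriv {f f' : ℝ → ℝ} {f'' : ℝ} (hf : ∀ᶠ s in 𝓝 0, 0 ≤ f s) (h0 : f 0 = 0)
    (h1 : ∀ᶠ s in 𝓝 0, HasDerivAt f (f' s) s) (h2 : HasDerivAt f' f'' 0) : 0 ≤ f'' := by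
  by_contra! hneg
  have hd : deriv f =ᶠ[𝓝 0] f' := h1.mono fun s hs => hs.deriv
  have hmin : IsLocalMin f 0 := hf.mono fun s hs => by rw [h0]; exact hs
  have hd2 : deriv (deriv f) 0 = f'' := by rw [hd.deriv_eq, h2.deriv]
  have hmax := isLocalMax_of_deriv_deriv_neg (hd2 ▸ hneg) hmin.deriv_eq_zero
    h1.self_of_nhds.continuousAt
  have hz : f =ᶠ[𝓝 0] fun _ => 0 := by
    filter_upwards [hf, hmax] with s h3 h4
    rw [h0] at h4
    exact le_antisymm h4 h3
  have : deriv f =ᶠ[𝓝 0] fun _ => 0 := by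
    refine hz.deriv.trans (.of_eq ?_)
    funext s; simp
  rw [this.deriv_eq] at hd2
  simp at hd2
  exact hneg.ne hd2.symm

lemma SmoothSph.hasDerivAt_line {u : Sph n → ℝ} (hu : SmoothSph u) (z : Sph n) (ζ : Euc n) :
    ∀ᶠ s : ℝ in 𝓝 0, HasDerivAt (fun s : ℝ => radialExt u ((z : Euc n) + s • ζ))
      (fderiv ℝ (radialExt u) ((z : Euc n) + s • ζ) ζ) s := by
  filter_upwards [line_ne_zero z ζ] with s hs
  have h1 : HasDerivAt (fun s : ℝ => (z : Euc n) + s • ζ) ζ s := by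
    simpa using ((hasDerivAt_id s).smul_const ζ).const_add (z : Euc n)
  exact (((hu _ hs).differentiableAt (by simp)).hasFDerivAt).comp_hasDerivAt s h1

lemma SmoothSph.contDiffAt_fderiv {u : Sph n → ℝ} (hu : SmoothSph u) {x : Euc n} (hx : x ≠ 0) :
    ContDiffAt ℝ ∞ (fderiv ℝ (radialExt u)) x :=
  (hu x hx).fderiv_right (m := ∞) (by simp)

lemma SmoothSph.hasDerivAt_line_fderiv {u : Sph n → ℝ} (hu : SmoothSph u) (z : Sph n)
    (ζ ξ : Euc n) : HasDerivAt (fun s : ℝ => fderiv ℝ (radialExt u) ((z : Euc n) + s • ζ) ξ)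
      (fderiv ℝ (fderiv ℝ (radialExt u)) (z : Euc n) ζ ξ) 0 := by
  have h1 : HasDerivAt (fun s : ℝ => (z : Euc n) + s • ζ) ζ 0 := by
    simpa using ((hasDerivAt_id (0 : ℝ)).smul_const ζ).const_add (z : Euc n)
  have h2 : HasFDerivAt (fderiv ℝ (radialExt u))
      (fderiv ℝ (fderiv ℝ (radialExt u)) (z : Euc n)) ((z : Euc n) + (0 : ℝ) • ζ) := by
    rw [zero_smul, add_zero]
    exact ((hu.contDiffAt_fderiv (sph_ne_zero z)).differentiableAt (by simp)).hasFDerivAt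
  have h3 := h2.comp_hasDerivAt (0 : ℝ) h1
  exact ((ContinuousLinearMap.apply ℝ ℝ ξ).hasFDerivAt).comp_hasDerivAt (0 : ℝ) h3

/-- This produces the coefficient of the metric in `hessForm`. -/
lemma hfn_bpt_snd (u : Sph n → ℝ) (z : Sph n) : Real.exp (u z) - (bpt u z).2
    = Real.exp (u z) * ((1 - ‖sphGrad u z‖ ^ 2 - Real.exp (-2 * u z)) / 2) := by
  rw [bpt_snd]; ring

/-- For fixed X = X(z) the function e^{u(w)} - h_w(X) of w is non-negative and vanishes at w = z;
its Hessian there is e^{u(z)} times the form. -/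
lemma HSupport.hessForm_nonneg {u : Sph n → ℝ} (hu : HSupport u) {z : Sph n} {ζ : Euc n}
    (hζ : inner ℝ (z : Euc n) ζ = 0) : 0 ≤ hessForm u z ζ ζ := by
  set X := bpt u z with hX
  set N : ℝ → ℝ := fun s => Real.sqrt (1 + s ^ 2 * ‖ζ‖ ^ 2) with hN
  have hNn : ∀ s : ℝ, ‖(z : Euc n) + s • ζ‖ = N s := by
    intro s
    rw [hN, ← Real.sqrt_sq (norm_nonneg ((z : Euc n) + s • ζ)), norm_add_sq_real, sph_norm,
      real_inner_smul_right, hζ, norm_smul, mul_pow, Real.norm_eq_abs, sq_abs]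
    ring_nf
  have hN0 : N 0 = 1 := by simp [hN]
  have hNpos : ∀ s, 0 < N s := fun s => Real.sqrt_pos.mpr (by positivity)
  have hNd : ∀ s, HasDerivAt N (s * ‖ζ‖ ^ 2 / N s) s := by
    intro s
    have h1 : HasDerivAt (fun s : ℝ => 1 + s ^ 2 * ‖ζ‖ ^ 2) (2 * s * ‖ζ‖ ^ 2) s := by
      simpa using (((hasDerivAt_id s).pow 2).mul_const (‖ζ‖ ^ 2)).const_add 1
    have h2 := h1.sqrt (by positivity)
    convert! h2 using 1
    have := hNpos s
    simp only [hN] at this ⊢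
    field_simp
  have hNd2 : HasDerivAt (fun s => s * ‖ζ‖ ^ 2 / N s) (‖ζ‖ ^ 2) 0 := by
    have := ((hasDerivAt_id (0 : ℝ)).mul_const (‖ζ‖ ^ 2)).div (hNd 0) (hNpos 0).ne'
    convert! this using 1
    simp [hN0]
  set U : ℝ → ℝ := fun s => radialExt u ((z : Euc n) + s • ζ) with hU
  set U' : ℝ → ℝ := fun s => fderiv ℝ (radialExt u) ((z : Euc n) + s • ζ) ζ with hU'
  have hU0 : U 0 = u z := by simp [hU, radialExt_coe]
  have hU'0 : U' 0 = inner ℝ (sphGrad u z) ζ := by simp [hU', inner_sphGrad]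
  have hUd := hu.smooth.hasDerivAt_line z ζ
  have hUd2 := hu.smooth.hasDerivAt_line_fderiv z ζ ζ
  -- The inequality at (z + sζ)/|z + sζ| is multiplied by N(s) = |z + sζ|, which makes the inner
  -- product with the spatial part of X affine in s.
  have key := nonneg_second_deriv
    (f := fun s => N s * (Real.exp (U s) - X.2) + (inner ℝ X.1 (z : Euc n) + s * inner ℝ X.1 ζ))
    (f' := fun s => s * ‖ζ‖ ^ 2 / N s * (Real.exp (U s) - X.2) + N s * (Real.exp (U s) * U' s)
      + inner ℝ X.1 ζ)
    (f'' := ‖ζ‖ ^ 2 * (Real.exp (u z) - X.2) + Real.exp (u z) * (inner ℝ (sphGrad u z) ζ ^ 2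
      + fderiv ℝ (fderiv ℝ (radialExt u)) (z : Euc n) ζ ζ)) ?_ ?_ ?_ ?_
  · rw [hX, hfn_bpt_snd] at key
    have he := Real.exp_pos (u z)
    have h3 : 0 ≤ Real.exp (u z) * hessForm u z ζ ζ := by
      refine key.trans_eq ?_
      rw [hessForm, real_inner_self_eq_norm_sq]; ring
    exact nonneg_of_mul_nonneg_right h3 he
  · filter_upwards [line_ne_zero z ζ] with s hs
    have h1 := hu.le z (sphProj _ hs)
    have h2 : U s = u (sphProj _ hs) := radialExt_of_ne u hs
    rw [← h2] at h1
    have h4 : hfn (bpt u z) (sphProj _ hs)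
        = X.2 - (N s)⁻¹ * (inner ℝ X.1 (z : Euc n) + s * inner ℝ X.1 ζ) := by
      simp only [hfn, sphProj, real_inner_smul_right, inner_add_right, hNn, ← hX]
    rw [h4] at h1
    have h5 := hNpos s
    have h6 := mul_le_mul_of_nonneg_left h1 h5.le
    rw [mul_sub, ← mul_assoc, mul_inv_cancel₀ h5.ne', one_mul] at h6
    linarith
  · have := hfn_bpt_self u z
    simp only [hfn, ← hX] at this
    simp only [hN0, hU0]; linarith
  · filter_upwards [hUd] with s hs
    have hl : HasDerivAt (fun s : ℝ => inner ℝ X.1 (z : Euc n) + s * inner ℝ X.1 ζ)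
        (inner ℝ X.1 ζ) s := by
      simpa using ((hasDerivAt_id s).mul_const (inner ℝ X.1 ζ)).const_add (inner ℝ X.1 (z : Euc n))
    exact ((hNd s).mul (hs.exp.sub_const X.2)).add hl
  · have hs := hUd.self_of_nhds
    have h1 := ((hNd2.mul (hs.exp.sub_const X.2)).add
      ((hNd 0).mul (hs.exp.mul hUd2))).add_const (inner ℝ X.1 ζ)
    convert! h1 using 1
    simp only [zero_smul, add_zero, radialExt_coe, hN0, inner_sphGrad]
    ring

/-! ### The Hessian form of a p-sum -/

section PSum

variable {p a b : ℝ} {g h : Sph n → ℝ}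

/-- With d = Dg - Dh, differentiating the weights contributes p αβ⟨d,ζ⟩², while the quadratic terms
Du⊗Du and -½|Du|² contribute their convexity defects -αβ⟨d,ζ⟩² and ½αβ|d|²|ζ|². The e^{-2u} terms
give the Jensen defect. -/
lemma hessForm_pLog (hp : 0 < p) (ha : 0 ≤ a) (hb : 0 ≤ b) (hab : 1 ≤ a + b)
    (hg : SmoothSph g) (hh : SmoothSph h) (z : Sph n) (ζ : Euc n) {α β : ℝ}
    (hα : α = a * Real.exp (p * (g z - pLog p a b (g z) (h z))))
    (hβ : β = b * Real.exp (p * (h z - pLog p a b (g z) (h z)))) :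
    hessForm (fun z => pLog p a b (g z) (h z)) z ζ ζ = α * hessForm g z ζ ζ + β * hessForm h z ζ ζ
      + α * β * ((p - 1) * inner ℝ (sphGrad g z - sphGrad h z) ζ ^ 2
        + 1 / 2 * (‖sphGrad g z - sphGrad h z‖ ^ 2 * ‖ζ‖ ^ 2))
      + (α * Real.exp (-2 * g z) + β * Real.exp (-2 * h z)
        - Real.exp (-2 * pLog p a b (g z) (h z))) / 2 * ‖ζ‖ ^ 2 := by
  have hu := smoothSph_pLog (p := p) ha hb hab hg hh
  have hαβ : α + β = 1 := by rw [hα, hβ]; exact pLog_weights hp ha hb hab _ _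
  set G : ℝ → ℝ := fun s => radialExt g ((z : Euc n) + s • ζ) with hG
  set H : ℝ → ℝ := fun s => radialExt h ((z : Euc n) + s • ζ) with hH
  set G' : ℝ → ℝ := fun s => fderiv ℝ (radialExt g) ((z : Euc n) + s • ζ) ζ with hG'
  set H' : ℝ → ℝ := fun s => fderiv ℝ (radialExt h) ((z : Euc n) + s • ζ) ζ with hH'
  have hG0 : G 0 = g z := by simp [hG, radialExt_coe]
  have hH0 : H 0 = h z := by simp [hH, radialExt_coe]
  have hG'0 : G' 0 = inner ℝ (sphGrad g z) ζ := by simp [hG', inner_sphGrad]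
  have hH'0 : H' 0 = inner ℝ (sphGrad h z) ζ := by simp [hH', inner_sphGrad]
  have hGd := hg.hasDerivAt_line z ζ
  have hHd := hh.hasDerivAt_line z ζ
  have hGd2 := hg.hasDerivAt_line_fderiv z ζ ζ
  have hHd2 := hh.hasDerivAt_line_fderiv z ζ ζ
  set P : ℝ → ℝ := fun s => pLog p a b (G s) (H s) with hP
  have hPd : ∀ᶠ s in 𝓝 0, HasDerivAt P (a * Real.exp (p * (G s - P s)) * G' s
      + b * Real.exp (p * (H s - P s)) * H' s) s := by
    filter_upwards [hGd, hHd] with s h1 h2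
    exact hasDerivAt_pLog hp ha hb hab h1 h2
  have heq : (fun s : ℝ => radialExt (fun z => pLog p a b (g z) (h z)) ((z : Euc n) + s • ζ))
      =ᶠ[𝓝 0] P := by
    filter_upwards [line_ne_zero z ζ] with s hs
    simp only [hP, hG, hH, radialExt_of_ne _ hs]
  have heq' : (fun s : ℝ => fderiv ℝ (radialExt (fun z => pLog p a b (g z) (h z)))
      ((z : Euc n) + s • ζ) ζ) =ᶠ[𝓝 0] fun s => a * Real.exp (p * (G s - P s)) * G' s
      + b * Real.exp (p * (H s - P s)) * H' s := by
    filter_upwards [hu.hasDerivAt_line z ζ, hPd, heq.eventuallyEq_nhds] with s h1 h2 h3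
    exact h1.unique (h2.congr_of_eventuallyEq h3)
  have hG1 := hGd.self_of_nhds
  have hH1 := hHd.self_of_nhds
  have hP1 := hPd.self_of_nhds
  have hd2 := (((((hG1.sub hP1).const_mul p).exp.const_mul a).mul hGd2).add
    ((((hH1.sub hP1).const_mul p).exp.const_mul b).mul hHd2)).congr_of_eventuallyEq heq'
  have h2nd := (hu.hasDerivAt_line_fderiv z ζ ζ).unique hd2
  have hP0 : P 0 = pLog p a b (g z) (h z) := by simp only [hP, hG0, hH0]
  -- The product rule: the derivative of a weight is p times the weight times G' - P' or H' - P',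
  -- with P' already expanded.
  change _ = (a * (Real.exp (p * (G 0 - P 0)) * (p * (G' 0 - (a * Real.exp (p * (G 0 - P 0)) * G' 0
      + b * Real.exp (p * (H 0 - P 0)) * H' 0)))) * G' 0 + a * Real.exp (p * (G 0 - P 0)) * _)
      + (b * (Real.exp (p * (H 0 - P 0)) * (p * (H' 0 - (a * Real.exp (p * (G 0 - P 0)) * G' 0
      + b * Real.exp (p * (H 0 - P 0)) * H' 0)))) * H' 0 + b * Real.exp (p * (H 0 - P 0)) * _)
    at h2nd
  rw [hP0, hG0, hH0, hG'0, hH'0] at h2nd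
  have e1 : ∀ t : ℝ, a * (Real.exp (p * (g z - pLog p a b (g z) (h z))) * t) = α * t := by
    intro t; rw [hα]; ring
  have e2 : ∀ t : ℝ, b * (Real.exp (p * (h z - pLog p a b (g z) (h z))) * t) = β * t := by
    intro t; rw [hβ]; ring
  rw [e1, e2, ← hα, ← hβ] at h2nd
  rw [hessForm, h2nd, sphGrad_pLog hp ha hb hab hg hh, ← hα, ← hβ, hessForm, hessForm,
    norm_comb_sq hαβ, inner_add_left, real_inner_smul_left, real_inner_smul_left, inner_sub_left,
    real_inner_self_eq_norm_sq]
  obtain rfl : β = 1 - α := by linarith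
  ring

/-- Positivity of the Hessian form of a `p`-sum. -/
lemma hessForm_pLog_pos (hp₁ : 1 / 2 ≤ p) (hp₂ : p ≤ 2) (ha : 0 ≤ a) (hb : 0 ≤ b)
    (hab : 1 ≤ a + b) (hg : HSupport g) (hh : HSupport h) {z : Sph n} {ζ : Euc n}
    (hζ : inner ℝ (z : Euc n) ζ = 0) (hζ0 : ζ ≠ 0)
    (hs : (0 < a ∧ 0 < hessForm g z ζ ζ) ∨ (0 < b ∧ 0 < hessForm h z ζ ζ) ∨ 1 < a + b ∨
      (0 < a ∧ 0 < b ∧ 1 / 2 < p ∧ p < 2 ∧ (g z ≠ h z ∨ sphGrad g z ≠ sphGrad h z))) :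
    0 < hessForm (fun z => pLog p a b (g z) (h z)) z ζ ζ := by
  have hp : 0 < p := by linarith
  set α := a * Real.exp (p * (g z - pLog p a b (g z) (h z))) with hα
  set β := b * Real.exp (p * (h z - pLog p a b (g z) (h z))) with hβ
  have hw := pLog_weights hp ha hb hab (g z) (h z)
  rw [hessForm_pLog hp ha hb hab hg.smooth hh.smooth z ζ hα hβ]
  have hα0 : 0 ≤ α := by positivity
  have hβ0 : 0 ≤ β := by positivity
  have t1 := mul_nonneg hα0 (hg.hessForm_nonneg hζ)
  have t2 := mul_nonneg hβ0 (hh.hessForm_nonneg hζ)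
  set d := sphGrad g z - sphGrad h z
  have hcs : inner ℝ d ζ ^ 2 ≤ ‖d‖ ^ 2 * ‖ζ‖ ^ 2 := by
    rw [← mul_pow, ← sq_abs]
    exact pow_le_pow_left₀ (abs_nonneg _) (abs_real_inner_le_norm d ζ) 2
  -- Cauchy–Schwarz with p - 1 ≥ -1/2. For p = 1/2 equality occurs when ζ is parallel to d, hence
  -- the strict lower bound on p in the last alternative.
  have t3' : 0 ≤ (p - 1) * inner ℝ d ζ ^ 2 + 1 / 2 * (‖d‖ ^ 2 * ‖ζ‖ ^ 2) := by
    nlinarith [sq_nonneg (inner ℝ d ζ)]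
  have t3 := mul_nonneg (mul_nonneg hα0 hβ0) t3'
  have hz2 : 0 < ‖ζ‖ ^ 2 := by have := norm_pos_iff.mpr hζ0; positivity
  have t4' := jensen_exp hp ha hb hab hp₂ hw
  have t4 : 0 ≤ (α * Real.exp (-2 * g z) + β * Real.exp (-2 * h z)
      - Real.exp (-2 * pLog p a b (g z) (h z))) / 2 * ‖ζ‖ ^ 2 :=
    mul_nonneg (by linarith) hz2.le
  have t4s : (1 < a + b ∨ (0 < a ∧ 0 < b ∧ p < 2 ∧ g z ≠ h z)) →
      0 < (α * Real.exp (-2 * g z) + β * Real.exp (-2 * h z)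
      - Real.exp (-2 * pLog p a b (g z) (h z))) / 2 * ‖ζ‖ ^ 2 := fun hs =>
    mul_pos (by linarith [jensen_exp_strict hp ha hb hab hp₂ hw hs]) hz2
  rcases hs with ⟨h1, h2⟩ | ⟨h1, h2⟩ | h1 | ⟨h1, h2, h3, h4, h5⟩
  · have : 0 < α * hessForm g z ζ ζ := mul_pos (by positivity) h2
    linarith
  · have : 0 < β * hessForm h z ζ ζ := mul_pos (by positivity) h2
    linarith
  · have := t4s (Or.inl h1)
    linarith
  · rcases h5 with h5 | h5
    · have := t4s (Or.inr ⟨h1, h2, h4, h5⟩)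
      linarith
    · have hd : 0 < ‖d‖ ^ 2 := by
        have := norm_pos_iff.mpr (sub_ne_zero.mpr h5); positivity
      have h6 : 0 < (p - 1) * inner ℝ d ζ ^ 2 + 1 / 2 * (‖d‖ ^ 2 * ‖ζ‖ ^ 2) := by
        have := mul_pos hd hz2
        rcases le_or_gt 1 p with h7 | h7
        · nlinarith [mul_nonneg (sub_nonneg.mpr h7) (sq_nonneg (inner ℝ d ζ))]
        · nlinarith [mul_le_mul_of_nonneg_left hcs (sub_nonneg.mpr h7.le)]
      have h7 : 0 < α * β * ((p - 1) * inner ℝ d ζ ^ 2 + 1 / 2 * (‖d‖ ^ 2 * ‖ζ‖ ^ 2)) :=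
        mul_pos (mul_pos (by positivity) (by positivity)) h6
      linarith

end PSum

lemma contDiffAt_lor_comp {E : Type*} [NormedAddCommGroup E] [NormedSpace ℝ E] {f g : E → Mink n}
    {x : E} (hf : ContDiffAt ℝ ∞ f x) (hg : ContDiffAt ℝ ∞ g x) :
    ContDiffAt ℝ ∞ (fun y => lor (f y) (g y)) x :=
  ContDiffAt.comp (g := fun P : Mink n × Mink n => lor P.1 P.2) x contDiff_lor.contDiffAt
    (hf.prodMk hg)

/-! ### Derivatives of the boundary map -/

/-- An extension of `bpt u` to `ℝ^{n+1}`. -/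
def bptExt (u : Sph n → ℝ) (x : Euc n) : Mink n :=
  Real.exp (radialExt u x) • ((1 / 2 : ℝ) • ((-x, 1) : Mink n)
    + ((‖gradient (radialExt u) x‖ ^ 2 + Real.exp (-2 * radialExt u x)) / 2) • ((x, 1) : Mink n)
    - ((gradient (radialExt u) x, 0) : Mink n))

lemma bptExt_coe (u : Sph n → ℝ) (z : Sph n) : bptExt u z = bpt u z := by
  simp only [bptExt, bpt, radialExt_coe, sphGrad]

lemma SmoothSph.contDiffAt_gradient {u : Sph n → ℝ} (hu : SmoothSph u) {x : Euc n} (hx : x ≠ 0) :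
    ContDiffAt ℝ ∞ (gradient (radialExt u)) x :=
  ((InnerProductSpace.toDual ℝ (Euc n)).symm.toContinuousLinearEquiv.contDiff.contDiffAt).comp x
    (hu.contDiffAt_fderiv hx)

lemma SmoothSph.contDiffAt_bptExt {u : Sph n → ℝ} (hu : SmoothSph u) {x : Euc n} (hx : x ≠ 0) :
    ContDiffAt ℝ ∞ (bptExt u) x := by
  have h1 := hu x hx
  have h2 := hu.contDiffAt_gradient hx
  have h3 : ContDiffAt ℝ ∞ (fun x => ‖gradient (radialExt u) x‖ ^ 2) x := h2.norm_sq ℝ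
  have h4 : ContDiffAt ℝ ∞ (fun x => Real.exp (-2 * radialExt u x)) x :=
    (contDiffAt_const.mul h1).exp
  have h5 : ContDiffAt ℝ ∞ (fun x : Euc n => ((1 / 2 : ℝ) • ((-x, 1) : Mink n))) x :=
    (contDiffAt_id.neg.prodMk contDiffAt_const).const_smul _
  have h6 : ContDiffAt ℝ ∞ (fun x : Euc n => ((x, 1) : Mink n)) x :=
    contDiffAt_id.prodMk contDiffAt_const
  have h7 : ContDiffAt ℝ ∞ (fun x : Euc n => ((gradient (radialExt u) x, 0) : Mink n)) x :=
    h2.prodMk contDiffAt_const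
  have h8 := (h5.add (((h3.add h4).div_const 2).smul h6)).sub h7
  exact h1.exp.smul h8

/-- The derivative of `bpt u` at `z` in a tangent direction `ζ`. -/
def dbpt (u : Sph n → ℝ) (z : Sph n) (ζ : Euc n) : Mink n := fderiv ℝ (bptExt u) (z : Euc n) ζ

lemma line_norm_sq {z : Sph n} {ζ : Euc n} (hζ : inner ℝ (z : Euc n) ζ = 0) (s : ℝ) :
    ‖(z : Euc n) + s • ζ‖ ^ 2 = 1 + s ^ 2 * ‖ζ‖ ^ 2 := by
  rw [norm_add_sq_real, sph_norm, real_inner_smul_right, hζ, norm_smul, mul_pow,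
    Real.norm_eq_abs, sq_abs]
  ring

lemma line_ne_zero_of_tangent {z : Sph n} {ζ : Euc n} (hζ : inner ℝ (z : Euc n) ζ = 0) (s : ℝ) :
    (z : Euc n) + s • ζ ≠ 0 := by
  intro h
  have := line_norm_sq hζ s
  rw [h, norm_zero] at this
  nlinarith [mul_nonneg (sq_nonneg s) (sq_nonneg ‖ζ‖)]

/-- The curve on the sphere through `z` with velocity `ζ`. -/
def sphCurve (z : Sph n) {ζ : Euc n} (hζ : inner ℝ (z : Euc n) ζ = 0) (s : ℝ) : Sph n :=
  sphProj ((z : Euc n) + s • ζ) (line_ne_zero_of_tangent hζ s)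

lemma sphCurve_zero (z : Sph n) {ζ : Euc n} (hζ : inner ℝ (z : Euc n) ζ = 0) :
    sphCurve z hζ 0 = z := by
  apply Subtype.ext
  simp [sphCurve, sphProj]

lemma hasDerivAt_sphCurve (z : Sph n) {ζ : Euc n} (hζ : inner ℝ (z : Euc n) ζ = 0) :
    HasDerivAt (fun s => (sphCurve z hζ s : Euc n)) ζ 0 := by
  have h1 : HasDerivAt (fun s : ℝ => (z : Euc n) + s • ζ) ζ 0 := by
    simpa using ((hasDerivAt_id (0 : ℝ)).smul_const ζ).const_add (z : Euc n)
  have h2 : HasDerivAt (fun s : ℝ => 1 + s ^ 2 * ‖ζ‖ ^ 2) 0 0 := by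
    simpa using (((hasDerivAt_id (0 : ℝ)).pow 2).mul_const (‖ζ‖ ^ 2)).const_add 1
  have h3 : HasDerivAt (fun s : ℝ => ‖(z : Euc n) + s • ζ‖) 0 0 := by
    have h4 := h2.sqrt (by simp)
    simp only [← line_norm_sq hζ, Real.sqrt_sq (norm_nonneg _)] at h4
    simpa using h4
  have h4 := (h3.inv (by simp)).smul h1
  convert! h4 using 1
  simp

lemma comp_sphCurve (u : Sph n → ℝ) (z : Sph n) {ζ : Euc n} (hζ : inner ℝ (z : Euc n) ζ = 0)
    (s : ℝ) : u (sphCurve z hζ s) = radialExt u ((z : Euc n) + s • ζ) :=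
  (radialExt_of_ne u (line_ne_zero_of_tangent hζ s)).symm

lemma SmoothSph.hasDerivAt_sphCurve {u : Sph n → ℝ} (hu : SmoothSph u) (z : Sph n) {ζ : Euc n}
    (hζ : inner ℝ (z : Euc n) ζ = 0) :
    HasDerivAt (fun s => u (sphCurve z hζ s)) (inner ℝ (sphGrad u z) ζ) 0 := by
  simp only [comp_sphCurve]
  rw [inner_sphGrad]
  exact fderiv_radialExt_eq hu z ζ

lemma SmoothSph.hasDerivAt_bpt {u : Sph n → ℝ} (hu : SmoothSph u) (z : Sph n) {ζ : Euc n}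
    (hζ : inner ℝ (z : Euc n) ζ = 0) :
    HasDerivAt (fun s => bpt u (sphCurve z hζ s)) (dbpt u z ζ) 0 := by
  simp only [← bptExt_coe]
  refine HasFDerivAt.comp_hasDerivAt (l := bptExt u) (0 : ℝ) ?_ (HypSum.hasDerivAt_sphCurve z hζ)
  rw [sphCurve_zero]
  exact ((hu.contDiffAt_bptExt (sph_ne_zero z)).differentiableAt (by simp)).hasFDerivAt

lemma lor_bpt_null (u : Sph n → ℝ) (z : Sph n) :
    lor (bpt u z) ((z : Euc n), 1) = -Real.exp (u z) := by
  rw [← hfn_bpt_self u z, hfn_eq, neg_neg]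

lemma lor_bpt_tangent (u : Sph n → ℝ) {z : Sph n} {ζ : Euc n} (hζ : inner ℝ (z : Euc n) ζ = 0) :
    lor (bpt u z) (ζ, 0) = -(Real.exp (u z) * inner ℝ (sphGrad u z) ζ) := by
  rw [lor, bpt_fst, real_inner_smul_left, inner_sub_left, real_inner_smul_left, hζ]
  ring

lemma lor_null_null (z : Sph n) : lor ((z : Euc n), (1 : ℝ)) ((z : Euc n), (1 : ℝ)) = 0 := by
  simp [lor]

lemma SmoothSph.lor_bpt_dbpt {u : Sph n → ℝ} (hu : SmoothSph u) {z : Sph n} {ζ : Euc n}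
    (hζ : inner ℝ (z : Euc n) ζ = 0) : lor (bpt u z) (dbpt u z ζ) = 0 := by
  have h1 := (hu.hasDerivAt_bpt z hζ).lor (hu.hasDerivAt_bpt z hζ)
  simp only [(bpt_mem u _).1, sphCurve_zero] at h1
  have h2 := h1.unique (hasDerivAt_const _ _)
  rw [lor_comm (dbpt u z ζ)] at h2
  linarith

lemma hasDerivAt_null (z : Sph n) {ζ : Euc n} (hζ : inner ℝ (z : Euc n) ζ = 0) :
    HasDerivAt (fun s => ((sphCurve z hζ s : Euc n), (1 : ℝ))) (ζ, 0) 0 :=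
  (hasDerivAt_sphCurve z hζ).prodMk (hasDerivAt_const _ _)

/-- In differentiating ⟨X(z),(z,1)⟩ = -e^{u(z)}, the term with (ζ,0) already accounts for the whole
derivative of the right side. Together with `lor_bpt_dbpt` this makes X - e^{-u}(z,1) normal to the
image of the boundary map. -/
lemma SmoothSph.lor_dbpt_null {u : Sph n → ℝ} (hu : SmoothSph u) {z : Sph n} {ζ : Euc n}
    (hζ : inner ℝ (z : Euc n) ζ = 0) : lor (dbpt u z ζ) ((z : Euc n), 1) = 0 := by
  have h1 := (hu.hasDerivAt_bpt z hζ).lor (hasDerivAt_null z hζ)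
  simp only [lor_bpt_null, sphCurve_zero, lor_bpt_tangent u hζ] at h1
  have h2 := h1.unique (hu.hasDerivAt_sphCurve z hζ).exp.neg
  rw [sphCurve_zero] at h2
  linarith

/-- This is how the Hessian form enters the geometry: it is the tangential part of the derivative of
the boundary map. Only ξ has to be tangent, since ζ acts through the ambient extension. -/
lemma SmoothSph.lor_dbpt_tangent {u : Sph n → ℝ} (hu : SmoothSph u) {z : Sph n} {ζ ξ : Euc n}
    (hξ : inner ℝ (z : Euc n) ξ = 0) :
    lor (dbpt u z ζ) (ξ, 0) = -(Real.exp (u z) * hessForm u z ζ ξ) := by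
  have hl : HasDerivAt (fun s : ℝ => (z : Euc n) + s • ζ) ζ 0 := by
    simpa using ((hasDerivAt_id (0 : ℝ)).smul_const ζ).const_add (z : Euc n)
  have h0 : HasDerivAt (fun s : ℝ => bptExt u ((z : Euc n) + s • ζ)) (dbpt u z ζ) 0 := by
    refine HasFDerivAt.comp_hasDerivAt (l := bptExt u) (0 : ℝ) ?_ hl
    rw [zero_smul, add_zero]
    exact ((hu.contDiffAt_bptExt (sph_ne_zero z)).differentiableAt (by simp)).hasFDerivAt
  have h1 := h0.lor (hasDerivAt_const (0 : ℝ) ((ξ, 0) : Mink n))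
  rw [lor_zero_right, add_zero] at h1
  -- This coefficient only has to be differentiable: it multiplies s⟨ζ,ξ⟩, which vanishes at s = 0,
  -- so its own derivative drops out.
  have hB : DifferentiableAt ℝ (fun s : ℝ => (‖gradient (radialExt u) ((z : Euc n) + s • ζ)‖ ^ 2
      + Real.exp (-2 * radialExt u ((z : Euc n) + s • ζ)) - 1) / 2) 0 := by
    have hd : DifferentiableAt ℝ (fun s : ℝ => (z : Euc n) + s • ζ) 0 := hl.differentiableAt
    have e1 : DifferentiableAt ℝ (gradient (radialExt u)) ((z : Euc n) + (0 : ℝ) • ζ) := by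
      rw [zero_smul, add_zero]
      exact (hu.contDiffAt_gradient (sph_ne_zero z)).differentiableAt (by simp)
    have e2 : DifferentiableAt ℝ (radialExt u) ((z : Euc n) + (0 : ℝ) • ζ) := by
      rw [zero_smul, add_zero]; exact hu.differentiableAt z
    have e3 := (DifferentiableAt.comp (g := gradient (radialExt u)) (0 : ℝ) e1 hd).norm_sq ℝ
    have e4 := ((DifferentiableAt.comp (g := radialExt u) (0 : ℝ) e2 hd).const_mul (-2)).exp
    exact ((e3.add e4).sub_const 1).div_const 2
  have hU := (hu.hasDerivAt_line z ζ).self_of_nhds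
  have h2 := hU.exp.mul ((hB.hasDerivAt.mul ((hasDerivAt_id (0 : ℝ)).mul_const (inner ℝ ζ ξ))).sub
    (hu.hasDerivAt_line_fderiv z ζ ξ))
  have h3 := h1.unique (h2.congr_of_eventuallyEq (.of_eq (funext fun s => ?_)))
  · rw [h3, hessForm, inner_sphGrad, inner_sphGrad]
    simp only [Pi.sub_apply, Pi.mul_apply, zero_smul, add_zero, radialExt_coe, id, zero_mul,
      mul_zero, zero_sub, one_mul, zero_add, sphGrad]
    ring
  · simp only [Pi.sub_apply, Pi.mul_apply, id]
    rw [← inner_gradient_left, bptExt, lor]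
    simp only [Prod.smul_fst, Prod.fst_add, Prod.fst_sub, real_inner_smul_left, inner_add_left,
      inner_sub_left, inner_neg_left, hξ, mul_zero]
    ring

/-! ### Local defining functions and normals -/

lemma lor_lorGrad (ρ : Mink n → ℝ) (Y W : Mink n) : lor (lorGrad ρ Y) W = fderiv ℝ ρ Y W := by
  have h1 : inner ℝ ((InnerProductSpace.toDual ℝ (Euc n)).symm
      ((fderiv ℝ ρ Y).comp (ContinuousLinearMap.inl ℝ (Euc n) ℝ))) W.1 = fderiv ℝ ρ Y (W.1, 0) := by
    rw [InnerProductSpace.toDual_symm_apply]; simp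
  have h2 : fderiv ℝ ρ Y (0, W.2) = W.2 * fderiv ℝ ρ Y (0, 1) := by
    rw [← smul_eq_mul, ← map_smul]; simp
  simp only [lor, lorGrad, h1]
  have : W = (W.1, 0) + (0, W.2) := by simp
  conv_rhs => rw [this]
  rw [map_add, h2]; ring

lemma lor_hypGrad (ρ : Mink n → ℝ) {X W : Mink n} (hW : lor X W = 0) :
    lor (hypGrad ρ X) W = fderiv ℝ ρ X W := by
  rw [hypGrad, lor_add_left, lor_smul_left, hW, lor_lorGrad]; ring

lemma lor_hypGrad_self (ρ : Mink n → ℝ) (X : Hyp n) : lor X.1 (hypGrad ρ X) = 0 := by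
  rw [hypGrad, lor_add_right, lor_smul_right, X.2.1, lor_comm]; ring

lemma _root_.ContDiffAt.lorGrad {ρ : Mink n → ℝ} {Y : Mink n} (h : ContDiffAt ℝ ∞ ρ Y) :
    ContDiffAt ℝ ∞ (lorGrad ρ) Y := by
  have h1 : ContDiffAt ℝ ∞ (fderiv ℝ ρ) Y := h.fderiv_right (m := ∞) (by simp)
  have h2 : ContDiffAt ℝ ∞ (fun Y => (fderiv ℝ ρ Y).comp
      (ContinuousLinearMap.inl ℝ (Euc n) ℝ)) Y := h1.clm_comp contDiffAt_const
  have h3 : ContDiffAt ℝ ∞ (fun Y => (InnerProductSpace.toDual ℝ (Euc n)).symm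
      ((fderiv ℝ ρ Y).comp (ContinuousLinearMap.inl ℝ (Euc n) ℝ))) Y :=
    ((InnerProductSpace.toDual ℝ (Euc n)).symm.toContinuousLinearEquiv.contDiff.contDiffAt).comp
      Y h2
  have h4 : ContDiffAt ℝ ∞ (fun Y => -fderiv ℝ ρ Y (0, 1)) Y :=
    (h1.clm_apply contDiffAt_const).neg
  exact ContDiffAt.prodMk h3 h4

lemma _root_.ContDiffAt.hypGrad {ρ : Mink n → ℝ} {Y : Mink n} (h : ContDiffAt ℝ ∞ ρ Y) :
    ContDiffAt ℝ ∞ (hypGrad ρ) Y := by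
  have h1 := h.lorGrad
  exact ContDiffAt.add h1 (ContDiffAt.smul (contDiffAt_lor_comp h1 contDiffAt_id) contDiffAt_id)

lemma _root_.ContDiffAt.unitNormal {ρ : Mink n → ℝ} {Y : Mink n} (h : ContDiffAt ℝ ∞ ρ Y)
    (hpos : 0 < lor (HypSum.hypGrad ρ Y) (HypSum.hypGrad ρ Y)) :
    ContDiffAt ℝ ∞ (unitNormal ρ) Y := by
  have h1 := h.hypGrad
  have h3 : ContDiffAt ℝ ∞ (fun Y => (Real.sqrt (lor (HypSum.hypGrad ρ Y) (HypSum.hypGrad ρ Y)))⁻¹)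
      Y := ((contDiffAt_lor_comp h1 h1).sqrt hpos.ne').inv (Real.sqrt_pos.mpr hpos).ne'
  exact ContDiffAt.smul h3 h1

namespace IsLocalDefiningFn

variable {Ω : Set (Hyp n)} {X : Hyp n} {ρ : Mink n → ℝ}

lemma contDiffAt (h : IsLocalDefiningFn Ω X ρ) : ContDiffAt ℝ ∞ ρ X :=
  let ⟨_, hU, hρ⟩ := h.smooth
  hρ.contDiffAt hU

lemma contDiffAt_fderiv (h : IsLocalDefiningFn Ω X ρ) : ContDiffAt ℝ ∞ (fderiv ℝ ρ) X :=
  h.contDiffAt.fderiv_right (m := ∞) (by simp)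

lemma contDiffAt_lorGrad (h : IsLocalDefiningFn Ω X ρ) : ContDiffAt ℝ ∞ (lorGrad ρ) X :=
  h.contDiffAt.lorGrad

lemma contDiffAt_hypGrad (h : IsLocalDefiningFn Ω X ρ) : ContDiffAt ℝ ∞ (hypGrad ρ) X :=
  h.contDiffAt.hypGrad

lemma lor_grad_pos (h : IsLocalDefiningFn Ω X ρ) : 0 < lor (hypGrad ρ X) (hypGrad ρ X) :=
  lor_self_pos (lor_hypGrad_self ρ X) h.grad_ne_zero

lemma contDiffAt_unitNormal (h : IsLocalDefiningFn Ω X ρ) :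
    ContDiffAt ℝ ∞ (unitNormal ρ) X :=
  h.contDiffAt.unitNormal h.lor_grad_pos

lemma lor_unitNormal_self (h : IsLocalDefiningFn Ω X ρ) :
    lor (unitNormal ρ X) (unitNormal ρ X) = 1 := by
  have := h.lor_grad_pos
  rw [unitNormal, lor_smul_left, lor_smul_right, ← mul_assoc, ← mul_inv,
    Real.mul_self_sqrt this.le]
  field_simp

lemma lor_unitNormal_point (ρ : Mink n → ℝ) (X : Hyp n) : lor X.1 (unitNormal ρ X) = 0 := by
  rw [unitNormal, lor_smul_right, lor_hypGrad_self, mul_zero]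

/-- A defining function near `X` is also one near all boundary points close to `X`. -/
lemma eventually (h : IsLocalDefiningFn Ω X ρ) :
    ∀ᶠ Y : Hyp n in 𝓝 X, Y ∈ frontier Ω → IsLocalDefiningFn Ω Y ρ := by
  obtain ⟨U, hU, hρ⟩ := h.smooth
  have hval : Tendsto (Subtype.val : Hyp n → Mink n) (𝓝 X) (𝓝 X.1) :=
    continuous_subtype_val.continuousAt
  have h1 : ∀ᶠ Y : Hyp n in 𝓝 X, U ∈ 𝓝 Y.1 := hval.eventually (eventually_mem_nhds_iff.mpr hU)
  have h2 : ∀ᶠ Y : Hyp n in 𝓝 X, hypGrad ρ Y.1 ≠ 0 :=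
    hval.eventually (h.contDiffAt_hypGrad.continuousAt.eventually_ne h.grad_ne_zero)
  filter_upwards [h1, h2, h.mem_iff.eventually_nhds] with Y hY1 hY2 hY3 hYf
  have hc : ContinuousAt (fun Y : Hyp n => ρ Y.1) Y :=
    ContinuousAt.comp (g := ρ) (hρ.contDiffAt hY1).continuousAt continuous_subtype_val.continuousAt
  refine ⟨⟨U, hY1, hρ⟩, hY3, ?_, hY2⟩
  rcases lt_trichotomy (ρ Y.1) 0 with h0 | h0 | h0
  · exfalso
    refine hYf.2 (mem_interior_iff_mem_nhds.mpr ?_)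
    filter_upwards [hY3, hc.eventually (gt_mem_nhds h0)] with W h4 h5
    exact h4.mpr h5.le
  · exact h0
  · exfalso
    have h6 : ∃ᶠ W in 𝓝 Y, W ∈ Ω := mem_closure_iff_frequently.mp hYf.1
    obtain ⟨W, h7, h8, h9⟩ := (h6.and_eventually
      (hY3.and (hc.eventually (lt_mem_nhds h0)))).exists
    have := h8.mp h7
    linarith

lemma eventually_contDiffAt (h : IsLocalDefiningFn Ω X ρ) :
    ∀ᶠ Y in 𝓝 X.1, ContDiffAt ℝ ∞ ρ Y := by
  obtain ⟨U, hU, hρ⟩ := h.smooth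
  exact (eventually_mem_nhds_iff.mpr hU).mono fun Y hY => hρ.contDiffAt hY

lemma eventually_contDiffAt_unitNormal (h : IsLocalDefiningFn Ω X ρ) :
    ∀ᶠ Y in 𝓝 X.1, ContDiffAt ℝ ∞ (unitNormal ρ) Y := by
  have h1 := (contDiffAt_lor_comp h.contDiffAt_hypGrad h.contDiffAt_hypGrad).continuousAt.eventually
    (lt_mem_nhds h.lor_grad_pos)
  filter_upwards [h.eventually_contDiffAt, h1] with Y h2 h3
  exact h2.unitNormal h3

lemma differentiableAt (h : IsLocalDefiningFn Ω X ρ) : DifferentiableAt ℝ ρ X :=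
  h.contDiffAt.differentiableAt (by simp)

/-- At a maximum point of `h_z` on `Ω` the outward normal is `X - (z, 1) / h_z(X)`. -/
lemma unitNormal_eq (h : IsLocalDefiningFn Ω X ρ) {z : Sph n}
    (hmax : ∀ Y ∈ Ω, hfn Y.1 z ≤ hfn X.1 z) :
    unitNormal ρ X = X.1 - (hfn X.1 z)⁻¹ • ((z : Euc n), (1 : ℝ)) := by
  have hh := hfn_pos X z
  set Z : Mink n := ((z : Euc n), (1 : ℝ)) with hZ
  have hXZ : lor X.1 Z = -hfn X.1 z := by rw [hfn_eq]; ring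
  have hZZ : lor Z Z = 0 := lor_null_null z
  set m := X.1 - (hfn X.1 z)⁻¹ • Z with hm
  set ν := unitNormal ρ X with hν
  have hXν : lor X.1 ν = 0 := lor_unitNormal_point ρ X
  have hνν : lor ν ν = 1 := h.lor_unitNormal_self
  have hXm : lor X.1 m = 0 := by
    rw [hm, lor_sub_right, lor_smul_right, X.2.1, hXZ]; field_simp; ring
  have hmm : lor m m = 1 := by
    simp only [hm, lor_sub_left, lor_sub_right, lor_smul_left, lor_smul_right, X.2.1, hXZ, hZZ,
      lor_comm Z X.1]
    field_simp; ring
  -- A tangent vector w with ⟨ν,w⟩ < 0 points into Ω, so h_z cannot increase along it; m is the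
  -- gradient of log h_z at X. Two unit vectors related in this way coincide.
  have key : ∀ w : Mink n, lor X.1 w = 0 → lor ν w < 0 → lor m w ≤ 0 := by
    intro w hXw hw
    have hDρ : fderiv ℝ ρ X.1 w < 0 := by
      rw [← lor_hypGrad ρ hXw]
      rw [hν, unitNormal, lor_smul_left] at hw
      have := inv_pos.mpr (Real.sqrt_pos.mpr h.lor_grad_pos)
      by_contra! h3
      exact absurd hw (not_lt.mpr (mul_nonneg this.le h3))
    have hl : HasDerivAt (fun s : ℝ => X.1 + s • w) w 0 := by
      simpa using ((hasDerivAt_id (0 : ℝ)).smul_const w).const_add X.1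
    have hlor : ∀ s : ℝ, -lor (X.1 + s • w) (X.1 + s • w) = 1 - s ^ 2 * lor w w := by
      intro s
      simp only [lor_add_left, lor_add_right, lor_smul_left, lor_smul_right, X.2.1, hXw,
        lor_comm w X.1]
      ring
    have hn : HasDerivAt (fun s : ℝ => nrm (X.1 + s • w)) w 0 := by
      have h2 : HasDerivAt (fun s : ℝ => 1 - s ^ 2 * lor w w) 0 0 := by
        simpa using (((hasDerivAt_id (0 : ℝ)).pow 2).mul_const (lor w w)).const_sub 1
      have h4 := ((h2.sqrt (by simp)).inv (by simp)).smul hl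
      simp only [nrm, hlor]
      convert! h4 using 1
      simp
    have hρd : HasDerivAt (fun s : ℝ => ρ (nrm (X.1 + s • w))) (fderiv ℝ ρ X.1 w) 0 := by
      refine HasFDerivAt.comp_hasDerivAt (l := ρ) (0 : ℝ) ?_ hn
      rw [zero_smul, add_zero, nrm_hyp]
      exact h.differentiableAt.hasFDerivAt
    have hneg : ∀ᶠ s : ℝ in 𝓝[>] 0, ρ (nrm (X.1 + s • w)) < 0 := by
      have h5 := (hasDerivAt_iff_tendsto_slope.mp hρd).mono_left
        (nhdsWithin_mono 0 (fun s (hs : s ∈ Ioi (0 : ℝ)) => ne_of_gt hs))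
      filter_upwards [h5.eventually (gt_mem_nhds hDρ), self_mem_nhdsWithin] with s hs hs0
      rw [slope_def_field, zero_smul, add_zero, nrm_hyp, h.eq_zero, sub_zero, sub_zero,
        div_neg_iff] at hs
      rcases hs with hs | hs
      · exact absurd hs.2 (not_lt.mpr (le_of_lt hs0))
      · exact hs.1
    have hmem : ∀ᶠ s : ℝ in 𝓝[>] 0, _ := (hl.continuousAt.tendsto.mono_left nhdsWithin_le_nhds).eventually
      (show ∀ᶠ Y in 𝓝 (X.1 + (0 : ℝ) • w), _ from by
        rw [zero_smul, add_zero]; exact eventually_normalize_mem h.mem_iff)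
    obtain ⟨s, ⟨hs1, hY, hs2⟩, hs0⟩ := ((hneg.and hmem).and
      (self_mem_nhdsWithin : Ioi (0 : ℝ) ∈ 𝓝[>] 0)).exists
    have hs0' : (0 : ℝ) < s := hs0
    have hs3 := hmax _ (hs2.mpr hs1.le)
    have hp := hfn_pos' hY z
    have h0 : 0 < -lor (X.1 + s • w) (X.1 + s • w) := neg_pos.mpr (lor_self_neg hY)
    have h1 : Real.sqrt (-lor (X.1 + s • w) (X.1 + s • w)) ≤ 1 := by
      rw [Real.sqrt_le_one, hlor]
      nlinarith [mul_nonneg (sq_nonneg s) (lor_self_nonneg hXw)]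
    have h2 := (one_le_inv₀ (Real.sqrt_pos.mpr h0)).mpr h1
    rw [normalize_val, nrm, hfn_smul] at hs3
    have h4 : hfn (X.1 + s • w) z ≤ hfn X.1 z := by nlinarith
    rw [hfn_add, hfn_smul] at h4
    have h5 : hfn w z ≤ 0 := by
      by_contra! h6
      nlinarith [mul_pos hs0' h6]
    have h6 : lor m w = (hfn X.1 z)⁻¹ * hfn w z := by
      rw [hm, lor_sub_left, lor_smul_left, hXw, hfn_eq w, ← hZ, lor_comm w]; ring
    rw [h6]
    exact mul_nonpos_of_nonneg_of_nonpos (inv_pos.mpr hh).le h5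
  have hcs := lor_sq_le hXm hXν hνν
  rw [hmm] at hcs
  have h1 : 0 ≤ lor m ν := by
    have := key (-1 • ν : Mink n) (by
      rw [show (-1 • ν : Mink n) = (-1 : ℝ) • ν by simp, lor_smul_right, hXν, mul_zero]) (by
      rw [show (-1 • ν : Mink n) = (-1 : ℝ) • ν by simp, lor_smul_right, hνν]; norm_num)
    rw [show (-1 • ν : Mink n) = (-1 : ℝ) • ν by simp, lor_smul_right] at this
    linarith
  -- Otherwise, removing slightly more than its ν-component from m leaves an inward direction along
  -- which h_z increases.
  have h2 : 1 ≤ lor m ν ^ 2 := by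
    by_contra! h3
    have hε : 0 < (1 - lor m ν ^ 2) / 2 := by linarith
    have := key (m - (lor m ν + (1 - lor m ν ^ 2) / 2) • ν) (by
      rw [lor_sub_right, lor_smul_right, hXν, hXm]; ring) (by
      rw [lor_sub_right, lor_smul_right, hνν, lor_comm ν m]; linarith)
    rw [lor_sub_right, lor_smul_right, hmm] at this
    nlinarith
  have h3 : lor m ν = 1 := by nlinarith
  have h4 : ν - m = 0 := by
    refine eq_zero_of_lor_self (X := X) (by rw [lor_sub_right, hXν, hXm, sub_zero]) ?_
    simp only [lor_sub_left, lor_sub_right, hνν, hmm, lor_comm ν m, h3]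
    norm_num
  exact sub_eq_zero.mp h4

end IsLocalDefiningFn

/-! ### The Weingarten map -/

namespace IsLocalDefiningFn

variable {Ω : Set (Hyp n)} {X : Hyp n} {ρ : Mink n → ℝ}

lemma fderiv_eq_zero_of_tangent (h : IsLocalDefiningFn Ω X ρ) {w : Mink n} (hw : lor X.1 w = 0)
    (hνw : lor (unitNormal ρ X) w = 0) : fderiv ℝ ρ X.1 w = 0 := by
  rw [← lor_hypGrad ρ hw]
  rw [unitNormal, lor_smul_left] at hνw
  exact (mul_eq_zero.mp hνw).resolve_left (inv_pos.mpr (Real.sqrt_pos.mpr h.lor_grad_pos)).ne'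

/-- The second fundamental form in terms of a defining function. -/
lemma lor_fderiv_unitNormal (h : IsLocalDefiningFn Ω X ρ) (v : Mink n) {w : Mink n}
    (hw : lor X.1 w = 0) (hνw : lor (unitNormal ρ X) w = 0) :
    lor (fderiv ℝ (unitNormal ρ) X v) w = (Real.sqrt (lor (hypGrad ρ X) (hypGrad ρ X)))⁻¹ *
      (fderiv ℝ (fderiv ℝ ρ) X v w + lor (lorGrad ρ X) X * lor v w) := by
  have hl : HasDerivAt (fun s : ℝ => X.1 + s • v) v 0 := by
    simpa using ((hasDerivAt_id (0 : ℝ)).smul_const v).const_add X.1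
  have h0 : X.1 + (0 : ℝ) • v = X.1 := by simp
  have hν : HasDerivAt (fun s : ℝ => unitNormal ρ (X.1 + s • v)) (fderiv ℝ (unitNormal ρ) X v) 0 := by
    refine HasFDerivAt.comp_hasDerivAt (l := unitNormal ρ) (0 : ℝ) ?_ hl
    rw [h0]
    exact (h.contDiffAt_unitNormal.differentiableAt (by simp)).hasFDerivAt
  have h1 := hν.lor (hasDerivAt_const (0 : ℝ) w)
  rw [lor_zero_right, add_zero] at h1
  -- Differentiability of 1/|∇ρ| suffices, because it multiplies a function that vanishes at s = 0.
  -- The coefficient of s⟨v,w⟩ below is treated likewise.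
  have hr : DifferentiableAt ℝ (fun s : ℝ =>
      (Real.sqrt (lor (hypGrad ρ (X.1 + s • v)) (hypGrad ρ (X.1 + s • v))))⁻¹) 0 := by
    have e : DifferentiableAt ℝ (fun Y =>
        (Real.sqrt (lor (hypGrad ρ Y) (hypGrad ρ Y)))⁻¹) (X.1 + (0 : ℝ) • v) := by
      rw [h0]
      have := ((contDiffAt_lor_comp h.contDiffAt_hypGrad h.contDiffAt_hypGrad).sqrt
        h.lor_grad_pos.ne').inv (Real.sqrt_pos.mpr h.lor_grad_pos).ne'
      exact this.differentiableAt (by simp)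
    have e2 := e.comp (0 : ℝ) hl.differentiableAt
    exact e2
  have hc : DifferentiableAt ℝ (fun s : ℝ =>
      lor (lorGrad ρ (X.1 + s • v)) (X.1 + s • v)) 0 := by
    have e : DifferentiableAt ℝ (fun Y => lor (lorGrad ρ Y) Y) (X.1 + (0 : ℝ) • v) := by
      rw [h0]
      exact (contDiffAt_lor_comp h.contDiffAt_lorGrad contDiffAt_id).differentiableAt (by simp)
    have e2 := e.comp (0 : ℝ) hl.differentiableAt
    exact e2
  have hD : HasDerivAt (fun s : ℝ => fderiv ℝ ρ (X.1 + s • v) w)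
      (fderiv ℝ (fderiv ℝ ρ) X.1 v w) 0 := by
    have e : HasFDerivAt (fderiv ℝ ρ) (fderiv ℝ (fderiv ℝ ρ) X.1) (X.1 + (0 : ℝ) • v) := by
      rw [h0]; exact (h.contDiffAt_fderiv.differentiableAt (by simp)).hasFDerivAt
    exact ((ContinuousLinearMap.apply ℝ ℝ w).hasFDerivAt).comp_hasDerivAt (0 : ℝ)
      (e.comp_hasDerivAt (0 : ℝ) hl)
  have h2 := hr.hasDerivAt.mul (hD.add (hc.hasDerivAt.mul
    ((hasDerivAt_id (0 : ℝ)).mul_const (lor v w))))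
  have h3 := h1.unique (h2.congr_of_eventuallyEq (.of_eq (funext fun s => ?_)))
  · rw [h3]
    simp only [Pi.add_apply, Pi.mul_apply, zero_smul, add_zero, id, zero_mul, mul_zero,
      h.fderiv_eq_zero_of_tangent hw hνw, one_mul, zero_add]
  · simp only [Pi.add_apply, Pi.mul_apply, id]
    have e : lor (hypGrad ρ (X.1 + s • v)) w = fderiv ℝ ρ (X.1 + s • v) w
        + lor (lorGrad ρ (X.1 + s • v)) (X.1 + s • v) * (s * lor v w) := by
      rw [hypGrad, lor_add_left, lor_lorGrad, lor_smul_left, lor_add_left X.1, lor_smul_left s, hw,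
        zero_add]
    rw [unitNormal, lor_smul_left, e]

lemma fderiv_fderiv_comm (h : IsLocalDefiningFn Ω X ρ) (v w : Mink n) :
    fderiv ℝ (fderiv ℝ ρ) X v w = fderiv ℝ (fderiv ℝ ρ) X w v := by
  have := h.contDiffAt.isSymmSndFDerivAt
    (by rw [minSmoothness_of_isRCLikeNormedField]; exact WithTop.coe_le_coe.mpr le_top)
  exact this v w

lemma lor_fderiv_unitNormal_comm (h : IsLocalDefiningFn Ω X ρ) {v w : Mink n}
    (hv : lor X.1 v = 0) (hνv : lor (unitNormal ρ X) v = 0)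
    (hw : lor X.1 w = 0) (hνw : lor (unitNormal ρ X) w = 0) :
    lor (fderiv ℝ (unitNormal ρ) X v) w = lor (fderiv ℝ (unitNormal ρ) X w) v := by
  rw [h.lor_fderiv_unitNormal v hw hνw, h.lor_fderiv_unitNormal w hv hνv, h.fderiv_fderiv_comm,
    lor_comm v w]

/-- Off the hyperboloid `unitNormal ρ Y` need not be orthogonal to Y, but ⟨Y, ν(Y)⟩ is a multiple of
1 + ⟨Y,Y⟩, which is of second order in a tangent direction. Both relations are therefore derivatives
of ⟨Y,ν⟩ = 0 and ⟨ν,ν⟩ = 1. -/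
lemma lor_fderiv_unitNormal_of_lor_eq_zero (h : IsLocalDefiningFn Ω X ρ) {v : Mink n}
    (hv : lor X.1 v = 0) :
    lor X.1 (fderiv ℝ (unitNormal ρ) X v) = -lor (unitNormal ρ X) v ∧
      lor (unitNormal ρ X) (fderiv ℝ (unitNormal ρ) X v) = 0 := by
  have hl : HasDerivAt (fun s : ℝ => X.1 + s • v) v 0 := by
    simpa using ((hasDerivAt_id (0 : ℝ)).smul_const v).const_add X.1
  have h0 : X.1 + (0 : ℝ) • v = X.1 := by simp
  have hν : HasDerivAt (fun s : ℝ => unitNormal ρ (X.1 + s • v)) (fderiv ℝ (unitNormal ρ) X v) 0 := by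
    refine HasFDerivAt.comp_hasDerivAt (l := unitNormal ρ) (0 : ℝ) ?_ hl
    rw [h0]
    exact (h.contDiffAt_unitNormal.differentiableAt (by simp)).hasFDerivAt
  constructor
  · have h1 := hl.lor hν
    simp only [h0, lor_comm v] at h1
    have hc : DifferentiableAt ℝ (fun s : ℝ =>
        (Real.sqrt (lor (hypGrad ρ (X.1 + s • v)) (hypGrad ρ (X.1 + s • v))))⁻¹ *
          lor (lorGrad ρ (X.1 + s • v)) (X.1 + s • v)) 0 := by
      have e : DifferentiableAt ℝ (fun Y => (Real.sqrt (lor (hypGrad ρ Y) (hypGrad ρ Y)))⁻¹ *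
          lor (lorGrad ρ Y) Y) (X.1 + (0 : ℝ) • v) := by
        rw [h0]
        exact ((((contDiffAt_lor_comp h.contDiffAt_hypGrad h.contDiffAt_hypGrad).sqrt
          h.lor_grad_pos.ne').inv (Real.sqrt_pos.mpr h.lor_grad_pos).ne').mul
          (contDiffAt_lor_comp h.contDiffAt_lorGrad contDiffAt_id)).differentiableAt (by simp)
      have e2 := e.comp (0 : ℝ) hl.differentiableAt
      exact e2
    have h2 : HasDerivAt (fun s : ℝ => s ^ 2 * lor v v) 0 0 := by
      simpa using ((hasDerivAt_id (0 : ℝ)).pow 2).mul_const (lor v v)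
    have h3 := h1.unique ((hc.hasDerivAt.mul h2).congr_of_eventuallyEq
      (.of_eq (funext fun s => ?_)))
    · simp at h3; linarith
    · have e : lor (X.1 + s • v) (X.1 + s • v) = -1 + s ^ 2 * lor v v := by
        simp only [lor_add_left, lor_add_right, lor_smul_left, lor_smul_right, X.2.1, hv,
          lor_comm v X.1]
        ring
      simp only [Pi.mul_apply]
      have e' : lor (X.1 + s • v) (hypGrad ρ (X.1 + s • v))
          = lor (lorGrad ρ (X.1 + s • v)) (X.1 + s • v) * (s ^ 2 * lor v v) := by
        rw [hypGrad, lor_add_right, lor_smul_right, e, lor_comm (X.1 + s • v) (lorGrad ρ _)]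
        ring
      rw [unitNormal, lor_smul_right, e']
      ring
  · have h1 := hν.lor hν
    have h2 : HasDerivAt (fun s : ℝ => lor (unitNormal ρ (X.1 + s • v))
        (unitNormal ρ (X.1 + s • v))) 0 0 := by
      refine (hasDerivAt_const (0 : ℝ) (1 : ℝ)).congr_of_eventuallyEq ?_
      have hpos : ContinuousAt (fun s : ℝ =>
          lor (hypGrad ρ (X.1 + s • v)) (hypGrad ρ (X.1 + s • v))) 0 := by
        refine ContinuousAt.comp (g := fun Y => lor (hypGrad ρ Y) (hypGrad ρ Y)) ?_ hl.continuousAt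
        rw [h0]
        exact (contDiffAt_lor_comp h.contDiffAt_hypGrad h.contDiffAt_hypGrad).continuousAt
      have := hpos.eventually (lt_mem_nhds (show 0 < lor (hypGrad ρ (X.1 + (0 : ℝ) • v))
        (hypGrad ρ (X.1 + (0 : ℝ) • v)) by rw [h0]; exact h.lor_grad_pos))
      filter_upwards [this] with s hs
      rw [unitNormal, lor_smul_left, lor_smul_right, ← mul_assoc, ← mul_inv,
        Real.mul_self_sqrt hs.le, inv_mul_cancel₀ hs.ne']
    have h3 := h1.unique h2
    rw [h0, lor_comm] at h3
    linarith

lemma fderiv_unitNormal_tangent (h : IsLocalDefiningFn Ω X ρ) {v : Mink n}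
    (hv : lor X.1 v = 0) (hνv : lor (unitNormal ρ X) v = 0) :
    lor X.1 (fderiv ℝ (unitNormal ρ) X v) = 0 ∧
      lor (unitNormal ρ X) (fderiv ℝ (unitNormal ρ) X v) = 0 := by
  have h1 := h.lor_fderiv_unitNormal_of_lor_eq_zero hv
  rwa [hνv, neg_zero] at h1

lemma lor_eq_of_fst {v : Mink n} : lor v v = ‖v.1‖ ^ 2 - v.2 ^ 2 := by
  simp only [lor, real_inner_self_eq_norm_sq]; ring

/-- A lower bound for the principal curvatures bounds the second fundamental form. -/
lemma mul_lor_self_le (h : IsLocalDefiningFn Ω X ρ) {c : ℝ}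
    (hc : ∀ κ : ℝ, IsPrincipalCurvature Ω X κ → c < κ) {v : Mink n}
    (hv : lor X.1 v = 0) (hνv : lor (unitNormal ρ X) v = 0) :
    c * lor v v ≤ lor (fderiv ℝ (unitNormal ρ) X v) v := by
  by_cases hv0 : v = 0
  · subst hv0; simp [lor_zero_right]
  set W := fderiv ℝ (unitNormal ρ) X.1 with hW
  set S : Set (Mink n) := {w | lor X.1 w = 0} ∩ {w | lor (unitNormal ρ X) w = 0} ∩
    {w | lor w w = 1} with hS
  have hcl : ∀ Y : Mink n, Continuous fun w => lor Y w := fun Y =>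
    continuous_lor.comp (continuous_const.prodMk continuous_id)
  have hq : Continuous fun w : Mink n => lor w w :=
    continuous_lor.comp (continuous_id.prodMk continuous_id)
  have hQ : Continuous fun w : Mink n => lor (W w) w :=
    continuous_lor.comp (W.continuous.prodMk continuous_id)
  have hcomp : IsCompact S := by
    refine Metric.isCompact_of_isClosed_isBounded ?_ ?_
    · exact ((isClosed_eq (hcl _) continuous_const).inter
        (isClosed_eq (hcl _) continuous_const)).inter (isClosed_eq hq continuous_const)
    · refine (Metric.isBounded_closedBall (x := (0 : Mink n)) (r := X.1.2)).subset ?_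
      rintro w ⟨⟨h1, -⟩, h2⟩
      have h3 := lor_self_bound h1
      have h4 : lor w w = 1 := h2
      rw [h4, mul_one] at h3
      have h5 := X.2.2
      have h6 : ‖w.1‖ ≤ X.1.2 := abs_le_of_sq_le_sq' h3 h5.le |>.2
      rw [lor_eq_of_fst] at h4
      rw [mem_closedBall_zero_iff, Prod.norm_def, max_le_iff]
      refine ⟨h6, ?_⟩
      rw [Real.norm_eq_abs]
      exact abs_le_of_sq_le_sq (by nlinarith) h5.le
  have hvp := lor_self_pos hv hv0
  have hsc : ∀ w : Mink n, lor X.1 w = 0 → lor (unitNormal ρ X) w = 0 → 0 < lor w w →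
      (Real.sqrt (lor w w))⁻¹ • w ∈ S := by
    intro w h1 h2 h3
    refine ⟨⟨?_, ?_⟩, ?_⟩
    · change lor X.1 _ = 0
      rw [lor_smul_right, h1, mul_zero]
    · change lor _ _ = 0
      rw [lor_smul_right, h2, mul_zero]
    · change lor _ _ = 1
      rw [lor_smul_left, lor_smul_right, ← mul_assoc, ← mul_inv, Real.mul_self_sqrt h3.le,
        inv_mul_cancel₀ h3.ne']
  -- The minimum of the second fundamental form on unit tangent vectors is an eigenvalue of the
  -- Weingarten map, with the minimiser as eigenvector.
  obtain ⟨v₀, ⟨⟨h1, h2⟩, h3⟩, hmin⟩ := hcomp.exists_isMinOn ⟨_, hsc v hv hνv hvp⟩ hQ.continuousOn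
  replace h1 : lor X.1 v₀ = 0 := h1
  replace h2 : lor (unitNormal ρ X) v₀ = 0 := h2
  replace h3 : lor v₀ v₀ = 1 := h3
  set κ := lor (W v₀) v₀ with hκ
  have hQge : ∀ w : Mink n, lor X.1 w = 0 → lor (unitNormal ρ X) w = 0 →
      κ * lor w w ≤ lor (W w) w := by
    intro w e1 e2
    by_cases hw0 : w = 0
    · subst hw0; simp [lor_zero_right]
    have e3 := lor_self_pos e1 hw0
    have e4 := hmin (hsc w e1 e2 e3)
    simp only [mem_ofPred_eq, map_smul, lor_smul_left, lor_smul_right] at e4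
    rw [← mul_assoc, ← mul_inv, Real.mul_self_sqrt e3.le] at e4
    rwa [inv_mul_eq_div, le_div_iff₀ e3] at e4
  have hsymm : ∀ w : Mink n, lor X.1 w = 0 → lor (unitNormal ρ X) w = 0 →
      lor (W v₀) w = κ * lor v₀ w := by
    intro w e1 e2
    have e3 := h.lor_fderiv_unitNormal_comm h1 h2 e1 e2
    rw [← hW] at e3
    -- Minimality along v₀ + t w gives a non-negative quadratic in t without constant term; its
    -- discriminant forces the linear coefficient to vanish.
    have e4 : ∀ t : ℝ, 0 ≤ (lor (W w) w - κ * lor w w) * (t * t)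
        + 2 * (lor (W v₀) w - κ * lor v₀ w) * t + 0 := by
      intro t
      have e5 := hQge (v₀ + t • w) (by rw [lor_add_right, lor_smul_right, h1, e1]; ring)
        (by rw [lor_add_right, lor_smul_right, h2, e2]; ring)
      simp only [map_add, map_smul, lor_add_left, lor_add_right, lor_smul_left, lor_smul_right,
        h3, lor_comm w v₀, ← e3, ← hκ] at e5
      linarith
    have e6 := discrim_le_zero e4
    rw [discrim] at e6
    have : lor (W v₀) w - κ * lor v₀ w = 0 := by nlinarith
    linarith
  have hWv := h.fderiv_unitNormal_tangent h1 h2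
  have hE : W v₀ - κ • v₀ = 0 := by
    have f1 : lor X.1 (W v₀ - κ • v₀) = 0 := by
      rw [lor_sub_right, lor_smul_right, hWv.1, h1]; ring
    have f2 : lor (unitNormal ρ X) (W v₀ - κ • v₀) = 0 := by
      rw [lor_sub_right, lor_smul_right, hWv.2, h2]; ring
    refine eq_zero_of_lor_self f1 ?_
    rw [lor_sub_left, hsymm _ f1 f2, lor_smul_left]; linarith
  have hv₀ : v₀ ≠ 0 := by
    rintro rfl; rw [lor_zero_left] at h3; exact zero_ne_one h3
  have := hc κ ⟨ρ, h, v₀, hv₀, h1, h2, sub_eq_zero.mp hE⟩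
  nlinarith [hQge v hv hνv]

/-- The derivative of the unit normal along the boundary map. -/
lemma fderiv_unitNormal_dbpt {u : Sph n → ℝ} (hu : SmoothSph u) (hsub : Ω ⊆ horoHull u)
    (hmem : ∀ z, bptH u z ∈ Ω) {z : Sph n} (h : IsLocalDefiningFn Ω (bptH u z) ρ) {ζ : Euc n}
    (hζ : inner ℝ (z : Euc n) ζ = 0) :
    fderiv ℝ (unitNormal ρ) (bpt u z) (dbpt u z ζ) = dbpt u z ζ
      - Real.exp (-u z) • ((ζ, 0) : Mink n)
      + (Real.exp (-u z) * inner ℝ (sphGrad u z) ζ) • ((z : Euc n), (1 : ℝ)) := by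
  have hX := hu.hasDerivAt_bpt z hζ
  have h1 : HasDerivAt (fun s => unitNormal ρ (bpt u (sphCurve z hζ s)))
      (fderiv ℝ (unitNormal ρ) (bpt u z) (dbpt u z ζ)) 0 := by
    refine HasFDerivAt.comp_hasDerivAt (l := unitNormal ρ) (0 : ℝ) ?_ hX
    rw [sphCurve_zero]
    exact (h.contDiffAt_unitNormal.differentiableAt (by simp)).hasFDerivAt
  have h2 := hX.sub ((hu.hasDerivAt_sphCurve z hζ).neg.exp.smul (hasDerivAt_null z hζ))
  have hcont : Tendsto (fun s => bptH u (sphCurve z hζ s)) (𝓝 0) (𝓝 (bptH u z)) := by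
    rw [tendsto_subtype_rng]
    have := hX.continuousAt.tendsto
    rwa [sphCurve_zero] at this
  -- The same ρ is a defining function at the nearby points X(w), where h_w is maximal, so the
  -- formula for the normal holds along the whole curve and can be differentiated.
  have heq : (fun s => unitNormal ρ (bpt u (sphCurve z hζ s))) =ᶠ[𝓝 0]
      fun s => bpt u (sphCurve z hζ s) - Real.exp (-u (sphCurve z hζ s)) •
        ((sphCurve z hζ s : Euc n), (1 : ℝ)) := by
    filter_upwards [hcont.eventually h.eventually] with s hs
    set w := sphCurve z hζ s
    have e1 : hfn (bptH u w).1 w = Real.exp (u w) := hfn_bpt_self u w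
    have h3 := hs (mem_frontier_of_hfn_eq hsub (hmem w) e1)
    have h4 := h3.unitNormal_eq (z := w) (fun Y hY => by rw [e1]; exact hsub hY w)
    rw [e1] at h4
    rw [Real.exp_neg]
    exact h4
  have h3 := h1.unique (h2.congr_of_eventuallyEq heq)
  rw [h3]
  simp only [Pi.neg_apply, sphCurve_zero]
  module

lemma unitNormal_bpt {u : Sph n → ℝ} (hsub : Ω ⊆ horoHull u) {z : Sph n}
    (h : IsLocalDefiningFn Ω (bptH u z) ρ) :
    unitNormal ρ (bpt u z) = bpt u z - Real.exp (-u z) • ((z : Euc n), (1 : ℝ)) := by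
  have e1 : hfn (bptH u z).1 z = Real.exp (u z) := hfn_bpt_self u z
  have h4 := h.unitNormal_eq (z := z) (fun Y hY => by rw [e1]; exact hsub hY z)
  rw [e1] at h4
  rw [Real.exp_neg]
  exact h4

lemma lor_unitNormal_dbpt {u : Sph n → ℝ} (hu : SmoothSph u) (hsub : Ω ⊆ horoHull u) {z : Sph n}
    (h : IsLocalDefiningFn Ω (bptH u z) ρ) {ζ : Euc n} (hζ : inner ℝ (z : Euc n) ζ = 0) :
    lor (unitNormal ρ (bpt u z)) (dbpt u z ζ) = 0 := by
  rw [h.unitNormal_bpt hsub, lor_sub_left, lor_smul_left, hu.lor_bpt_dbpt hζ,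
    lor_comm _ (dbpt u z ζ), hu.lor_dbpt_null hζ]
  ring

/-- Principal curvatures in terms of the Hessian form. -/
lemma curvature_eq {u : Sph n → ℝ} (hu : SmoothSph u) (hsub : Ω ⊆ horoHull u)
    (hmem : ∀ z, bptH u z ∈ Ω) {z : Sph n} {κ : ℝ} (h : IsPrincipalCurvature Ω (bptH u z) κ) :
    ∃ ξ : Euc n, ξ ≠ 0 ∧ inner ℝ (z : Euc n) ξ = 0 ∧
      (κ - 1) * (Real.exp (u z) ^ 2 * hessForm u z ξ ξ) = ‖ξ‖ ^ 2 := by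
  obtain ⟨ρ, h, v, hv0, hXv, hνv, hκ⟩ := h
  have hXv' : lor (bpt u z) v = 0 := hXv
  have hνv' : lor (unitNormal ρ (bpt u z)) v = 0 := hνv
  set Z : Mink n := ((z : Euc n), (1 : ℝ)) with hZ
  have hp := Real.exp_pos (-u z)
  have hZv : lor Z v = 0 := by
    have h1 := hνv'
    rw [h.unitNormal_bpt hsub, lor_sub_left, lor_smul_left, hXv', ← hZ] at h1
    have : Real.exp (-u z) * lor Z v = 0 := by linarith
    exact (mul_eq_zero.mp this).resolve_left hp.ne'
  have hv2 : v.2 = inner ℝ (z : Euc n) v.1 := by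
    simp only [lor, hZ] at hZv; linarith
  set ξ := v.1 - v.2 • (z : Euc n) with hξ
  have hv : v = (ξ, 0) + v.2 • Z := by
    refine Prod.ext ?_ ?_
    · simp [hξ, hZ]
    · simp [hZ]
  have hzξ : inner ℝ (z : Euc n) ξ = 0 := by
    rw [hξ, inner_sub_right, real_inner_smul_right, sph_inner, ← hv2]; ring
  have hξ0 : ξ ≠ 0 := by
    intro h0
    rw [h0] at hv
    have h1 : lor (bpt u z) v = -(v.2 * Real.exp (u z)) := by
      rw [hv, lor_add_right, lor_smul_right, lor_bpt_null]
      simp [lor, hZ]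
    rw [hXv'] at h1
    have h2 : v.2 = 0 := by
      have := Real.exp_pos (u z)
      have h3 : v.2 * Real.exp (u z) = 0 := by linarith
      exact (mul_eq_zero.mp h3).resolve_right this.ne'
    rw [h2] at hv
    exact hv0 (by rw [hv]; simp)
  refine ⟨ξ, hξ0, hzξ, ?_⟩
  have hd1 := hu.lor_bpt_dbpt hzξ
  have hd2 := lor_unitNormal_dbpt hu hsub h hzξ
  -- Self-adjointness moves the Weingarten map from the eigenvector v to dX(ξ), on which it is
  -- explicit; ξ is v without its multiple of (z,1).
  have hcomm := h.lor_fderiv_unitNormal_comm (v := dbpt u z ξ) (w := v) hd1 hd2 hXv hνv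
  have e0 : lor (dbpt u z ξ) v = -(Real.exp (u z) * hessForm u z ξ ξ) := by
    conv_lhs => rw [hv]
    rw [lor_add_right, lor_smul_right, hu.lor_dbpt_null hzξ, hu.lor_dbpt_tangent hzξ]
    ring
  have e1 : lor ((ξ, 0) : Mink n) v = ‖ξ‖ ^ 2 := by
    conv_lhs => rw [hv]
    rw [lor_add_right, lor_smul_right]
    simp [lor, hZ, real_inner_comm, hzξ]
  rw [hκ, lor_smul_left] at hcomm
  have hcomm' : lor (fderiv ℝ (unitNormal ρ) (bpt u z) (dbpt u z ξ)) v
    = κ * lor v (dbpt u z ξ) := hcomm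
  rw [fderiv_unitNormal_dbpt hu hsub hmem h hzξ, lor_add_left, lor_sub_left, lor_smul_left,
    lor_smul_left, ← hZ, hZv, lor_comm v, e0, e1] at hcomm'
  have hpq : Real.exp (u z) * Real.exp (-u z) = 1 := by rw [← Real.exp_add]; simp
  have : (κ - 1) * (Real.exp (u z) * hessForm u z ξ ξ) = Real.exp (-u z) * ‖ξ‖ ^ 2 := by
    linarith
  calc (κ - 1) * (Real.exp (u z) ^ 2 * hessForm u z ξ ξ)
      = Real.exp (u z) * ((κ - 1) * (Real.exp (u z) * hessForm u z ξ ξ)) := by ring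
    _ = _ := by rw [this, ← mul_assoc, hpq, one_mul]

/-- Principal curvatures greater than `1` make the Hessian form positive. -/
lemma hessForm_pos {u : Sph n → ℝ} (hu : SmoothSph u) (hsub : Ω ⊆ horoHull u)
    (hmem : ∀ z, bptH u z ∈ Ω) {z : Sph n} (h : IsLocalDefiningFn Ω (bptH u z) ρ) {δ : ℝ}
    (hδ : 0 < δ) (hc : ∀ κ : ℝ, IsPrincipalCurvature Ω (bptH u z) κ → 1 + δ < κ) {ζ : Euc n}
    (hζ : inner ℝ (z : Euc n) ζ = 0) (hζ0 : ζ ≠ 0) : 0 < hessForm u z ζ ζ := by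
  have hd1 := hu.lor_bpt_dbpt hζ
  have hd2 := lor_unitNormal_dbpt hu hsub h hζ
  have hW := fderiv_unitNormal_dbpt hu hsub hmem h hζ
  set Z : Mink n := ((z : Euc n), (1 : ℝ)) with hZ
  have hp := Real.exp_pos (-u z)
  have hd0 : dbpt u z ζ ≠ 0 := by
    intro h0
    rw [h0, map_zero] at hW
    have h2 := congrArg Prod.snd hW
    have h1 := congrArg Prod.fst hW
    simp [hZ] at h1 h2
    rw [h2] at h1
    simp at h1
    exact hζ0 h1
  have hdp : 0 < lor (dbpt u z ζ) (dbpt u z ζ) := lor_self_pos (X := bptH u z) hd1 hd0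
  -- Modulo (z,1) the Weingarten map takes dX(ζ) to dX(ζ) - e^{-u}(ζ,0). After cancelling |dX(ζ)|²
  -- the bound leaves δ|dX(ζ)|² below the Hessian form.
  have key : (1 + δ) * lor (dbpt u z ζ) (dbpt u z ζ)
      ≤ lor (fderiv ℝ (unitNormal ρ) (bpt u z) (dbpt u z ζ)) (dbpt u z ζ) :=
    h.mul_lor_self_le hc hd1 hd2
  rw [hW, lor_add_left, lor_sub_left, lor_smul_left, lor_smul_left, lor_comm Z,
    hu.lor_dbpt_null hζ, lor_comm (ζ, 0), hu.lor_dbpt_tangent hζ] at key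
  have hpq : Real.exp (-u z) * Real.exp (u z) = 1 := by rw [← Real.exp_add]; simp
  have h5 : δ * lor (dbpt u z ζ) (dbpt u z ζ)
      ≤ Real.exp (-u z) * Real.exp (u z) * hessForm u z ζ ζ := by linarith
  rw [hpq, one_mul] at h5
  exact (mul_pos hδ hdp).trans_le h5

end IsLocalDefiningFn

/-! ### Smoothness of the boundary -/

/-- The inverse function theorem for endomaps of finite-dimensional spaces. -/
lemma exists_smooth_localInverse {V : Type*} [NormedAddCommGroup V] [NormedSpace ℝ V]
    [FiniteDimensional ℝ V] {f : V → V} {a : V} (hf : ∀ᶠ x in 𝓝 a, ContDiffAt ℝ ∞ f x)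
    (hinj : ∀ v, fderiv ℝ f a v = 0 → v = 0) :
    ∃ g : V → V, (∀ᶠ y in 𝓝 (f a), ContDiffAt ℝ ∞ g y) ∧ g (f a) = a ∧
      ∀ᶠ x in 𝓝 a, g (f x) = x := by
  have : CompleteSpace V := FiniteDimensional.complete ℝ V
  have hfa := hf.self_of_nhds
  have hker : Function.Injective (fderiv ℝ f a) :=
    (injective_iff_map_eq_zero (fderiv ℝ f a)).mpr hinj
  let e : V ≃L[ℝ] V :=
    (LinearEquiv.ofInjectiveEndo (fderiv ℝ f a : V →ₗ[ℝ] V) hker).toContinuousLinearEquiv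
  have he : (e : V →L[ℝ] V) = fderiv ℝ f a := by ext v; rfl
  have hd : HasFDerivAt f (e : V →L[ℝ] V) a := by
    rw [he]; exact (hfa.differentiableAt (by simp)).hasFDerivAt
  let Φ := hfa.toOpenPartialHomeomorph f hd (by simp)
  have hΦ : ∀ x, Φ x = f x := fun _ => rfl
  have hsrc : a ∈ Φ.source := hfa.mem_toOpenPartialHomeomorph_source hd (by simp)
  have htgt : f a ∈ Φ.target := hfa.image_mem_toOpenPartialHomeomorph_target hd (by simp)
  have hsymm : Φ.symm (f a) = a := Φ.left_inv hsrc
  refine ⟨Φ.symm, ?_, hsymm, ?_⟩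
  · have hcont : Tendsto Φ.symm (𝓝 (f a)) (𝓝 a) := by
      have := (Φ.continuousAt_symm htgt).tendsto
      rwa [hsymm] at this
    -- Invertibility of the derivative is an open condition, so the inverse is smooth on a
    -- neighbourhood and not only at one point.
    have hopen : ∀ᶠ x in 𝓝 a, fderiv ℝ f x ∈ range ((↑) : (V ≃L[ℝ] V) → V →L[ℝ] V) := by
      have hc : ContinuousAt (fderiv ℝ f) a :=
        (hfa.fderiv_right (m := 0) (by simp)).continuousAt
      exact hc.eventually (ContinuousLinearEquiv.isOpen.mem_nhds ⟨e, he⟩)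
    filter_upwards [Φ.open_target.mem_nhds htgt, hcont.eventually hf, hcont.eventually hopen]
      with y hy h1 h2
    obtain ⟨e', he'⟩ := h2
    refine Φ.contDiffAt_symm hy (f₀' := e') ?_ h1
    rw [he']
    exact (h1.differentiableAt (by simp)).hasFDerivAt
  · filter_upwards [Φ.open_source.mem_nhds hsrc] with x hx
    exact Φ.left_inv hx

/-- The map `(x, r) ↦ |x| X(x / |x|) + r (x / |x|, 1)`. -/
def coneMap (u : Sph n → ℝ) (P : Mink n) : Mink n :=
  ‖P.1‖ • bptExt u (‖P.1‖⁻¹ • P.1) + P.2 • ((‖P.1‖⁻¹ • P.1, 1) : Mink n)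

lemma coneMap_smul (u : Sph n → ℝ) (z : Sph n) {s : ℝ} (hs : 0 < s) (r : ℝ) :
    coneMap u (s • (z : Euc n), r) = s • bpt u z + r • ((z : Euc n), (1 : ℝ)) := by
  have h : ‖s • (z : Euc n)‖ = s := by rw [norm_smul, sph_norm, mul_one, Real.norm_of_nonneg hs.le]
  simp only [coneMap, h, smul_smul, inv_mul_cancel₀ hs.ne', one_smul, bptExt_coe]

lemma coneMap_coe (u : Sph n → ℝ) (z : Sph n) (r : ℝ) :
    coneMap u ((z : Euc n), r) = bpt u z + r • ((z : Euc n), (1 : ℝ)) := by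
  have := coneMap_smul u z one_pos r
  simpa only [one_smul] using this

lemma contDiffAt_coneMap {u : Sph n → ℝ} (hu : SmoothSph u) {P : Mink n} (hP : P.1 ≠ 0) :
    ContDiffAt ℝ ∞ (coneMap u) P := by
  have h1 : ContDiffAt ℝ ∞ (fun P : Mink n => ‖P.1‖) P := contDiffAt_fst.norm ℝ hP
  have h2 : ContDiffAt ℝ ∞ (fun P : Mink n => ‖P.1‖⁻¹ • P.1) P :=
    ContDiffAt.smul (h1.inv (norm_ne_zero_iff.mpr hP)) contDiffAt_fst
  have h3 : ContDiffAt ℝ ∞ (bptExt u) (‖P.1‖⁻¹ • P.1) :=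
    hu.contDiffAt_bptExt (smul_ne_zero (inv_ne_zero (norm_ne_zero_iff.mpr hP)) hP)
  have h4 : ContDiffAt ℝ ∞ (fun P : Mink n => bptExt u (‖P.1‖⁻¹ • P.1)) P :=
    ContDiffAt.comp (g := bptExt u) P h3 h2
  have h5 : ContDiffAt ℝ ∞ (fun P : Mink n => ((‖P.1‖⁻¹ • P.1, 1) : Mink n)) P :=
    h2.prodMk contDiffAt_const
  exact ContDiffAt.add (ContDiffAt.smul h1 h4) (ContDiffAt.smul contDiffAt_snd h5)

lemma tangent_decomp (z : Sph n) (x : Euc n) :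
    ∃ (ζ : Euc n) (c : ℝ), inner ℝ (z : Euc n) ζ = 0 ∧ x = ζ + c • (z : Euc n) := by
  refine ⟨x - inner ℝ (z : Euc n) x • (z : Euc n), inner ℝ (z : Euc n) x, ?_, by module⟩
  rw [inner_sub_right, real_inner_smul_right, sph_inner]; ring

/-- The derivative sends (ζ,0), (z,0), (0,1) to dX(ζ), X, (z,1). Pairing a vanishing combination
with (z,1) kills the coefficient of X; pairing with (ζ,0) then leaves the positive Hessian form. -/
lemma fderiv_coneMap_injective {u : Sph n → ℝ} (hu : SmoothSph u) (hpos : HessPos u) (z : Sph n)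
    {v : Mink n} (hv : fderiv ℝ (coneMap u) ((z : Euc n), (0 : ℝ)) v = 0) : v = 0 := by
  set D := fderiv ℝ (coneMap u) ((z : Euc n), (0 : ℝ)) with hD
  have hd : HasFDerivAt (coneMap u) D ((z : Euc n), (0 : ℝ)) :=
    ((contDiffAt_coneMap hu (sph_ne_zero z)).differentiableAt (by simp)).hasFDerivAt
  have hline : ∀ (γ : ℝ → Mink n) (w : Mink n), HasDerivAt γ w 0 → γ 0 = ((z : Euc n), (0 : ℝ)) →
      HasDerivAt (fun s => coneMap u (γ s)) (D w) 0 := by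
    intro γ w h1 h2
    refine HasFDerivAt.comp_hasDerivAt (l := coneMap u) (0 : ℝ) ?_ h1
    rw [h2]; exact hd
  have e1 : ∀ ζ : Euc n, inner ℝ (z : Euc n) ζ = 0 → D (ζ, 0) = dbpt u z ζ := by
    intro ζ hζ
    have h1 := hline (fun s => ((sphCurve z hζ s : Euc n), (0 : ℝ))) (ζ, 0)
      ((hasDerivAt_sphCurve z hζ).prodMk (hasDerivAt_const _ _)) (by rw [sphCurve_zero])
    simp only [coneMap_coe, zero_smul, add_zero] at h1
    exact h1.unique (hu.hasDerivAt_bpt z hζ)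
  have e2 : D ((z : Euc n), 0) = bpt u z := by
    have h1 := hline (fun s => ((1 + s) • (z : Euc n), (0 : ℝ))) ((z : Euc n), 0) (by
      refine HasDerivAt.prodMk ?_ (hasDerivAt_const _ _)
      simpa using ((hasDerivAt_id (0 : ℝ)).const_add 1).smul_const (z : Euc n)) (by simp)
    have h2 : HasDerivAt (fun s : ℝ => (1 + s) • bpt u z) (bpt u z) 0 := by
      simpa using ((hasDerivAt_id (0 : ℝ)).const_add 1).smul_const (bpt u z)
    refine h1.unique (h2.congr_of_eventuallyEq ?_)
    filter_upwards [lt_mem_nhds (show (-1 : ℝ) < 0 by norm_num)] with s hs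
    rw [coneMap_smul u z (by linarith), zero_smul, add_zero]
  have e3 : D (0, 1) = ((z : Euc n), (1 : ℝ)) := by
    have h1 := hline (fun s => ((z : Euc n), s)) (0, 1)
      ((hasDerivAt_const _ _).prodMk (hasDerivAt_id _)) rfl
    have h2 : HasDerivAt (fun s : ℝ => bpt u z + s • ((z : Euc n), (1 : ℝ)))
        ((z : Euc n), (1 : ℝ)) 0 := by
      simpa using ((hasDerivAt_id (0 : ℝ)).smul_const ((z : Euc n), (1 : ℝ))).const_add (bpt u z)
    simp only [coneMap_coe] at h1
    exact h1.unique h2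
  obtain ⟨x, r⟩ := v
  obtain ⟨ζ, c, hζ, rfl⟩ := tangent_decomp z x
  have hdec : ((ζ + c • (z : Euc n), r) : Mink n)
      = (ζ, 0) + c • ((z : Euc n), (0 : ℝ)) + r • ((0, 1) : Mink n) := by simp
  rw [hdec, map_add, map_add, map_smul, map_smul, e1 ζ hζ, e2, e3] at hv
  have hZ := congrArg (fun w => lor w ((z : Euc n), (1 : ℝ))) hv
  simp only [lor_add_left, lor_smul_left, hu.lor_dbpt_null hζ, lor_bpt_null, lor_null_null,
    lor_zero_left] at hZ
  have hc : c = 0 := by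
    have := Real.exp_pos (u z)
    have h3 : c * Real.exp (u z) = 0 := by linarith
    exact (mul_eq_zero.mp h3).resolve_right this.ne'
  have hT := congrArg (fun w => lor w ((ζ, 0) : Mink n)) hv
  have hZζ : lor ((z : Euc n), (1 : ℝ)) ((ζ, 0) : Mink n) = 0 := by simp [lor, hζ]
  simp only [lor_add_left, lor_smul_left, hu.lor_dbpt_tangent hζ, hc, hZζ, lor_zero_left] at hT
  have hζ0 : ζ = 0 := by
    by_contra h0
    have := mul_pos (Real.exp_pos (u z)) (hpos z ζ hζ h0)
    linarith
  have hr := congrArg Prod.snd hv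
  have hd0 : dbpt u z ζ = 0 := by rw [hζ0, dbpt, map_zero]
  rw [hd0, hc] at hr
  simp at hr
  rw [hζ0, hc, hr]; simp

lemma exists_coneMap_inverse {u : Sph n → ℝ} (hu : SmoothSph u) (hpos : HessPos u) (z : Sph n) :
    ∃ g : Mink n → Mink n, (∀ᶠ y in 𝓝 (bpt u z), ContDiffAt ℝ ∞ g y) ∧
      g (bpt u z) = ((z : Euc n), (0 : ℝ)) ∧
      ∀ᶠ x in 𝓝 (((z : Euc n), (0 : ℝ)) : Mink n), g (coneMap u x) = x := by
  have h := exists_smooth_localInverse (f := coneMap u) (a := (((z : Euc n), (0 : ℝ)) : Mink n)) ?_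
    (fun v => fderiv_coneMap_injective hu hpos z)
  · simpa only [coneMap_coe, zero_smul, add_zero] using h
  · have : ∀ᶠ P : Mink n in 𝓝 (((z : Euc n), (0 : ℝ)) : Mink n), P.1 ≠ 0 :=
      continuous_fst.continuousAt.eventually_ne (sph_ne_zero z)
    exact this.mono fun P hP => contDiffAt_coneMap hu hP

/-! ### Injectivity of the boundary map -/

lemma exists_tangent (hn : 1 ≤ n) (z : Sph n) : ∃ ζ : Euc n, ζ ≠ 0 ∧ inner ℝ (z : Euc n) ζ = 0 := by
  have h1 : 0 < Module.finrank ℝ (ℝ ∙ (z : Euc n))ᗮ := by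
    have h2 := Submodule.finrank_add_finrank_orthogonal (ℝ ∙ (z : Euc n))
    rw [finrank_span_singleton (sph_ne_zero z), finrank_euclideanSpace_fin] at h2
    omega
  have := Module.finrank_pos_iff.mp h1
  obtain ⟨ζ, hζ⟩ := exists_ne (0 : (ℝ ∙ (z : Euc n))ᗮ)
  exact ⟨ζ, by simpa using hζ, Submodule.mem_orthogonal_singleton_iff_inner_right.mp ζ.2⟩

/-- A constant map has zero derivative, hence zero Hessian form. The bound n ≥ 1 provides a non-zero
tangent vector. -/
lemma bptH_ne_const (hn : 1 ≤ n) {u : Sph n → ℝ} (hu : SmoothSph u) (hpos : HessPos u) :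
    ¬ ∃ X : Hyp n, ∀ z, bptH u z = X := by
  rintro ⟨X, hX⟩
  have z : Sph n := ⟨EuclideanSpace.single 0 1, by simp⟩
  obtain ⟨ζ, hζ0, hζ⟩ := exists_tangent hn z
  have h1 := hu.hasDerivAt_bpt z hζ
  have h2 : ∀ w, bpt u w = X.1 := fun w => congrArg Subtype.val (hX w)
  simp only [h2] at h1
  have h3 := h1.unique (hasDerivAt_const _ _)
  have h4 := hu.lor_dbpt_tangent (ζ := ζ) hζ
  rw [h3, lor_zero_left] at h4
  have := mul_pos (Real.exp_pos (u z)) (hpos z ζ hζ hζ0)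
  linarith

lemma null_future {X : Hyp n} {W : Mink n} (h0 : lor W W = 0) (hX : lor X.1 W < 0) :
    0 < W.2 ∧ ‖W.1‖ = W.2 := by
  have h1 : ‖W.1‖ ^ 2 = W.2 ^ 2 := by
    simp only [lor, real_inner_self_eq_norm_sq] at h0; nlinarith
  have h2 : ‖W.1‖ = |W.2| := by
    rw [← Real.sqrt_sq (norm_nonneg W.1), h1, Real.sqrt_sq_eq_abs]
  have hpos : 0 < W.2 := by
    by_contra! h3
    rw [abs_of_nonpos h3] at h2
    have h4 := neg_le_of_abs_le (abs_real_inner_le_norm X.1.1 W.1)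
    rw [h2] at h4
    have h5 := hyp_norm_lt X
    simp only [lor] at hX
    nlinarith
  exact ⟨hpos, by rw [h2, abs_of_pos hpos]⟩

/-- The Gauss map is well defined: each boundary point has only one supporting horosphere. -/
lemma bptH_injective (hn : 1 ≤ n) {u : Sph n → ℝ} (hu : HSupport u) (hpos : HessPos u) :
    Function.Injective (bptH u) := by
  intro z₁ z₂ h12
  by_contra hne
  set X := bptH u z₁ with hX
  have hX1 : X.1 = bpt u z₁ := rfl
  have hX2 : X.1 = bpt u z₂ := by rw [h12]; rfl
  set A : Mink n := Real.exp (-u z₁) • ((z₁ : Euc n), (1 : ℝ)) with hA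
  set B : Mink n := Real.exp (-u z₂) • ((z₂ : Euc n), (1 : ℝ)) with hB
  have hee : ∀ t : ℝ, Real.exp (-t) * Real.exp t = 1 := fun t => by rw [← Real.exp_add]; simp
  have hXA : lor X.1 A = -1 := by
    rw [hA, lor_smul_right, hX1, lor_bpt_null, mul_neg, hee]
  have hXB : lor X.1 B = -1 := by
    rw [hB, lor_smul_right, hX2, lor_bpt_null, mul_neg, hee]
  have hAA : lor A A = 0 := by
    rw [hA, lor_smul_left, lor_smul_right, lor_null_null]; ring
  have hBB : lor B B = 0 := by
    rw [hB, lor_smul_left, lor_smul_right, lor_null_null]; ring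
  have hYA : ∀ Y ∈ horoHull u, -1 ≤ lor Y.1 A := by
    intro Y hY
    have h1 := hY z₁
    rw [hfn_eq] at h1
    rw [hA, lor_smul_right]
    nlinarith [hee (u z₁), Real.exp_pos (-u z₁)]
  have hYB : ∀ Y ∈ horoHull u, -1 ≤ lor Y.1 B := by
    intro Y hY
    have h1 := hY z₂
    rw [hfn_eq] at h1
    rw [hB, lor_smul_right]
    nlinarith [hee (u z₂), Real.exp_pos (-u z₂)]
  -- the null vectors spanned by the two normals
  set N : ℝ → Mink n := fun t => X.1 - ((1 - t) • A + t • B) with hN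
  have hNN : ∀ t, lor (N t) (N t) = 1 + 2 * t * (1 - t) * lor A B := by
    intro t
    simp only [hN, lor_sub_left, lor_sub_right, lor_add_left, lor_add_right, lor_smul_left,
      lor_smul_right, X.2.1, hXA, hXB, hAA, hBB, lor_comm A X.1, lor_comm B X.1, lor_comm B A]
    ring
  have hXN : ∀ t, lor X.1 (N t) = 0 := by
    intro t
    simp only [hN, lor_sub_right, lor_add_right, lor_smul_right, X.2.1, hXA, hXB]
    ring
  have hABle : lor A B ≤ 0 := by
    have h1 := lor_self_nonneg (hXN (1 / 2))
    have h2 : lor A B = Real.exp (-u z₁) * Real.exp (-u z₂) *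
        (inner ℝ (z₁ : Euc n) (z₂ : Euc n) - 1) := by
      rw [hA, hB, lor_smul_left, lor_smul_right]
      simp only [lor]; ring
    rw [h2]
    have h3 := real_inner_le_norm (z₁ : Euc n) (z₂ : Euc n)
    rw [sph_norm, sph_norm] at h3
    exact mul_nonpos_of_nonneg_of_nonpos (by positivity) (by linarith)
  -- If the two normals are opposite, then A + B = 2X and the two horo-balls meet only at X, so the
  -- hull is a point.
  by_cases hanti : lor A B = -2
  · refine bptH_ne_const hn hu.smooth hpos ⟨X, fun z => ?_⟩
    have hm := hu.bptH_mem z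
    have h1 : A + B - (2 : ℝ) • X.1 = 0 := by
      refine eq_zero_of_lor_self (X := X) ?_ ?_
      · simp only [lor_sub_right, lor_add_right, lor_smul_right, hXA, hXB, X.2.1]; ring
      · simp only [lor_sub_left, lor_sub_right, lor_add_left, lor_add_right, lor_smul_left,
          lor_smul_right, X.2.1, hXA, hXB, hAA, hBB, lor_comm A X.1, lor_comm B X.1, lor_comm B A,
          hanti]
        norm_num
    refine eq_of_lor_eq ?_
    have h2 := hYA _ hm
    have h3 := hYB _ hm
    have h4 := congrArg (fun w => lor (bptH u z).1 w) h1
    simp only [lor_sub_right, lor_add_right, lor_smul_right, lor_zero_right] at h4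
    linarith
  have hABlt : lor A B ≠ 0 := by
    intro h0
    have h1 : A - B = 0 := by
      refine eq_zero_of_lor_self (X := X) ?_ ?_
      · simp only [lor_sub_right, hXA, hXB]; ring
      · simp only [lor_sub_left, lor_sub_right, hAA, hBB, lor_comm B A, h0]; norm_num
    have h2 := sub_eq_zero.mp h1
    have h3 := congrArg Prod.snd h2
    have h4 := congrArg Prod.fst h2
    simp only [hA, hB, Prod.smul_snd, Prod.smul_fst, smul_eq_mul, mul_one] at h3 h4
    rw [h3] at h4
    exact hne (Subtype.ext (smul_right_injective _ (Real.exp_pos (-u z₂)).ne' h4))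
  -- X - W t is a unit normal between the two given ones, and W t is the null vector of the
  -- corresponding horosphere through X.
  set W : ℝ → Mink n := fun t => X.1 - (Real.sqrt (lor (N t) (N t)))⁻¹ • N t with hW
  have hN0 : N 0 = X.1 - A := by simp [hN]
  have hW0 : W 0 = A := by simp only [hW, hNN]; simp [hN0]
  have hWc : ContinuousAt W 0 := by
    have h1 : Continuous N := by fun_prop
    have h2 : Continuous fun t => Real.sqrt (lor (N t) (N t)) :=
      (continuous_lor.comp (h1.prodMk h1)).sqrt
    refine continuousAt_const.sub ((h2.continuousAt.inv₀ ?_).smul h1.continuousAt)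
    rw [hNN]; simp
  have hev : ∀ᶠ t : ℝ in 𝓝[>] 0, 0 < lor (N t) (N t) ∧ t < 1 / 2 := by
    refine Eventually.filter_mono nhdsWithin_le_nhds ?_
    have h1 : ContinuousAt (fun t : ℝ => lor (N t) (N t)) 0 := by
      simp only [hNN]; fun_prop
    exact (h1.eventually (lt_mem_nhds (show 0 < lor (N 0) (N 0) by rw [hNN]; norm_num))).and (gt_mem_nhds (by norm_num))
  -- The interpolated horospheres also support the hull at X, so X has supporting directions w ≠ z₁
  -- arbitrarily close to z₁.
  have key : ∀ᶠ t : ℝ in 𝓝[>] 0, ∃ w : Sph n, w ≠ z₁ ∧ bptH u w = X ∧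
      (w : Euc n) = (W t).2⁻¹ • (W t).1 := by
    filter_upwards [hev, self_mem_nhdsWithin] with t ⟨ht1, ht2⟩ ht0
    have ht0' : (0 : ℝ) < t := ht0
    set m := Real.sqrt (lor (N t) (N t)) with hm
    have hm0 : 0 < m := Real.sqrt_pos.mpr ht1
    have hmm : m * m = lor (N t) (N t) := Real.mul_self_sqrt ht1.le
    have htt : 0 < t * (1 - t) := mul_pos ht0' (by linarith)
    have hm1 : m ≤ 1 := by
      rw [hNN] at hmm
      nlinarith
    have hWt : W t = X.1 - m⁻¹ • (X.1 - ((1 - t) • A + t • B)) := rfl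
    have hWW : lor (W t) (W t) = 0 := by
      have h1 : lor (W t) (W t) = -1 + (m⁻¹ * m) * (m⁻¹ * m) := by
        rw [show (m⁻¹ * m) * (m⁻¹ * m) = m⁻¹ * (m⁻¹ * (m * m)) by ring, hmm]
        simp only [hW, lor_sub_left, lor_sub_right, lor_smul_left, lor_smul_right, X.2.1, hXN,
          lor_comm (N t) X.1, ← hm]
        ring
      rw [h1, inv_mul_cancel₀ hm0.ne']; norm_num
    have hXW : lor X.1 (W t) = -1 := by
      simp only [hW, lor_sub_right, lor_smul_right, X.2.1, hXN]; ring
    obtain ⟨hW2, hWn⟩ := null_future hWW (by rw [hXW]; norm_num : lor X.1 (W t) < 0)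
    set w : Sph n := ⟨(W t).2⁻¹ • (W t).1, by
      rw [mem_sphere_zero_iff_norm, norm_smul, norm_inv, Real.norm_of_nonneg hW2.le, hWn,
        inv_mul_cancel₀ hW2.ne']⟩ with hw
    have hWw : W t = (W t).2 • ((w : Euc n), (1 : ℝ)) := by
      refine Prod.ext ?_ ?_
      · simp only [hw, Prod.smul_fst, smul_smul, mul_inv_cancel₀ hW2.ne', one_smul]
      · simp
    have hfnW : ∀ Y : Hyp n, lor Y.1 (W t) = -((W t).2 * hfn Y.1 w) := by
      intro Y
      conv_lhs => rw [hWw]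
      rw [lor_smul_right, hfn_eq]; ring
    have hle : ∀ Y ∈ horoHull u, -1 ≤ lor Y.1 (W t) := by
      intro Y hY
      have e1 := hYA Y hY
      have e2 := hYB Y hY
      have e3 := hyp_lor_le Y X
      -- The coefficient 1 - m⁻¹ of ⟨Y,X⟩ is at most 0 and ⟨Y,X⟩ ≤ -1, which compensates for the
      -- factor m⁻¹ in front of the remaining term.
      have e4 : lor Y.1 (W t) = lor Y.1 X.1 - m⁻¹ * (lor Y.1 X.1
          - ((1 - t) * lor Y.1 A + t * lor Y.1 B)) := by
        rw [hWt]
        simp only [lor_sub_right, lor_add_right, lor_smul_right]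
      have e5 : -1 ≤ (1 - t) * lor Y.1 A + t * lor Y.1 B := by nlinarith
      have e6 : 1 ≤ m⁻¹ := (one_le_inv₀ hm0).mpr hm1
      rw [e4]
      nlinarith
    refine ⟨w, ?_, ?_, rfl⟩
    · intro hwz
      have h1 : (W t).2 = Real.exp (-u z₁) := by
        have h2 := hfnW X
        rw [hXW, hwz, hX1, hfn_bpt_self] at h2
        have h3 := hee (u z₁)
        exact mul_right_cancel₀ (Real.exp_pos (u z₁)).ne' (by linarith)
      rw [hwz, h1, ← hA] at hWw
      have h2 : lor A (W t) = 0 := by rw [hWw, hAA]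
      rw [hWt] at h2
      simp only [lor_sub_right, lor_add_right, lor_smul_right, lor_comm A X.1, hXA, hAA] at h2
      -- If w = z₁ then W t = A; comparing this value of m with ⟨N,N⟩ = m² forces ⟨A,B⟩ to be 0 or
      -- -2.
      have h3 : m = 1 + t * lor A B := by
        have h4 : m * m⁻¹ = 1 := mul_inv_cancel₀ hm0.ne'
        linear_combination (-m) * h2 + (1 + t * lor A B) * h4
      rw [hNN, h3] at hmm
      have h4 : t * lor A B * (t * (lor A B + 2)) = 0 := by linarith
      have h5 : lor A B + 2 ≠ 0 := fun h => hanti (by linarith)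
      exact (mul_ne_zero (mul_ne_zero ht0'.ne' hABlt) (mul_ne_zero ht0'.ne' h5)) h4
    · have h1 : ∀ Y ∈ horoHull u, hfn Y.1 w ≤ hfn X.1 w := by
        intro Y hY
        have h2 := hle Y hY
        have h3 := hfnW X
        rw [hfnW] at h2
        rw [hXW] at h3
        exact le_of_mul_le_mul_left (by linarith) hW2
      have hXm : X ∈ horoHull u := hu.bptH_mem z₁
      have h2 := h1 _ (hu.bptH_mem w)
      have h3 : hfn (bptH u w).1 w = Real.exp (u w) := hfn_bpt_self u w
      rw [h3] at h2
      exact (eq_bptH_of_le (hu.smooth.differentiableAt w) hXm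
        (le_antisymm (hXm w) h2)).symm
  -- The directions w tend to z₁ and have the same image, against the local injectivity of the
  -- boundary map.
  obtain ⟨g, -, -, hg⟩ := exists_coneMap_inverse hu.smooth hpos z₁
  have htend : Tendsto (fun t => (((W t).2⁻¹ • (W t).1, 0) : Mink n)) (𝓝[>] 0)
      (𝓝 (((z₁ : Euc n), (0 : ℝ)) : Mink n)) := by
    have hA2 : A.2 ≠ 0 := by simp [hA]
    have h1 : ContinuousAt (fun t => (((W t).2⁻¹ • (W t).1, 0) : Mink n)) 0 := by
      refine ContinuousAt.prodMk ((hWc.snd.inv₀ ?_).smul hWc.fst) continuousAt_const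
      rw [hW0]; exact hA2
    have h2 := h1.tendsto
    rw [hW0] at h2
    have h3 : A.2⁻¹ • A.1 = (z₁ : Euc n) := by
      simp [hA, smul_smul]
    rw [h3] at h2
    exact h2.mono_left nhdsWithin_le_nhds
  obtain ⟨t, ⟨w, hw1, hw2, hw3⟩, hgt⟩ := (key.and (htend.eventually hg)).exists
  rw [← hw3, coneMap_coe] at hgt
  have hg0 := hg.self_of_nhds
  rw [coneMap_coe] at hg0
  have h5 : bpt u w = bpt u z₁ := congrArg Subtype.val hw2
  rw [h5, zero_smul, add_zero] at hgt
  rw [zero_smul, add_zero, hgt] at hg0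
  exact hw1 (Subtype.ext (congrArg Prod.fst hg0))

/-! ### Smooth defining functions of the hull -/

lemma sphGrad_add_const (u : Sph n → ℝ) (c : ℝ) (z : Sph n) :
    sphGrad (fun z => u z + c) z = sphGrad u z := by
  simp only [sphGrad, gradient]
  rw [(radialExt_comp_eventuallyEq u (· + c) (sph_ne_zero z)).fderiv_eq, fderiv_add_const]

/-- Points at a given horospherical ratio from the hull lie on a normal geodesic. -/
lemma eq_coneMap_of_le {u : Sph n → ℝ} (hu : SmoothSph u) {Y : Hyp n} {z : Sph n} {G : ℝ}
    (hG : 0 < G) (hle : ∀ w : Sph n, hfn Y.1 w ≤ G * Real.exp (u w))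
    (heq : hfn Y.1 z = G * Real.exp (u z)) :
    Y.1 = coneMap u (G • (z : Euc n), Real.exp (-u z) / 2 * (G⁻¹ - G)) := by
  -- The function u + log G is touched by Y at z, so Y is the point given by its 1-jet, which
  -- differs from that of u only in the value.
  have hexp : ∀ w, Real.exp (u w + Real.log G) = G * Real.exp (u w) := fun w => by
    rw [Real.exp_add, Real.exp_log hG, mul_comm]
  have hd : DifferentiableAt ℝ (radialExt fun w => u w + Real.log G) (z : Euc n) :=
    ((hu.differentiableAt z).add_const _).congr_of_eventuallyEq
      (radialExt_comp_eventuallyEq u (· + Real.log G) (sph_ne_zero z))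
  have h1 := congrArg Subtype.val (eq_bptH_of_le hd (fun w => (hle w).trans_eq (hexp w).symm)
    (heq.trans (hexp z).symm))
  have h2 : Real.exp (-2 * (u z + Real.log G)) = (G⁻¹ * Real.exp (-u z)) ^ 2 := by
    rw [← Real.exp_log (inv_pos.mpr hG), Real.log_inv, ← Real.exp_add, ← Real.exp_nat_mul]
    congr 1; push_cast; ring
  have h3 : Real.exp (-2 * u z) = Real.exp (-u z) ^ 2 := by
    rw [← Real.exp_nat_mul]; congr 1; push_cast; ring
  have h4 : Real.exp (u z) * Real.exp (-u z) = 1 := by rw [← Real.exp_add]; simp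
  rw [h1, coneMap_smul u z hG]
  simp only [bptH, bpt, sphGrad_add_const, hexp, h2, h3]
  have h5 : (G⁻¹ - G) / 2 * Real.exp (-u z) =
      G * Real.exp (u z) * ((G⁻¹ * Real.exp (-u z)) ^ 2 / 2 - Real.exp (-u z) ^ 2 / 2) := by
    have h6 : G * G⁻¹ = 1 := mul_inv_cancel₀ hG.ne'
    linear_combination (-(Real.exp (-u z) / 2) * (G * G⁻¹ * G⁻¹ - G)) * h4
      - (G⁻¹ * Real.exp (-u z) / 2) * h6
  have h7 : Real.exp (-u z) / 2 * (G⁻¹ - G) = (G⁻¹ - G) / 2 * Real.exp (-u z) := by ring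
  rw [h7, h5]
  module

/-- The ratio `h_z(Y) / e^{u(z)}`. -/
def horoRatio (u : Sph n → ℝ) (Y : Hyp n) (z : Sph n) : ℝ := hfn Y.1 z * Real.exp (-u z)

lemma horoRatio_pos (u : Sph n → ℝ) (Y : Hyp n) (z : Sph n) : 0 < horoRatio u Y z :=
  mul_pos (hfn_pos Y z) (Real.exp_pos _)

lemma hfn_eq_horoRatio (u : Sph n → ℝ) (Y : Hyp n) (z : Sph n) :
    hfn Y.1 z = horoRatio u Y z * Real.exp (u z) := by
  rw [horoRatio, mul_assoc, ← Real.exp_add]; simp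

lemma continuous_horoRatio {u : Sph n → ℝ} (hu : Continuous u) :
    Continuous fun P : Hyp n × Sph n => horoRatio u P.1 P.2 := by
  have h1 : Continuous fun P : Hyp n × Sph n => hfn P.1.1 (P.2 : Euc n) :=
    continuous_hfn.comp ((continuous_subtype_val.comp continuous_fst).prodMk
      (continuous_subtype_val.comp continuous_snd))
  exact h1.mul (Real.continuous_exp.comp (hu.comp continuous_snd).neg)

lemma horoRatio_le_one {u : Sph n → ℝ} {Y : Hyp n} {z : Sph n} :
    horoRatio u Y z ≤ 1 ↔ hfn Y.1 z ≤ Real.exp (u z) := by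
  rw [hfn_eq_horoRatio u, ← mul_le_iff_le_one_left (Real.exp_pos (u z))]

lemma horoRatio_lt_one (hn : 1 ≤ n) {u : Sph n → ℝ} (hu : HSupport u) (hpos : HessPos u)
    {z w : Sph n} (hw : w ≠ z) : horoRatio u (bptH u z) w < 1 := by
  refine lt_of_le_of_ne (horoRatio_le_one.mpr (hu.bptH_mem z w)) fun h => hw ?_
  refine bptH_injective hn hu hpos ?_
  refine (eq_bptH_of_le (hu.smooth.differentiableAt w) (hu.bptH_mem z) ?_).symm
  rw [hfn_eq_horoRatio u, h, one_mul]

/-- Y lies in the hull if and only if the largest ratio G of h_w(Y) to e^{u(w)} is at most 1. If G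
is attained at w, then Y is the image under `coneMap` of a pair with first component Gw, so G is the
norm of the first component of a local inverse, hence smooth in Y although defined as a maximum. -/
lemma exists_localDefiningFn (hn : 1 ≤ n) {u : Sph n → ℝ} (hu : HSupport u) (hpos : HessPos u)
    (z : Sph n) : ∃ ρ : Mink n → ℝ, IsLocalDefiningFn (horoHull u) (bptH u z) ρ := by
  have hc := hu.smooth.continuous
  have hF := continuous_horoRatio hc
  obtain ⟨g, hgs, hg0, hg⟩ := exists_coneMap_inverse hu.smooth hpos z
  have hρs : ∀ᶠ Y in 𝓝 (bpt u z), ContDiffAt ℝ ∞ (fun Y => ‖(g Y).1‖ - 1) Y := by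
    have h1 : ContinuousAt (fun Y => (g Y).1) (bpt u z) :=
      (hgs.self_of_nhds.continuousAt).fst
    have h2 : ∀ᶠ Y in 𝓝 (bpt u z), (g Y).1 ≠ 0 :=
      h1.eventually_ne (by rw [hg0]; exact sph_ne_zero z)
    filter_upwards [hgs, h2] with Y h3 h4
    exact (h3.fst.norm ℝ h4).sub contDiffAt_const
  have hone : horoRatio u (bptH u z) z = 1 := by
    have h1 := hfn_eq_horoRatio u (bptH u z) z
    have h2 : hfn (bptH u z).1 z = Real.exp (u z) := hfn_bpt_self u z
    rw [h2] at h1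
    exact (mul_eq_right₀ (Real.exp_pos _).ne').mp h1.symm
  refine ⟨fun Y => ‖(g Y).1‖ - 1, ⟨⟨_, hρs, fun Y hY => ContDiffAt.contDiffWithinAt hY⟩, ?_, ?_, ?_⟩⟩
  · have hP : ∀ᶠ P : Hyp n × Sph n in 𝓝 (bptH u z) ×ˢ 𝓝 z,
        g (coneMap u (horoRatio u P.1 P.2 • (P.2 : Euc n),
          Real.exp (-u P.2) / 2 * ((horoRatio u P.1 P.2)⁻¹ - horoRatio u P.1 P.2)))
        = (horoRatio u P.1 P.2 • (P.2 : Euc n),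
          Real.exp (-u P.2) / 2 * ((horoRatio u P.1 P.2)⁻¹ - horoRatio u P.1 P.2)) := by
      rw [← nhds_prod_eq]
      have h1 : Continuous fun P : Hyp n × Sph n => ((horoRatio u P.1 P.2 • (P.2 : Euc n),
          Real.exp (-u P.2) / 2 * ((horoRatio u P.1 P.2)⁻¹ - horoRatio u P.1 P.2)) : Mink n) := by
        refine Continuous.prodMk (hF.smul (continuous_subtype_val.comp continuous_snd)) ?_
        refine ((Real.continuous_exp.comp (hc.comp continuous_snd).neg).div_const 2).mul ?_
        exact (hF.inv₀ fun P => (horoRatio_pos u P.1 P.2).ne').sub hF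
      have h2 := h1.tendsto (bptH u z, z)
      simp only [hone, one_smul, inv_one, sub_self, mul_zero] at h2
      exact h2.eventually hg
    obtain ⟨A, hA, N, hN, hAN⟩ := eventually_prod_iff.mp hP
    obtain ⟨N', hN'N, hN'o, hzN'⟩ := mem_nhds_iff.mp hN
    have hcpt : IsCompact N'ᶜ := hN'o.isClosed_compl.isCompact
    -- By injectivity the ratio at X(z) is below 1 away from z, so for nearby Y the maximising
    -- direction stays where the local inverse is available.
    have hfar : ∀ᶠ Y in 𝓝 (bptH u z), ∀ w ∈ N'ᶜ, horoRatio u Y w < horoRatio u Y z := by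
      refine hcpt.eventually_forall_of_forall_eventually fun w hw => ?_
      have h1 : Continuous fun P : Hyp n × Sph n => horoRatio u P.1 z :=
        hF.comp (continuous_fst.prodMk continuous_const)
      refine hF.continuousAt.eventually_lt h1.continuousAt ?_
      show horoRatio u (bptH u z) w < horoRatio u (bptH u z) z
      rw [hone]
      exact horoRatio_lt_one hn hu hpos fun h => hw (h ▸ hzN')
    filter_upwards [hA, hfar] with Y hYA hYf
    obtain ⟨w, -, hw⟩ := isCompact_univ.exists_isMaxOn (⟨z, mem_univ z⟩ : (univ : Set (Sph n)).Nonempty)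
      (f := fun w => horoRatio u Y w)
      (hF.comp (continuous_const.prodMk continuous_id)).continuousOn
    have hmax : ∀ v, horoRatio u Y v ≤ horoRatio u Y w := fun v => hw (mem_univ v)
    have hwN : w ∈ N' := by
      by_contra h
      exact absurd (hmax z) (not_le.mpr (hYf w h))
    have hYeq := eq_coneMap_of_le (Y := Y) hu.smooth (horoRatio_pos u Y w) (fun v => by
      rw [hfn_eq_horoRatio u Y v]
      exact mul_le_mul_of_nonneg_right (hmax v) (Real.exp_pos _).le) (hfn_eq_horoRatio u Y w)
    have h1 := hAN hYA (hN'N hwN)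
    dsimp only at h1
    rw [← hYeq] at h1
    have h2 : ‖(g Y.1).1‖ = horoRatio u Y w := by
      rw [h1, norm_smul, sph_norm, mul_one, Real.norm_of_nonneg (horoRatio_pos u Y w).le]
    rw [h2, sub_nonpos]
    exact ⟨fun h => horoRatio_le_one.mpr (h w), fun h v => horoRatio_le_one.mp ((hmax v).trans h)⟩
  · show ‖(g (bpt u z)).1‖ - 1 = 0
    rw [hg0, sph_norm, sub_self]
  · intro h0
    set ρ : Mink n → ℝ := fun Y => ‖(g Y).1‖ - 1 with hρ
    set v : Mink n := bpt u z - Real.exp (-u z) • ((z : Euc n), (1 : ℝ)) with hv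
    have hXv : lor (bpt u z) v = 0 := by
      have h1 : lor (bpt u z) (bpt u z) = -1 := (bptH u z).2.1
      have h2 : Real.exp (-u z) * Real.exp (u z) = 1 := by rw [← Real.exp_add]; simp
      rw [hv, lor_sub_right, lor_smul_right, lor_bpt_null, h1]
      linarith
    have h1 : fderiv ℝ ρ (bpt u z) v = 0 := by
      have h2 := lor_hypGrad ρ hXv
      rw [← h2]
      change hypGrad ρ (bpt u z) = 0 at h0
      rw [h0, lor_zero_left]
    have h3 : HasDerivAt (fun s : ℝ => ρ (bpt u z + s • v)) (fderiv ℝ ρ (bpt u z) v) 0 := by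
      refine HasFDerivAt.comp_hasDerivAt (l := ρ) (0 : ℝ) ?_
        (by simpa using ((hasDerivAt_id (0 : ℝ)).smul_const v).const_add (bpt u z))
      rw [zero_smul, add_zero]
      exact (hρs.self_of_nhds.differentiableAt (by simp)).hasFDerivAt
    -- Along the normal v = X - e^{-u}(z,1) the cone coordinates are (1 + s)z and -s e^{-u}, so ρ
    -- equals s and its gradient cannot vanish.
    have h4 : (fun s : ℝ => ρ (bpt u z + s • v)) =ᶠ[𝓝 0] fun s => s := by
      have h5 : Tendsto (fun s : ℝ => (((1 + s) • (z : Euc n), -s * Real.exp (-u z)) : Mink n))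
          (𝓝 0) (𝓝 ((z : Euc n), 0)) := by
        have h6 : Continuous fun s : ℝ =>
          (((1 + s) • (z : Euc n), -s * Real.exp (-u z)) : Mink n) := by fun_prop
        simpa using h6.tendsto 0
      filter_upwards [h5.eventually hg, lt_mem_nhds (show (-1 : ℝ) < 0 by norm_num)] with s h6 h7
      have h8 : (0 : ℝ) < 1 + s := by linarith
      rw [coneMap_smul u z h8] at h6
      have h9 : bpt u z + s • v = (1 + s) • bpt u z + (-s * Real.exp (-u z)) •
          ((z : Euc n), (1 : ℝ)) := by rw [hv]; module
      rw [h9, hρ]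
      dsimp only
      rw [h6, norm_smul, sph_norm, mul_one, Real.norm_of_nonneg h8.le]
      ring
    have h5 := h3.unique ((hasDerivAt_id (0 : ℝ)).congr_of_eventuallyEq h4)
    rw [h1] at h5
    exact zero_ne_one h5

/-! ### The uniform curvature bound -/

lemma continuous_norm_coe {V : Type*} [NormedAddCommGroup V] [NormedSpace ℝ V] {F : Euc n → V}
    (hF : ∀ z : Sph n, ContDiffAt ℝ 0 F (z : Euc n)) : Continuous fun z : Sph n => ‖F (z : Euc n)‖ :=
  continuous_iff_continuousAt.mpr fun z =>
    (ContinuousAt.comp (g := F) (hF z).continuousAt continuous_subtype_val.continuousAt).norm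

/-- The negative terms of the form are dropped and the others are bounded by compactness of the
sphere. -/
lemma exists_hessForm_le {u : Sph n → ℝ} (hu : SmoothSph u) :
    ∃ C : ℝ, ∀ (z : Sph n) (ζ : Euc n),
      Real.exp (u z) ^ 2 * hessForm u z ζ ζ ≤ C * ‖ζ‖ ^ 2 := by
  have h1 : Continuous fun z : Sph n => ‖sphGrad u z‖ :=
    continuous_norm_coe (F := gradient (radialExt u))
      fun z => (hu.contDiffAt_gradient (sph_ne_zero z)).of_le (by simp)
  have h2 : Continuous fun z : Sph n => ‖fderiv ℝ (fderiv ℝ (radialExt u)) (z : Euc n)‖ :=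
    continuous_norm_coe (F := fderiv ℝ (fderiv ℝ (radialExt u)))
      fun z => (hu.contDiffAt_fderiv (sph_ne_zero z)).fderiv_right (m := 0) (by simp)
  have h3 : Continuous fun z : Sph n => Real.exp (u z) ^ 2 *
      (‖fderiv ℝ (fderiv ℝ (radialExt u)) (z : Euc n)‖ + ‖sphGrad u z‖ ^ 2 + 1) := by
    have h4 : ∀ f₁ f₂ f₃ : Sph n → ℝ, Continuous f₁ → Continuous f₂ → Continuous f₃ →
        Continuous fun z => Real.exp (f₁ z) ^ 2 * (f₂ z + f₃ z ^ 2 + 1) := by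
      intro f₁ f₂ f₃ _ _ _; fun_prop
    exact h4 u _ _ hu.continuous h2 h1
  obtain ⟨C, hC⟩ := (isCompact_range h3).bddAbove
  refine ⟨C, fun z ζ => ?_⟩
  refine le_trans ?_ (mul_le_mul_of_nonneg_right (hC ⟨z, rfl⟩) (sq_nonneg ‖ζ‖))
  dsimp only
  rw [mul_assoc]
  refine mul_le_mul_of_nonneg_left ?_ (sq_nonneg _)
  have h4 := (Real.norm_eq_abs _ ▸ le_abs_self _ :
    fderiv ℝ (fderiv ℝ (radialExt u)) (z : Euc n) ζ ζ ≤ ‖_‖).trans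
    ((fderiv ℝ (fderiv ℝ (radialExt u)) (z : Euc n)).le_opNorm₂ ζ ζ)
  have h5 : inner ℝ (sphGrad u z) ζ * inner ℝ (sphGrad u z) ζ ≤ ‖sphGrad u z‖ ^ 2 * ‖ζ‖ ^ 2 := by
    have := real_inner_mul_inner_self_le (sphGrad u z) ζ
    rwa [real_inner_self_eq_norm_sq, real_inner_self_eq_norm_sq] at this
  simp only [hessForm, real_inner_self_eq_norm_sq]
  nlinarith [mul_nonneg (sq_nonneg ‖sphGrad u z‖) (sq_nonneg ‖ζ‖), sq_nonneg ‖ζ‖,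
    mul_nonneg (Real.exp_pos (-2 * u z)).le (sq_nonneg ‖ζ‖)]

lemma isUniformlyHConvex_horoHull (hn : 1 ≤ n) {u : Sph n → ℝ} (hu : HSupport u)
    (hpos : HessPos u) : IsUniformlyHConvex (horoHull u) := by
  have hdom := isHConvexDomain_horoHull hu
  refine ⟨⟨hdom.isCompact, isConnected_horoHull hu, ?_, ?_⟩, ?_⟩
  · refine hdom.interior_or_point.resolve_right ?_
    rintro ⟨X, hX⟩
    refine bptH_ne_const hn hu.smooth hpos ⟨X, fun z => ?_⟩
    have := hu.bptH_mem z
    rwa [hX] at this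
  · rw [frontier_horoHull hu]
    rintro _ ⟨z, rfl⟩
    exact exists_localDefiningFn hn hu hpos z
  · obtain ⟨C, hC⟩ := exists_hessForm_le hu.smooth
    -- The curvature formula gives 1 ≤ (κ - 1)C; replacing C by 2(|C| + 1) keeps the constant
    -- positive and makes the inequality strict.
    refine ⟨(2 * (|C| + 1))⁻¹, by positivity, ?_⟩
    rw [frontier_horoHull hu]
    rintro _ ⟨z, rfl⟩ κ hκ
    obtain ⟨ξ, hξ0, hξ, h1⟩ :=
      IsLocalDefiningFn.curvature_eq hu.smooth subset_rfl hu.bptH_mem hκ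
    have h2 : 0 < Real.exp (u z) ^ 2 * hessForm u z ξ ξ :=
      mul_pos (pow_pos (Real.exp_pos _) 2) (hpos z ξ hξ hξ0)
    have h3 : 0 < ‖ξ‖ ^ 2 := pow_pos (norm_pos_iff.mpr hξ0) 2
    have h4 : 0 < κ - 1 := by
      by_contra! h4
      linarith [mul_nonpos_of_nonpos_of_nonneg h4 h2.le]
    have h5 : 1 ≤ (κ - 1) * C := by
      have h6 := mul_le_mul_of_nonneg_left (hC z ξ) h4.le
      rw [h1, ← mul_assoc] at h6
      exact le_of_mul_le_mul_right (by linarith) h3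
    have h6 : 1 < (κ - 1) * (2 * (|C| + 1)) := by nlinarith [le_abs_self C, abs_nonneg C]
    have h7 : (2 * (|C| + 1))⁻¹ < κ - 1 := by
      rw [inv_lt_iff_one_lt_mul₀ (by positivity)]; exact h6
    linarith

/-! ### From local to global strict convexity -/

section Chain

variable {E : Type*} [NormedAddCommGroup E]

/-- Chains of points of `K` from `x` to `y`, with steps at most `δ`. -/
def chains (K : Set E) (x y : E) (N : ℕ) (δ : ℝ) : Set (ℕ → E) :=
  {v | (∀ i, v i ∈ K) ∧ v 0 = x ∧ (∀ i, N ≤ i → v i = y) ∧ ∀ i, dist (v i) (v (i + 1)) ≤ δ}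

/-- Chains are infinite sequences that are constant from index N on, so Tychonoff's theorem applies.
-/
lemma isCompact_chains {K : Set E} (hK : IsCompact K) (x y : E) (N : ℕ) (δ : ℝ) :
    IsCompact (chains K x y N δ) := by
  refine (isCompact_univ_pi fun _ : ℕ => hK).of_isClosed_subset ?_ fun v hv i _ => hv.1 i
  have h1 : IsClosed {v : ℕ → E | ∀ i, v i ∈ K} := by
    rw [ofPred_forall]
    exact isClosed_iInter fun i => hK.isClosed.preimage (continuous_apply i)
  have h2 : IsClosed {v : ℕ → E | v 0 = x} := isClosed_eq (continuous_apply 0) continuous_const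
  have h3 : IsClosed {v : ℕ → E | ∀ i, N ≤ i → v i = y} := by
    simp only [ofPred_forall]
    exact isClosed_iInter fun i => isClosed_iInter fun _ =>
      isClosed_eq (continuous_apply i) continuous_const
  have h4 : IsClosed {v : ℕ → E | ∀ i, dist (v i) (v (i + 1)) ≤ δ} := by
    rw [ofPred_forall]
    exact isClosed_iInter fun i =>
      isClosed_le ((continuous_apply i).dist (continuous_apply (i + 1))) continuous_const
  exact h1.inter (h2.inter (h3.inter h4))

lemma exists_chain {K : Set E} (hK : IsPreconnected K) {x y : E} (hx : x ∈ K) (hy : y ∈ K)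
    {δ : ℝ} (hδ : 0 < δ) : ∃ N, (chains K x y N δ).Nonempty := by
  have h : Relation.ReflTransGen (fun a b => b ∈ K ∧ dist a b ≤ δ) x y := by
    refine hK.induction₂' (fun a b => Relation.ReflTransGen (fun a b => b ∈ K ∧ dist a b ≤ δ) a b)
      (fun a ha => ?_) (fun a b c _ _ _ => Relation.ReflTransGen.trans) hx hy
    filter_upwards [self_mem_nhdsWithin, mem_nhdsWithin_of_mem_nhds (Metric.ball_mem_nhds a hδ)]
      with b hb hab
    rw [Metric.mem_ball] at hab
    exact ⟨.single ⟨hb, by rw [dist_comm]; exact hab.le⟩, .single ⟨ha, hab.le⟩⟩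
  induction h with
  | refl => exact ⟨0, fun _ => x, fun _ => hx, rfl, fun _ _ => rfl, fun _ => by simpa using hδ.le⟩
  | @tail b c hab hbc ih =>
    have hb : b ∈ K := by
      rcases hab.cases_tail with h | ⟨d, -, h⟩
      · rwa [h]
      · exact h.1
    obtain ⟨N, v, h1, h2, h3, h4⟩ := ih hb
    refine ⟨N + 1, fun i => if i ≤ N then v i else c, fun i => ?_, ?_, fun i hi => ?_, fun i => ?_⟩
    · dsimp only
      split_ifs
      exacts [h1 i, hbc.1]
    · simpa using h2
    · dsimp only
      rw [if_neg (by omega)]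
    · dsimp only
      rcases lt_trichotomy i N with hi | hi | hi
      · rw [if_pos hi.le, if_pos (by omega)]; exact h4 i
      · rw [if_pos hi.le, if_neg (by omega), h3 i hi.ge]; exact hbc.2
      · rw [if_neg (by omega), if_neg (by omega), dist_self]; exact hδ.le

/-- Squares are used rather than lengths, so that moving a vertex to the midpoint of its neighbours
strictly decreases the sum. -/
def chainEnergy (N : ℕ) (v : ℕ → E) : ℝ := ∑ i ∈ Finset.range N, ‖v i - v (i + 1)‖ ^ 2

lemma chainEnergy_update {N j : ℕ} (hj : j + 1 < N) (v : ℕ → E) (m : E) :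
    chainEnergy N (Function.update v (j + 1) m) - chainEnergy N v =
      (‖v j - m‖ ^ 2 + ‖m - v (j + 2)‖ ^ 2)
        - (‖v j - v (j + 1)‖ ^ 2 + ‖v (j + 1) - v (j + 2)‖ ^ 2) := by
  rw [chainEnergy, chainEnergy, ← Finset.sum_sub_distrib]
  rw [← Finset.sum_subset (s₁ := {j, j + 1})]
  · rw [Finset.sum_pair (by omega)]
    simp
    ring
  · intro i hi
    simp only [Finset.mem_insert, Finset.mem_singleton] at hi
    rw [Finset.mem_range]; omega
  · intro i _ hi
    simp only [Finset.mem_insert, Finset.mem_singleton, not_or] at hi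
    rw [Function.update_of_ne (by omega), Function.update_of_ne (by omega), sub_self]

variable [InnerProductSpace ℝ E]

lemma norm_sub_sq_add_midpoint (a b c : E) :
    ‖a - c‖ ^ 2 + ‖c - b‖ ^ 2 = ‖a - midpoint ℝ a b‖ ^ 2 + ‖midpoint ℝ a b - b‖ ^ 2
      + 2 * ‖c - midpoint ℝ a b‖ ^ 2 := by
  set m := midpoint ℝ a b with hm
  have ha : a = m + (2⁻¹ : ℝ) • (a - b) := by
    rw [hm, midpoint_eq_smul_add, invOf_eq_inv]; module
  have hb : b = m - (2⁻¹ : ℝ) • (a - b) := by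
    rw [hm, midpoint_eq_smul_add, invOf_eq_inv]; module
  set d := (2⁻¹ : ℝ) • (a - b) with hd
  have h1 : a - c = d - (c - m) := by rw [ha]; abel
  have h2 : c - b = (c - m) + d := by rw [hb]; abel
  have h3 : a - m = d := by rw [ha]; abel
  have h4 : m - b = d := by rw [hb]; abel
  rw [h1, h2, h3, h4, norm_sub_sq_real, norm_add_sq_real, real_inner_comm]
  ring

/-- In a compact connected set that is locally strictly midpoint convex, the line through two
distinct points meets the interior. -/
lemma exists_mem_interior_of_local {K : Set E} (hK : IsCompact K) (hconn : IsPreconnected K)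
    (hloc : ∀ c ∈ K, ∃ r > 0, ∀ a ∈ K, ∀ b ∈ K, dist a c < r → dist b c < r → a ≠ b →
      midpoint ℝ a b ∈ interior K)
    {x y : E} (hx : x ∈ K) (hy : y ∈ K) (hxy : x ≠ y) :
    ∃ s : ℝ, x + s • (y - x) ∈ interior K := by
  choose! r hr0 hr using hloc
  obtain ⟨R, hR0, hR⟩ := lebesgue_number_lemma_of_metric (c := fun c : K => Metric.ball (c : E) (r c))
    hK (fun _ => Metric.isOpen_ball)
    fun c hc => mem_iUnion.mpr ⟨⟨c, hc⟩, Metric.mem_ball_self (hr0 c hc)⟩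
  have hmid : ∀ a ∈ K, ∀ b ∈ K, dist a b < R → a ≠ b → midpoint ℝ a b ∈ interior K := by
    intro a ha b hb hab hne
    obtain ⟨c, hc⟩ := hR a ha
    exact hr c c.2 a ha b hb (hc (Metric.mem_ball_self hR0))
      (hc (by rwa [Metric.mem_ball, dist_comm])) hne
  obtain ⟨M, w, hw⟩ := exists_chain hconn hx hy (show 0 < R / 3 by linarith)
  -- Two extra steps guarantee an inner vertex v 1 between v 0 and v 2.
  set N := M + 2 with hN
  have hw' : w ∈ chains K x y N (R / 3) :=
    ⟨hw.1, hw.2.1, fun i hi => hw.2.2.1 i (by omega), hw.2.2.2⟩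
  have hcont : Continuous (chainEnergy N : (ℕ → E) → ℝ) := by
    unfold chainEnergy; fun_prop
  obtain ⟨v, hv, hmin⟩ := (isCompact_chains hK x y N (R / 3)).exists_isMinOn ⟨w, hw'⟩
    hcont.continuousOn
  obtain ⟨hvK, hv0, hvN, hvd⟩ := hv
  have hd2 : ∀ j, dist (v j) (v (j + 2)) < R := fun j => by
    have := dist_triangle (v j) (v (j + 1)) (v (j + 2))
    linarith [hvd j, hvd (j + 1)]
  -- Steps at most R/3 put v j and v (j + 2) within R, so their midpoint is in K. Moving the vertex
  -- there keeps the chain admissible and lowers the energy by twice the squared displacement. A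
  -- minimiser is therefore an arithmetic progression.
  have hstep : ∀ j, j + 1 < N → v (j + 1) = midpoint ℝ (v j) (v (j + 2)) := by
    intro j hj
    set m := midpoint ℝ (v j) (v (j + 2)) with hm
    have hmK : m ∈ K := by
      by_cases h : v j = v (j + 2)
      · rw [hm, ← h, midpoint_self]; exact hvK j
      · exact interior_subset (hmid _ (hvK j) _ (hvK _) (hd2 j) h)
    have hdj : dist (v j) (v (j + 2)) ≤ R / 3 + R / 3 :=
      (dist_triangle (v j) (v (j + 1)) (v (j + 2))).trans (add_le_add (hvd j) (hvd (j + 1)))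
    have hd1 : dist (v j) m ≤ R / 3 := by
      rw [hm, dist_left_midpoint (𝕜 := ℝ)]
      norm_num
      linarith
    have hd1' : dist m (v (j + 2)) ≤ R / 3 := by
      rw [hm, dist_midpoint_right (𝕜 := ℝ)]
      norm_num
      linarith
    have hmem : Function.update v (j + 1) m ∈ chains K x y N (R / 3) := by
      refine ⟨fun i => ?_, ?_, fun i hi => ?_, fun i => ?_⟩
      · by_cases h : i = j + 1
        · rw [h, Function.update_self]; exact hmK
        · rw [Function.update_of_ne h]; exact hvK i
      · rw [Function.update_of_ne (by omega)]; exact hv0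
      · rw [Function.update_of_ne (by omega)]; exact hvN i hi
      · by_cases h : i = j
        · rw [h, Function.update_self, Function.update_of_ne (by omega)]; exact hd1
        by_cases h' : i = j + 1
        · rw [h', Function.update_self, Function.update_of_ne (by omega)]; exact hd1'
        · rw [Function.update_of_ne h', Function.update_of_ne (by omega)]; exact hvd i
    have h1 : chainEnergy N v ≤ chainEnergy N (Function.update v (j + 1) m) := hmin hmem
    have h2 := chainEnergy_update hj v m
    have h3 := norm_sub_sq_add_midpoint (v j) (v (j + 2)) (v (j + 1))
    rw [← hm] at h3
    have h4 : ‖v (j + 1) - m‖ ^ 2 ≤ 0 := by linarith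
    exact sub_eq_zero.mp (norm_eq_zero.mp (pow_eq_zero_iff (two_ne_zero)
      |>.mp (le_antisymm h4 (sq_nonneg _))))
  have hlin : ∀ j, j < N → v j = x + (j : ℝ) • (v 1 - x) ∧
      v (j + 1) = x + ((j : ℝ) + 1) • (v 1 - x) := by
    intro j
    induction j with
    | zero => intro _; simp [hv0]
    | succ k ih =>
      intro hk
      obtain ⟨h1, h2⟩ := ih (by omega)
      refine ⟨by rw [h2]; push_cast; rfl, ?_⟩
      have h3 := hstep k hk
      have h4 : v (k + 2) = (2 : ℝ) • v (k + 1) - v k := by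
        conv_rhs => rw [h3]
        rw [midpoint_eq_smul_add, invOf_eq_inv]; module
      rw [show k + 1 + 1 = k + 2 from rfl, h4, h2, h1]
      push_cast
      module
  have hy1 : y = x + (N : ℝ) • (v 1 - x) := by
    have := (hlin (M + 1) (by omega)).2
    rw [hvN (M + 1 + 1) (by omega)] at this
    rw [this, hN]; push_cast; congr 2; ring
  have hN0 : (N : ℝ) ≠ 0 := by positivity
  have h1 : v 0 ≠ v 2 := by
    intro h
    have h2 := hstep 0 (by omega)
    rw [← h, midpoint_self, hv0] at h2
    rw [show 0 + 1 = 1 from rfl] at h2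
    rw [h2] at hy1
    exact hxy (by simpa using hy1.symm)
  refine ⟨(N : ℝ)⁻¹, ?_⟩
  have h2 : x + (N : ℝ)⁻¹ • (y - x) = v 1 := by
    have h3 : y - x = (N : ℝ) • (v 1 - x) := by
      conv_lhs => rw [hy1]
      exact add_sub_cancel_left _ _
    rw [h3, smul_smul, inv_mul_cancel₀ hN0, one_smul, add_sub_cancel]
  rw [h2]
  have h3 := hstep 0 (by omega)
  rw [show 0 + 1 = 1 from rfl] at h3
  rw [h3]
  exact hmid _ (hvK 0) _ (hvK 2) (hd2 0) h1

/-- Sublevel sets of `σ` are strictly midpoint convex near a point at which the second derivative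
of `σ` is positive on the kernel of the first one. -/
lemma exists_ball_midpoint_neg [FiniteDimensional ℝ E] {σ : E → ℝ} {c : E}
    (hσ : ∀ᶠ y in 𝓝 c, ContDiffAt ℝ 2 σ y)
    (h : ∀ v : E, v ≠ 0 → fderiv ℝ σ c v = 0 → 0 < fderiv ℝ (fderiv ℝ σ) c v v) :
    ∃ r > 0, ∀ a ∈ Metric.ball c r, ∀ b ∈ Metric.ball c r, σ a ≤ 0 → σ b ≤ 0 → a ≠ b →
      σ (midpoint ℝ a b) < 0 := by
  have hc := hσ.self_of_nhds
  have hd1 : ContinuousAt (fderiv ℝ σ) c := (hc.fderiv_right (m := 1) (by norm_num)).continuousAt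
  have hd2 : ContinuousAt (fderiv ℝ (fderiv ℝ σ)) c :=
    ((hc.fderiv_right (m := 1) (by norm_num)).fderiv_right (m := 0) (by norm_num)).continuousAt
  -- The alternative is open in point and direction, so compactness of the unit sphere makes it hold
  -- near c in all directions at once.
  have hev : ∀ᶠ y in 𝓝 c, ∀ v ∈ Metric.sphere (0 : E) 1,
      fderiv ℝ σ y v ≠ 0 ∨ 0 < fderiv ℝ (fderiv ℝ σ) y v v := by
    refine (isCompact_sphere (0 : E) 1).eventually_forall_of_forall_eventually fun v hv => ?_
    have hv0 : v ≠ 0 := by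
      rintro rfl
      simp at hv
    have h1 : ContinuousAt (fun P : E × E => fderiv ℝ σ P.1 P.2) (c, v) :=
      (ContinuousAt.comp (g := fderiv ℝ σ) (x := (c, v)) hd1 continuousAt_fst).clm_apply
        continuousAt_snd
    have h2 : ContinuousAt (fun P : E × E => fderiv ℝ (fderiv ℝ σ) P.1 P.2 P.2) (c, v) :=
      ((ContinuousAt.comp (g := fderiv ℝ (fderiv ℝ σ)) (x := (c, v)) hd2
        continuousAt_fst).clm_apply continuousAt_snd).clm_apply continuousAt_snd
    by_cases h0 : fderiv ℝ σ c v = 0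
    · exact (h2.eventually (lt_mem_nhds (h v hv0 h0))).mono fun _ => Or.inr
    · exact (h1.eventually_ne h0).mono fun _ => Or.inl
  obtain ⟨r, hr0, hr⟩ := Metric.eventually_nhds_iff_ball.mp (hσ.and hev)
  refine ⟨r, hr0, fun a ha b hb hσa hσb hab => ?_⟩
  set v := b - a with hv
  have hv0 : v ≠ 0 := sub_ne_zero.mpr hab.symm
  have hseg : ∀ s ∈ Icc (0 : ℝ) 1, a + s • v ∈ Metric.ball c r := fun s hs =>
    (convex_ball c r).segment_subset ha hb (by
      rw [segment_eq_image']; exact ⟨s, hs, rfl⟩)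
  have hlin : ∀ s : ℝ, HasDerivAt (fun s : ℝ => a + s • v) v s := fun s => by
    simpa using ((hasDerivAt_id s).smul_const v).const_add a
  have hf' : ∀ s ∈ Icc (0 : ℝ) 1,
      HasDerivAt (fun s => σ (a + s • v)) (fderiv ℝ σ (a + s • v) v) s := fun s hs =>
    HasFDerivAt.comp_hasDerivAt (l := σ) s
      (((hr _ (hseg s hs)).1.differentiableAt (by norm_num)).hasFDerivAt) (hlin s)
  have hf'' : ∀ s ∈ Icc (0 : ℝ) 1, HasDerivAt (fun s => fderiv ℝ σ (a + s • v) v)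
      (fderiv ℝ (fderiv ℝ σ) (a + s • v) v v) s := fun s hs => by
    have h1 : HasDerivAt (fun s => fderiv ℝ σ (a + s • v))
        (fderiv ℝ (fderiv ℝ σ) (a + s • v) v) s :=
      HasFDerivAt.comp_hasDerivAt (l := fderiv ℝ σ) s
        ((((hr _ (hseg s hs)).1.fderiv_right (m := 1) (by norm_num)).differentiableAt
          (by norm_num)).hasFDerivAt) (hlin s)
    simpa using h1.clm_apply (hasDerivAt_const s v)
  have hfc : ContinuousOn (fun s : ℝ => σ (a + s • v)) (Icc 0 1) :=
    fun s hs => (hf' s hs).continuousAt.continuousWithinAt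
  -- no interior maximum
  have hno : ∀ s ∈ Ioo (0 : ℝ) 1, ¬ IsMaxOn (fun s : ℝ => σ (a + s • v)) (Icc 0 1) s := by
    intro s hs hmax
    have hs' := Ioo_subset_Icc_self hs
    have hmax' : IsLocalMax (fun s : ℝ => σ (a + s • v)) s := hmax.isLocalMax (Icc_mem_nhds hs.1 hs.2)
    have h0 := hmax'.hasDerivAt_eq_zero (hf' s hs')
    have hpos : 0 < fderiv ℝ (fderiv ℝ σ) (a + s • v) v v := by
      have hvn : 0 < ‖v‖ := norm_pos_iff.mpr hv0
      have h1 := (hr _ (hseg s hs')).2 (‖v‖⁻¹ • v) (by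
        rw [mem_sphere_zero_iff_norm, norm_smul, norm_inv, norm_norm, inv_mul_cancel₀ hvn.ne'])
      simp only [map_smul, smul_apply, smul_eq_mul, h0, mul_zero, ne_eq,
        not_true_eq_false, false_or] at h1
      exact pos_of_mul_pos_right (pos_of_mul_pos_right h1 (by positivity)) (by positivity)
    have hshift : Tendsto (fun e : ℝ => s + e) (𝓝 0) (𝓝 s) := by
      have : Continuous fun e : ℝ => s + e := by fun_prop
      simpa using this.tendsto 0
    have h2 := nonneg_second_deriv (f := fun e => σ (a + s • v) - σ (a + (s + e) • v))
      (f' := fun e => -(fderiv ℝ σ (a + (s + e) • v) v))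
      (f'' := -(fderiv ℝ (fderiv ℝ σ) (a + s • v) v v))
      ((hshift.eventually hmax').mono fun e he => sub_nonneg.mpr he) (by simp)
      ((hshift.eventually (Icc_mem_nhds hs.1 hs.2)).mono fun e he =>
        ((hf' (s + e) he).comp_const_add s e).const_sub _)
      (HasDerivAt.comp_const_add s 0 (by rw [add_zero]; exact hf'' s hs')).neg
    linarith
  by_contra! hge
  have hm : midpoint ℝ a b = a + (2⁻¹ : ℝ) • v := by
    rw [midpoint_eq_smul_add, invOf_eq_inv, hv]; module
  rw [hm] at hge
  have hhalf : (2⁻¹ : ℝ) ∈ Ioo (0 : ℝ) 1 := by norm_num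
  -- The maximum on the segment is at an endpoint, where σ ≤ 0; with σ ≥ 0 at the midpoint, the
  -- midpoint would be an interior maximum too.
  obtain ⟨s, hs, hmax⟩ := isCompact_Icc.exists_isMaxOn (nonempty_Icc.mpr zero_le_one) hfc
  have hs0 : s = 0 ∨ s = 1 := by
    by_contra! h0
    exact hno s ⟨lt_of_le_of_ne hs.1 h0.1.symm, lt_of_le_of_ne hs.2 h0.2⟩ hmax
  have hle : σ (a + s • v) ≤ 0 := by
    rcases hs0 with rfl | rfl
    · simpa using hσa
    · simpa [hv] using hσb
  exact hno _ hhalf fun t ht => (hmax ht).trans (hle.trans hge)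

end Chain

/-! ### The half-space model with `z` at infinity -/

/-- The representative with h_z = 1 on the ray of the point. Here |y|² includes the square of the
height ⟨y,z⟩, which gives the Lorentzian square -⟨y,z⟩². -/
def hsNum (z : Sph n) (y : Euc n) : Mink n :=
  (1 / 2 : ℝ) • ((-(z : Euc n), 1) : Mink n) + (inner ℝ y y / 2) • (((z : Euc n), 1) : Mink n)
    + ((y - inner ℝ y (z : Euc n) • (z : Euc n), 0) : Mink n)

/-- The point of the hyperboloid with coordinate `y` in the half-space `{⟨y, z⟩ > 0}`. -/
def hsPt (z : Sph n) (y : Euc n) : Mink n := (inner ℝ y (z : Euc n))⁻¹ • hsNum z y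

/-- The coordinate in the half-space of a point of the hyperboloid. -/
def hsCoord (z : Sph n) (X : Mink n) : Euc n :=
  (hfn X z)⁻¹ • (X.1 - inner ℝ X.1 (z : Euc n) • (z : Euc n) + (z : Euc n))

lemma lor_hsNum_self (z : Sph n) (y : Euc n) :
    lor (hsNum z y) (hsNum z y) = -inner ℝ y (z : Euc n) ^ 2 := by
  have h1 := sph_inner z
  simp only [lor, hsNum, Prod.fst_add, Prod.snd_add, Prod.smul_fst, Prod.smul_snd, smul_eq_mul,
    inner_add_left, inner_add_right, inner_sub_left, inner_sub_right, real_inner_smul_left,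
    real_inner_smul_right, inner_neg_left, inner_neg_right, h1, real_inner_comm y (z : Euc n)]
  ring

lemma hfn_hsNum (z : Sph n) (y : Euc n) : hfn (hsNum z y) z = 1 := by
  have h1 := sph_inner z
  simp only [hfn, hsNum, Prod.fst_add, Prod.snd_add, Prod.smul_fst, Prod.smul_snd, smul_eq_mul,
    inner_add_left, inner_sub_left, real_inner_smul_left, inner_neg_left, h1]
  ring

lemma hsNum_snd (z : Sph n) (y : Euc n) : (hsNum z y).2 = (1 + inner ℝ y y) / 2 := by
  simp only [hsNum, Prod.snd_add, Prod.smul_snd, smul_eq_mul]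
  ring

lemma hfn_hsPt (z : Sph n) (y : Euc n) : hfn (hsPt z y) z = (inner ℝ y (z : Euc n))⁻¹ := by
  rw [hsPt, hfn_smul, hfn_hsNum, mul_one]

lemma hsPt_mem {z : Sph n} {y : Euc n} (hy : 0 < inner ℝ y (z : Euc n)) :
    lor (hsPt z y) (hsPt z y) = -1 ∧ 0 < (hsPt z y).2 := by
  constructor
  · rw [hsPt, lor_smul_left, lor_smul_right, lor_hsNum_self]
    field_simp
  · rw [hsPt, Prod.smul_snd, hsNum_snd, smul_eq_mul]
    have := real_inner_self_nonneg (F := Euc n) (x := y)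
    positivity

/-- Horospheres centred at z become horizontal hyperplanes, and maximising h_z means minimising the
height. -/
lemma inner_hsCoord (z : Sph n) (X : Mink n) :
    inner ℝ (hsCoord z X) (z : Euc n) = (hfn X z)⁻¹ := by
  rw [hsCoord, real_inner_smul_left, inner_add_left, inner_sub_left, real_inner_smul_left,
    sph_inner]
  ring

lemma hsCoord_hsPt {z : Sph n} {y : Euc n} (hy : 0 < inner ℝ y (z : Euc n)) :
    hsCoord z (hsPt z y) = y := by
  set t := inner ℝ y (z : Euc n) with ht
  have h1 : (hsPt z y).1 = t⁻¹ • ((inner ℝ y y / 2 - 1 / 2 - t) • (z : Euc n) + y) := by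
    simp only [hsPt, hsNum, Prod.smul_fst, Prod.fst_add, ← ht]
    congr 1; module
  rw [hsCoord, hfn_hsPt, ← ht, inv_inv, h1, real_inner_smul_left, inner_add_left,
    real_inner_smul_left, sph_inner, ← ht]
  simp only [smul_sub, smul_add, smul_smul]
  have h2 : t * t⁻¹ = 1 := mul_inv_cancel₀ hy.ne'
  simp only [← mul_assoc, h2]
  module

lemma hsPt_hsCoord (z : Sph n) (X : Hyp n) : hsPt z (hsCoord z X.1) = X.1 := by
  have hh := hfn_pos X z
  set s := inner ℝ X.1.1 (z : Euc n) with hs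
  have hhe : hfn X.1 z = X.1.2 - s := rfl
  set h := hfn X.1 z with hh'
  have h1 : inner ℝ (hsCoord z X.1) (hsCoord z X.1) = (h⁻¹) * (X.1.2 + s) := by
    have h2 := hyp_sq X
    have h4 : inner ℝ X.1.1 X.1.1 = X.1.2 ^ 2 - 1 := by rw [real_inner_self_eq_norm_sq]; linarith
    rw [hsCoord, real_inner_smul_left, real_inner_smul_right]
    simp only [inner_add_left, inner_add_right, inner_sub_left, inner_sub_right,
      real_inner_smul_left, real_inner_smul_right, sph_inner, h4,
      real_inner_comm X.1.1 (z : Euc n), ← hs, ← hh']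
    have h3 : h * h⁻¹ = 1 := mul_inv_cancel₀ hh.ne'
    rw [hhe] at h3 ⊢
    linear_combination (X.1.2 - s)⁻¹ * (X.1.2 + s) * h3
  have h3 : h * h⁻¹ = 1 := mul_inv_cancel₀ hh.ne'
  rw [hsPt, inner_hsCoord, ← hh', inv_inv, hsNum, h1, inner_hsCoord, ← hh', hsCoord, ← hh', ← hs]
  have e1 : h * (1 / 2) + h * (h⁻¹ * (X.1.2 + s) / 2) = X.1.2 := by
    linear_combination (X.1.2 + s) / 2 * h3 + hhe / 2
  refine Prod.ext ?_ ?_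
  · simp only [Prod.smul_fst, Prod.fst_add, smul_add, smul_sub, smul_smul, h3]
    have e2 : h * (1 / 2) = X.1.2 - h * (h⁻¹ * (X.1.2 + s) / 2) := by linarith
    have e3 : h * (h⁻¹ * (X.1.2 + s) / 2) = (X.1.2 + s) / 2 := by
      linear_combination (X.1.2 + s) / 2 * h3
    rw [← mul_assoc, h3, one_mul, e2, e3]
    module
  · simp only [Prod.smul_snd, Prod.snd_add, smul_eq_mul]
    linarith

lemma contDiffAt_hsPt {z : Sph n} {y : Euc n} (hy : inner ℝ y (z : Euc n) ≠ 0) :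
    ContDiffAt ℝ ∞ (hsPt z) y := by
  have h1 : ContDiffAt ℝ ∞ (fun y : Euc n => inner ℝ y (z : Euc n)) y :=
    contDiffAt_id.inner ℝ contDiffAt_const
  have h2 : ContDiffAt ℝ ∞ (fun y : Euc n => inner ℝ y y / 2) y :=
    (contDiffAt_id.inner ℝ contDiffAt_id).div_const 2
  have h3 : ContDiffAt ℝ ∞ (fun y : Euc n =>
      ((y - inner ℝ y (z : Euc n) • (z : Euc n), 0) : Mink n)) y :=
    (contDiffAt_id.sub (h1.smul contDiffAt_const)).prodMk contDiffAt_const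
  have h4 : ContDiffAt ℝ ∞ (fun y : Euc n =>
      (inner ℝ y y / 2) • (((z : Euc n), 1) : Mink n)) y := ContDiffAt.smul h2 contDiffAt_const
  have h5 : ContDiffAt ℝ ∞ (fun y : Euc n => (1 / 2 : ℝ) • ((-(z : Euc n), 1) : Mink n)
      + (inner ℝ y y / 2) • (((z : Euc n), 1) : Mink n)) y := ContDiffAt.add contDiffAt_const h4
  have h6 : ContDiffAt ℝ ∞ (fun y : Euc n => hsNum z y) y := ContDiffAt.add h5 h3
  have h7 : ContDiffAt ℝ ∞ (fun y : Euc n => (inner ℝ y (z : Euc n))⁻¹) y := h1.inv hy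
  exact ContDiffAt.smul h7 h6

lemma continuous_hsCoord (z : Sph n) : Continuous fun X : Hyp n => hsCoord z X.1 := by
  have h1 : Continuous fun X : Hyp n => hfn X.1 (z : Euc n) :=
    continuous_hfn.comp (continuous_subtype_val.prodMk continuous_const)
  have h2 : Continuous fun X : Hyp n => X.1.1 := continuous_fst.comp continuous_subtype_val
  have h4 : Continuous fun X : Hyp n => (hfn X.1 (z : Euc n))⁻¹ :=
    h1.inv₀ fun X => (hfn_pos X z).ne'
  have h5 : Continuous fun X : Hyp n => X.1.1 - inner ℝ X.1.1 (z : Euc n) • (z : Euc n) + (z : Euc n) := by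
    fun_prop
  exact h4.smul h5

/-- The derivative of `hsPt z` at `y` in the direction `v`. -/
def dhsPt (z : Sph n) (y v : Euc n) : Mink n :=
  (inner ℝ y (z : Euc n))⁻¹ • (inner ℝ y v • (((z : Euc n), 1) : Mink n)
    + ((v - inner ℝ v (z : Euc n) • (z : Euc n), 0) : Mink n)
    - inner ℝ v (z : Euc n) • hsPt z y)

lemma hasDerivAt_inner_line (y v w : Euc n) (s : ℝ) :
    HasDerivAt (fun s : ℝ => inner ℝ (y + s • v) w) (inner ℝ v w) s := by
  simp only [inner_add_left, real_inner_smul_left]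
  simpa using ((hasDerivAt_id s).mul_const (inner ℝ v w)).const_add (inner ℝ y w)

lemma hasDerivAt_hsPt {z : Sph n} {y v : Euc n} {s : ℝ}
    (hy : inner ℝ (y + s • v) (z : Euc n) ≠ 0) :
    HasDerivAt (fun s : ℝ => hsPt z (y + s • v)) (dhsPt z (y + s • v) v) s := by
  have hl : HasDerivAt (fun s : ℝ => y + s • v) v s := by
    simpa using ((hasDerivAt_id s).smul_const v).const_add y
  have ht := hasDerivAt_inner_line y v (z : Euc n) s
  have hq := (hl.inner ℝ hl).div_const 2
  have h1 : HasDerivAt (fun s : ℝ => ((y + s • v - inner ℝ (y + s • v) (z : Euc n) • (z : Euc n), 0) :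
      Mink n)) ((v - inner ℝ v (z : Euc n) • (z : Euc n), 0) : Mink n) s :=
    (hl.sub (ht.smul_const (z : Euc n))).prodMk (hasDerivAt_const _ _)
  have h2 := HasDerivAt.smul (ht.inv hy) (HasDerivAt.add (HasDerivAt.add (hasDerivAt_const s
    ((1 / 2 : ℝ) • ((-(z : Euc n), 1) : Mink n)))
    (hq.smul_const (((z : Euc n), 1) : Mink n))) h1)
  refine HasDerivAt.congr_deriv (f := fun s : ℝ => hsPt z (y + s • v)) h2 ?_
  set t := inner ℝ (y + s • v) (z : Euc n) with htd
  rw [dhsPt, hsPt, ← htd, hsNum, real_inner_comm v (y + s • v), ← htd]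
  simp only [Pi.add_apply, zero_add, Pi.inv_apply, ← htd]
  have h4 : -inner ℝ v (z : Euc n) / t ^ 2 = -inner ℝ v (z : Euc n) * (t⁻¹ * t⁻¹) := by
    rw [div_eq_mul_inv, ← mul_inv, sq]
  rw [h4]
  module

lemma lor_hsNum_dir (z : Sph n) (y v : Euc n) :
    lor (hsNum z y) (inner ℝ y v • (((z : Euc n), 1) : Mink n)
      + ((v - inner ℝ v (z : Euc n) • (z : Euc n), 0) : Mink n))
      = -(inner ℝ y (z : Euc n) * inner ℝ v (z : Euc n)) := by
  have h1 := sph_inner z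
  simp only [lor, hsNum, Prod.fst_add, Prod.snd_add, Prod.smul_fst, Prod.smul_snd, smul_eq_mul,
    inner_add_left, inner_add_right, inner_sub_left, inner_sub_right, real_inner_smul_left,
    real_inner_smul_right, inner_neg_left, h1, real_inner_comm v (z : Euc n),
    real_inner_comm v y]
  ring

lemma lor_hsPt_dhsPt {z : Sph n} {y : Euc n} (hy : 0 < inner ℝ y (z : Euc n)) (v : Euc n) :
    lor (hsPt z y) (dhsPt z y v) = 0 := by
  have h1 := (hsPt_mem hy).1
  rw [dhsPt, lor_smul_right, lor_sub_right, lor_smul_right, h1]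
  nth_rw 1 [hsPt]
  rw [lor_smul_left, lor_hsNum_dir]
  field_simp
  ring

lemma lor_dhsPt_self {z : Sph n} {y : Euc n} (hy : 0 < inner ℝ y (z : Euc n)) (v : Euc n) :
    lor (dhsPt z y v) (dhsPt z y v) = inner ℝ v v / inner ℝ y (z : Euc n) ^ 2 := by
  have h1 := (hsPt_mem hy).1
  set D : Mink n := inner ℝ y v • (((z : Euc n), 1) : Mink n)
    + ((v - inner ℝ v (z : Euc n) • (z : Euc n), 0) : Mink n) with hD
  have h2 : lor (hsPt z y) D = -inner ℝ v (z : Euc n) := by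
    rw [hsPt, lor_smul_left, hD, lor_hsNum_dir]; field_simp
  have h3 : lor D D = inner ℝ v v - inner ℝ v (z : Euc n) ^ 2 := by
    have h4 := sph_inner z
    simp only [hD, lor, Prod.fst_add, Prod.snd_add, Prod.smul_fst, Prod.smul_snd, smul_eq_mul,
      inner_add_left, inner_add_right, inner_sub_left, inner_sub_right, real_inner_smul_left,
      real_inner_smul_right, h4, real_inner_comm v (z : Euc n)]
    ring
  rw [dhsPt, ← hD, lor_smul_left, lor_smul_right, lor_sub_left, lor_sub_right, lor_sub_right,
    lor_smul_left, lor_smul_right, lor_smul_left, lor_smul_right, lor_comm D (hsPt z y), h1, h2, h3]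
  field_simp
  ring

lemma hasDerivAt_dhsPt {z : Sph n} {y v : Euc n} (hy : inner ℝ y (z : Euc n) ≠ 0) :
    HasDerivAt (fun s : ℝ => dhsPt z (y + s • v) v)
      ((inner ℝ y (z : Euc n))⁻¹ • (inner ℝ v v • (((z : Euc n), 1) : Mink n)
        - (2 * inner ℝ v (z : Euc n)) • dhsPt z y v)) 0 := by
  have h0 : y + (0 : ℝ) • v = y := by simp
  have ht := hasDerivAt_inner_line y v (z : Euc n) 0
  have hv := hasDerivAt_inner_line y v v 0
  have hp := hasDerivAt_hsPt (z := z) (y := y) (v := v) (s := 0) (by rwa [h0])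
  have h2 := HasDerivAt.smul (ht.inv (by rwa [h0])) (HasDerivAt.sub (HasDerivAt.add
    (hv.smul_const (((z : Euc n), 1) : Mink n))
    (hasDerivAt_const (0 : ℝ) ((v - inner ℝ v (z : Euc n) • (z : Euc n), 0) : Mink n)))
    (hp.const_smul (inner ℝ v (z : Euc n))))
  refine HasDerivAt.congr_deriv (f := fun s : ℝ => dhsPt z (y + s • v) v) h2 ?_
  simp only [Pi.add_apply, Pi.sub_apply, Pi.smul_apply, Pi.inv_apply, h0]
  set D : Mink n := inner ℝ y v • (((z : Euc n), 1) : Mink n)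
    + ((v - inner ℝ v (z : Euc n) • (z : Euc n), 0) : Mink n) - inner ℝ v (z : Euc n) • hsPt z y
    with hD
  have h3 : dhsPt z y v = (inner ℝ y (z : Euc n))⁻¹ • D := rfl
  rw [h3]
  have h4 : -inner ℝ v (z : Euc n) / inner ℝ y (z : Euc n) ^ 2 = -inner ℝ v (z : Euc n) *
      ((inner ℝ y (z : Euc n))⁻¹ * (inner ℝ y (z : Euc n))⁻¹) := by
    rw [div_eq_mul_inv, ← mul_inv, sq]
  rw [h4]
  module

/-- `hsPt` as a map into the hyperboloid. -/
def hsHyp (z : Sph n) (y : Euc n) (hy : 0 < inner ℝ y (z : Euc n)) : Hyp n :=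
  ⟨hsPt z y, hsPt_mem hy⟩

lemma inner_hsCoord_pos (z : Sph n) (X : Hyp n) : 0 < inner ℝ (hsCoord z X.1) (z : Euc n) := by
  rw [inner_hsCoord]; exact inv_pos.mpr (hfn_pos X z)

lemma mem_image_hsCoord {K : Set (Hyp n)} {z : Sph n} {y : Euc n}
    (hy : 0 < inner ℝ y (z : Euc n)) :
    y ∈ (fun X : Hyp n => hsCoord z X.1) '' K ↔ hsHyp z y hy ∈ K := by
  constructor
  · rintro ⟨X, hX, rfl⟩
    have : hsHyp z (hsCoord z X.1) hy = X := Subtype.ext (hsPt_hsCoord z X)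
    rwa [this]
  · exact fun h => ⟨_, h, hsCoord_hsPt hy⟩

lemma eventually_inner_pos {z : Sph n} {c : Euc n} (hc : 0 < inner ℝ c (z : Euc n)) :
    ∀ᶠ y in 𝓝 c, 0 < inner ℝ y (z : Euc n) := by
  have h1 : Continuous fun y : Euc n => inner ℝ y (z : Euc n) :=
    continuous_id.inner continuous_const
  exact h1.continuousAt.eventually (lt_mem_nhds hc)

lemma eventually_hsHyp {P : Hyp n → Prop} {X : Hyp n} (hP : ∀ᶠ Y in 𝓝 X, P Y) (z : Sph n) :
    ∀ᶠ y in 𝓝 (hsCoord z X.1), ∀ hy, P (hsHyp z y hy) := by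
  rw [nhds_subtype_eq_comap, eventually_comap] at hP
  have h1 : Tendsto (hsPt z) (𝓝 (hsCoord z X.1)) (𝓝 X.1) := by
    have := (contDiffAt_hsPt (inner_hsCoord_pos z X).ne').continuousAt.tendsto
    rwa [hsPt_hsCoord] at this
  exact (h1.eventually hP).mono fun y hy h => hy _ rfl

lemma fderiv_comp_hsPt {ρ : Mink n → ℝ} {z : Sph n} {y : Euc n} (hy : inner ℝ y (z : Euc n) ≠ 0)
    (hρ : DifferentiableAt ℝ ρ (hsPt z y)) (v : Euc n) :
    fderiv ℝ (fun y => ρ (hsPt z y)) y v = fderiv ℝ ρ (hsPt z y) (dhsPt z y v) := by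
  have h0 : y + (0 : ℝ) • v = y := by simp
  have hl : HasDerivAt (fun s : ℝ => y + s • v) v 0 := by
    simpa using ((hasDerivAt_id (0 : ℝ)).smul_const v).const_add y
  have hp := hasDerivAt_hsPt (z := z) (y := y) (v := v) (s := 0) (by rwa [h0])
  rw [h0] at hp
  have h1 : HasDerivAt (fun s : ℝ => ρ (hsPt z (y + s • v)))
      (fderiv ℝ ρ (hsPt z y) (dhsPt z y v)) 0 := by
    refine HasFDerivAt.comp_hasDerivAt (l := ρ) (0 : ℝ) ?_ hp
    rw [h0]; exact hρ.hasFDerivAt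
  have hd : DifferentiableAt ℝ (fun y => ρ (hsPt z y)) y :=
    DifferentiableAt.comp (g := ρ) y hρ ((contDiffAt_hsPt hy).differentiableAt (by simp))
  have h2 : HasDerivAt (fun s : ℝ => ρ (hsPt z (y + s • v)))
      (fderiv ℝ (fun y => ρ (hsPt z y)) y v) 0 := by
    refine HasFDerivAt.comp_hasDerivAt (l := fun y => ρ (hsPt z y)) (0 : ℝ) ?_ hl
    rw [h0]; exact hd.hasFDerivAt
  exact h2.unique h1

namespace IsLocalDefiningFn

variable {Ω : Set (Hyp n)} {X : Hyp n} {ρ : Mink n → ℝ}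

lemma tendsto_hsPt (z : Sph n) : Tendsto (hsPt z) (𝓝 (hsCoord z X.1)) (𝓝 X.1) := by
  have := (contDiffAt_hsPt (inner_hsCoord_pos z X).ne').continuousAt.tendsto
  rwa [hsPt_hsCoord] at this

/-- Horospherical convexity in the half-space model is Euclidean convexity. -/
lemma fderiv_fderiv_hsPt_pos (h : IsLocalDefiningFn Ω X ρ) {δ : ℝ} (hδ : 0 < δ)
    (hc : ∀ κ : ℝ, IsPrincipalCurvature Ω X κ → 1 + δ < κ) (z : Sph n) {v : Euc n} (hv : v ≠ 0)
    (h0 : fderiv ℝ (fun y => ρ (hsPt z y)) (hsCoord z X.1) v = 0) :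
    0 < fderiv ℝ (fderiv ℝ fun y => ρ (hsPt z y)) (hsCoord z X.1) v v := by
  set c := hsCoord z X.1 with hcdef
  have ht := inner_hsCoord_pos z X
  have hth := inner_hsCoord z X.1
  rw [← hcdef] at ht hth
  set t := inner ℝ c (z : Euc n) with htdef
  have hcX : hsPt z c = X.1 := hsPt_hsCoord z X
  set w := dhsPt z c v with hw
  have hXw : lor X.1 w = 0 := by rw [← hcX]; exact lor_hsPt_dhsPt ht v
  have hvv : inner ℝ v v = t ^ 2 * lor w w := by
    rw [hw, lor_dhsPt_self ht, ← htdef, mul_div_cancel₀ _ (pow_pos ht 2).ne']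
  have hww : 0 < lor w w := by
    have h1 : 0 < inner ℝ v v := real_inner_self_pos.mpr hv
    rw [hvv] at h1
    exact pos_of_mul_pos_right h1 (sq_nonneg t)
  have hev : ∀ᶠ y in 𝓝 c, 0 < inner ℝ y (z : Euc n) ∧ ContDiffAt ℝ ∞ ρ (hsPt z y) :=
    (eventually_inner_pos ht).and ((tendsto_hsPt z).eventually h.eventually_contDiffAt)
  have hρw : fderiv ℝ ρ X.1 w = 0 := by
    rw [← hcX, ← fderiv_comp_hsPt ht.ne' (hcX ▸ h.differentiableAt)]
    exact h0
  have hνw : lor (unitNormal ρ X) w = 0 := by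
    rw [unitNormal, lor_smul_left, lor_hypGrad ρ hXw, hρw, mul_zero]
  have hl : HasDerivAt (fun s : ℝ => c + s • v) v 0 := by
    simpa using ((hasDerivAt_id (0 : ℝ)).smul_const v).const_add c
  have hz : c + (0 : ℝ) • v = c := by simp
  have hσ : ContDiffAt ℝ ∞ (fun y => ρ (hsPt z y)) c := by
    refine ContDiffAt.comp (g := ρ) c ?_ (contDiffAt_hsPt ht.ne')
    rw [hcX]; exact h.contDiffAt
  have e1 : HasDerivAt (fun s : ℝ => fderiv ℝ (fun y => ρ (hsPt z y)) (c + s • v) v)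
      (fderiv ℝ (fderiv ℝ fun y => ρ (hsPt z y)) c v v) 0 := by
    have e : HasFDerivAt (fderiv ℝ fun y => ρ (hsPt z y))
        (fderiv ℝ (fderiv ℝ fun y => ρ (hsPt z y)) c) (c + (0 : ℝ) • v) := by
      rw [hz]
      exact ((hσ.fderiv_right (m := ∞) (by simp)).differentiableAt (by simp)).hasFDerivAt
    exact ((ContinuousLinearMap.apply ℝ ℝ v).hasFDerivAt).comp_hasDerivAt (0 : ℝ)
      (e.comp_hasDerivAt (0 : ℝ) hl)
  have hp := hasDerivAt_hsPt (z := z) (y := c) (v := v) (s := 0) (by rw [hz]; exact ht.ne')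
  rw [hz, ← hw] at hp
  have e2 : HasDerivAt (fun s : ℝ => fderiv ℝ ρ (hsPt z (c + s • v)))
      (fderiv ℝ (fderiv ℝ ρ) X.1 w) 0 := by
    refine HasFDerivAt.comp_hasDerivAt (l := fderiv ℝ ρ) (0 : ℝ) ?_ hp
    rw [hz, hcX]
    exact (h.contDiffAt_fderiv.differentiableAt (by simp)).hasFDerivAt
  have e3 := e2.clm_apply (hasDerivAt_dhsPt (z := z) (y := c) (v := v) ht.ne')
  have hls : Tendsto (fun s : ℝ => c + s • v) (𝓝 0) (𝓝 c) := by
    have := hl.continuousAt.tendsto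
    rwa [hz] at this
  have e4 := e1.unique (e3.congr_of_eventuallyEq ((hls.eventually hev).mono fun s hs =>
    fderiv_comp_hsPt hs.1.ne' (hs.2.differentiableAt (by simp)) v))
  rw [e4, hz, hcX, ← hw, ← htdef, map_smul, map_sub, map_smul, map_smul, hρw]
  set Z : Mink n := ((z : Euc n), (1 : ℝ)) with hZ
  have hXZ : lor X.1 Z = -hfn X.1 z := by rw [hfn_eq]; ring
  have hZZ : lor Z Z = 0 := lor_null_null z
  have hh := hfn_pos X z
  set m := X.1 - t • Z with hm
  have hthh : t * hfn X.1 z = 1 := by rw [hth]; exact inv_mul_cancel₀ hh.ne'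
  have hXm : lor X.1 m = 0 := by
    rw [hm, lor_sub_right, lor_smul_right, X.2.1, hXZ]; linarith
  have hmm : lor m m = 1 := by
    simp only [hm, lor_sub_left, lor_sub_right, lor_smul_left, lor_smul_right, X.2.1, hXZ, hZZ,
      lor_comm Z X.1]
    linarith
  have hgm : lor (hypGrad ρ X) m = lor (lorGrad ρ X) X - t * fderiv ℝ ρ X.1 Z := by
    rw [lor_hypGrad ρ hXm, hm, map_sub, map_smul, lor_lorGrad, smul_eq_mul]
  set g := Real.sqrt (lor (hypGrad ρ X) (hypGrad ρ X)) with hg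
  have hg0 : 0 < g := Real.sqrt_pos.mpr h.lor_grad_pos
  -- m is the unit normal of the horosphere centred at z through X; Cauchy–Schwarz bounds the
  -- component of ∇ρ along it by |∇ρ|.
  have hle : lor (lorGrad ρ X) X - t * fderiv ℝ ρ X.1 Z ≤ g := by
    have h1 := lor_sq_le (lor_hypGrad_self ρ X) hXm hmm
    rw [← hgm]
    exact (le_abs_self _).trans (Real.abs_le_sqrt h1)
  have hW := h.mul_lor_self_le hc hXw hνw
  rw [h.lor_fderiv_unitNormal w hXw hνw, ← hg, le_inv_mul_iff₀ hg0] at hW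
  -- With this term the Hessian in the chart is |∇ρ| times the second fundamental form minus
  -- ⟨∇ρ,m⟩|w|², hence at least δ|∇ρ||w|²: only the excess of the curvature over that of horospheres
  -- remains.
  have hfin : t⁻¹ * (inner ℝ v v * fderiv ℝ ρ X.1 Z) = t * fderiv ℝ ρ X.1 Z * lor w w := by
    rw [hvv]; field_simp
  have hpos : 0 < g * δ * lor w w := by positivity
  simp only [smul_eq_mul, mul_zero, sub_zero, hfin]
  nlinarith [mul_le_mul_of_nonneg_right hle hww.le]

end IsLocalDefiningFn

/-! ### Uniqueness of the maximum points of h_z -/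

lemma exists_local_midpoint {K : Set (Hyp n)} (hK : IsUniformlyHConvex K) (z : Sph n) {X : Hyp n}
    (hX : X ∈ K) : ∃ r > 0, ∀ a ∈ (fun X : Hyp n => hsCoord z X.1) '' K,
      ∀ b ∈ (fun X : Hyp n => hsCoord z X.1) '' K,
      dist a (hsCoord z X.1) < r → dist b (hsCoord z X.1) < r → a ≠ b →
      midpoint ℝ a b ∈ interior ((fun X : Hyp n => hsCoord z X.1) '' K) := by
  set c := hsCoord z X.1 with hc
  have ht := inner_hsCoord_pos z X
  have hmid : ∀ {r : ℝ} {a b : Euc n}, dist a c < r → dist b c < r →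
      midpoint ℝ a b ∈ Metric.ball c r := fun ha hb =>
    (convex_ball c _).midpoint_mem ha hb
  by_cases hint : X ∈ interior K
  · have h1 : ∀ᶠ y in 𝓝 c, y ∈ (fun X : Hyp n => hsCoord z X.1) '' K := by
      filter_upwards [eventually_hsHyp (mem_interior_iff_mem_nhds.mp hint) z,
        eventually_inner_pos ht] with y h2 h3
      exact (mem_image_hsCoord h3).mpr (h2 h3)
    obtain ⟨r, hr0, hr⟩ := Metric.eventually_nhds_iff_ball.mp h1
    exact ⟨r, hr0, fun a _ b _ ha hb _ =>
      interior_maximal hr Metric.isOpen_ball (hmid ha hb)⟩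
  · have hf : X ∈ frontier K := ⟨subset_closure hX, hint⟩
    obtain ⟨ρ, hρ⟩ := hK.isSmoothDomain.smooth_boundary X hf
    obtain ⟨δ, hδ, hcurv⟩ := hK.curvature
    have hev : ∀ᶠ y in 𝓝 c, 0 < inner ℝ y (z : Euc n) ∧ ContDiffAt ℝ ∞ ρ (hsPt z y) :=
      (eventually_inner_pos ht).and
        ((IsLocalDefiningFn.tendsto_hsPt z).eventually hρ.eventually_contDiffAt)
    have hsm : ∀ᶠ y in 𝓝 c, ContDiffAt ℝ ∞ (fun y => ρ (hsPt z y)) y :=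
      hev.mono fun y hy => ContDiffAt.comp (g := ρ) y hy.2 (contDiffAt_hsPt hy.1.ne')
    obtain ⟨r₁, hr₁, h1⟩ := exists_ball_midpoint_neg
      (hsm.mono fun y hy => hy.of_le (WithTop.coe_le_coe.mpr le_top))
      fun v hv => hρ.fderiv_fderiv_hsPt_pos hδ (hcurv X hf) z hv
    have hiff : ∀ᶠ y in 𝓝 c, (y ∈ (fun X : Hyp n => hsCoord z X.1) '' K ↔ ρ (hsPt z y) ≤ 0) := by
      filter_upwards [eventually_hsHyp hρ.mem_iff z, eventually_inner_pos ht] with y h2 h3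
      rw [mem_image_hsCoord h3]
      exact h2 h3
    obtain ⟨r₂, hr₂, h2⟩ := Metric.eventually_nhds_iff_ball.mp (hiff.and hsm)
    refine ⟨min r₁ r₂, lt_min hr₁ hr₂, fun a haK b hbK ha hb hab => ?_⟩
    have ha1 := ha.trans_le (min_le_left _ _)
    have hb1 := hb.trans_le (min_le_left _ _)
    have ha2 := ha.trans_le (min_le_right _ _)
    have hb2 := hb.trans_le (min_le_right _ _)
    have h3 := h1 a ha1 b hb1 ((h2 a ha2).1.mp haK) ((h2 b hb2).1.mp hbK) hab
    have hm := hmid ha2 hb2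
    rw [mem_interior_iff_mem_nhds]
    filter_upwards [Metric.isOpen_ball.mem_nhds hm,
      (h2 _ hm).2.continuousAt.eventually (gt_mem_nhds h3)] with y hy1 hy2
    exact (h2 y hy1).1.mpr hy2.le

/-- On a uniformly h-convex domain `h_z` has only one maximum point. -/
lemma eq_of_isMax {K : Set (Hyp n)} (hK : IsUniformlyHConvex K) {z : Sph n} {X Y : Hyp n}
    (hX : X ∈ K) (hY : Y ∈ K) (hmax : ∀ W ∈ K, hfn W.1 z ≤ hfn X.1 z)
    (hXY : hfn Y.1 z = hfn X.1 z) : X = Y := by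
  by_contra hne
  have hcont := continuous_hsCoord (n := n) z
  have hneq : hsCoord z X.1 ≠ hsCoord z Y.1 := by
    intro h
    apply hne
    apply Subtype.ext
    rw [← hsPt_hsCoord z X, h, hsPt_hsCoord]
  obtain ⟨s, hs⟩ := exists_mem_interior_of_local (hK.isSmoothDomain.isCompact.image hcont)
    (hK.isSmoothDomain.isConnected.isPreconnected.image _ hcont.continuousOn) (by
      rintro _ ⟨W, hW, rfl⟩
      exact exists_local_midpoint hK z hW) ⟨X, hX, rfl⟩ ⟨Y, hY, rfl⟩ hneq
  set q := hsCoord z X.1 + s • (hsCoord z Y.1 - hsCoord z X.1) with hq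
  have hqt : inner ℝ q (z : Euc n) = (hfn X.1 z)⁻¹ := by
    rw [hq, inner_add_left, real_inner_smul_left, inner_sub_left, inner_hsCoord, inner_hsCoord, hXY]
    ring
  -- The line through the two maximum points has the minimal height of the image of K; from its
  -- interior point q one could still move down.
  have hc : Continuous fun e : ℝ => q - e • (z : Euc n) := by fun_prop
  have h1 : ∀ᶠ e : ℝ in 𝓝[>] 0, q - e • (z : Euc n) ∈ (fun X : Hyp n => hsCoord z X.1) '' K := by
    refine Eventually.filter_mono nhdsWithin_le_nhds ?_
    have h2 := hc.tendsto 0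
    rw [zero_smul, sub_zero] at h2
    exact h2.eventually (mem_interior_iff_mem_nhds.mp hs)
  obtain ⟨e, ⟨W, hW, hWe⟩, he⟩ := (h1.and self_mem_nhdsWithin).exists
  have he0 : (0 : ℝ) < e := he
  have h2 : (hfn W.1 z)⁻¹ = (hfn X.1 z)⁻¹ - e := by
    rw [← inner_hsCoord, ← hqt]
    have h3 := congrArg (fun y => inner ℝ y (z : Euc n)) hWe
    simp only [inner_sub_left, real_inner_smul_left, sph_inner, mul_one] at h3
    exact h3
  have h3 := inv_anti₀ (hfn_pos W z) (hmax W hW)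
  linarith

/-! ### Smoothness of the support function -/

/-- The map whose value at a boundary point with outward normal `X - (z, 1) / h` is `(z, -1)`. -/
def gaussMap (ρ : Mink n → ℝ) (Y : Mink n) : Mink n :=
  ((1 + ρ Y) • ((Y - unitNormal ρ Y).2⁻¹ • (Y - unitNormal ρ Y).1), lor Y Y)

namespace IsLocalDefiningFn

variable {Ω : Set (Hyp n)} {X : Hyp n} {ρ : Mink n → ℝ}

lemma sub_unitNormal_eq (h : IsLocalDefiningFn Ω X ρ) {z : Sph n}
    (hmax : ∀ Y ∈ Ω, hfn Y.1 z ≤ hfn X.1 z) :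
    X.1 - unitNormal ρ X = (hfn X.1 z)⁻¹ • ((z : Euc n), (1 : ℝ)) := by
  rw [h.unitNormal_eq hmax, sub_sub_cancel]

lemma gaussMap_eq (h : IsLocalDefiningFn Ω X ρ) {z : Sph n}
    (hmax : ∀ Y ∈ Ω, hfn Y.1 z ≤ hfn X.1 z) : gaussMap ρ X = ((z : Euc n), (-1 : ℝ)) := by
  have hh := hfn_pos X z
  rw [gaussMap, h.sub_unitNormal_eq hmax, h.eq_zero, X.2.1]
  simp only [Prod.smul_fst, Prod.smul_snd, smul_eq_mul, mul_one, inv_inv, smul_smul,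
    mul_inv_cancel₀ hh.ne', add_zero, one_smul]

lemma eventually_contDiffAt_gaussMap (h : IsLocalDefiningFn Ω X ρ) {z : Sph n}
    (hmax : ∀ Y ∈ Ω, hfn Y.1 z ≤ hfn X.1 z) : ∀ᶠ Y in 𝓝 X.1, ContDiffAt ℝ ∞ (gaussMap ρ) Y := by
  have h1 : ContinuousAt (fun Y => (Y - unitNormal ρ Y).2) X.1 :=
    (continuousAt_id.sub h.contDiffAt_unitNormal.continuousAt).snd
  have h2 : ∀ᶠ Y in 𝓝 X.1, (Y - unitNormal ρ Y).2 ≠ 0 := by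
    refine h1.eventually_ne ?_
    rw [h.sub_unitNormal_eq hmax]
    simpa using (hfn_pos X z).ne'
  filter_upwards [h.eventually_contDiffAt, h.eventually_contDiffAt_unitNormal, h2] with Y h3 h4 h5
  have h6 : ContDiffAt ℝ ∞ (fun Y => Y - unitNormal ρ Y) Y := ContDiffAt.sub contDiffAt_id h4
  have h7 : ContDiffAt ℝ ∞ (fun Y => (Y - unitNormal ρ Y).1) Y := h6.fst
  have h8 : ContDiffAt ℝ ∞ (fun Y => (Y - unitNormal ρ Y).2⁻¹) Y := h6.snd.inv h5
  have h9 : ContDiffAt ℝ ∞ (fun Y => (Y - unitNormal ρ Y).2⁻¹ • (Y - unitNormal ρ Y).1) Y :=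
    ContDiffAt.smul h8 h7
  have h10 : ContDiffAt ℝ ∞ (fun Y => 1 + ρ Y) Y := contDiffAt_const.add h3
  exact ContDiffAt.prodMk (ContDiffAt.smul h10 h9) (contDiffAt_lor_comp contDiffAt_id contDiffAt_id)

/-- The factor 1 + ρ and the component ⟨Y,Y⟩ detect motion off the boundary and off the hyperboloid,
so a kernel vector v is tangent to the boundary and Dν(v) = v modulo (z,1). Pairing with X removes
(z,1), and Dν(v) = v contradicts the curvature bound unless v = 0. -/
lemma fderiv_gaussMap_injective (h : IsLocalDefiningFn Ω X ρ) {δ : ℝ} (hδ : 0 < δ)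
    (hc : ∀ κ : ℝ, IsPrincipalCurvature Ω X κ → 1 + δ < κ) {z : Sph n}
    (hmax : ∀ Y ∈ Ω, hfn Y.1 z ≤ hfn X.1 z) {v : Mink n}
    (hv : fderiv ℝ (gaussMap ρ) X.1 v = 0) : v = 0 := by
  have hh := hfn_pos X z
  have hΦ := h.sub_unitNormal_eq hmax
  have h0 : X.1 + (0 : ℝ) • v = X.1 := by simp
  have hl : HasDerivAt (fun s : ℝ => X.1 + s • v) v 0 := by
    simpa using ((hasDerivAt_id (0 : ℝ)).smul_const v).const_add X.1
  have hcomp : ∀ {V : Type} [NormedAddCommGroup V] [NormedSpace ℝ V] (f : Mink n → V),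
      DifferentiableAt ℝ f X.1 → HasDerivAt (fun s : ℝ => f (X.1 + s • v)) (fderiv ℝ f X.1 v) 0 := by
    intro V _ _ f hf
    refine HasFDerivAt.comp_hasDerivAt (l := f) (0 : ℝ) ?_ hl
    rw [h0]; exact hf.hasFDerivAt
  set A := v - fderiv ℝ (unitNormal ρ) X v with hA
  have hν : HasDerivAt (fun s : ℝ => X.1 + s • v - unitNormal ρ (X.1 + s • v)) A 0 :=
    hl.sub (hcomp _ (h.contDiffAt_unitNormal.differentiableAt (by simp)))
  have hν1 : HasDerivAt (fun s : ℝ => (X.1 + s • v - unitNormal ρ (X.1 + s • v)).1) A.1 0 := hν.fst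
  have hν2 : HasDerivAt (fun s : ℝ => (X.1 + s • v - unitNormal ρ (X.1 + s • v)).2) A.2 0 := hν.snd
  have hρ := (hcomp ρ h.differentiableAt).const_add 1
  have hne : (X.1 + (0 : ℝ) • v - unitNormal ρ (X.1 + (0 : ℝ) • v)).2 ≠ 0 := by
    rw [h0, hΦ]; simpa using hh.ne'
  have hG := hcomp (gaussMap ρ)
    ((h.eventually_contDiffAt_gaussMap hmax).self_of_nhds.differentiableAt (by simp))
  rw [hv] at hG
  have hG1 : HasDerivAt (fun s : ℝ => (gaussMap ρ (X.1 + s • v)).1) 0 0 := hG.fst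
  have hG2 : HasDerivAt (fun s : ℝ => (gaussMap ρ (X.1 + s • v)).2) 0 0 := hG.snd
  have e2 := hG2.unique (hl.lor hl)
  have e1 := hG1.unique (hρ.smul ((hν2.inv hne).smul hν1))
  simp only [Pi.inv_apply, h0, hΦ, h.eq_zero, Prod.smul_fst, Prod.smul_snd,
    smul_eq_mul, mul_one, add_zero, one_smul, inv_inv, smul_smul, mul_inv_cancel₀ hh.ne'] at e1
  rw [h0, lor_comm v] at e2
  have hXv : lor X.1 v = 0 := by linarith
  obtain ⟨hD1, hD2⟩ := h.lor_fderiv_unitNormal_of_lor_eq_zero hXv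
  have hΦA : lor (X.1 - unitNormal ρ X) A = 0 := by
    rw [hA, lor_sub_left, lor_sub_right, lor_sub_right, hXv, hD1, hD2]; ring
  rw [hΦ, lor_smul_left] at hΦA
  have hZA : inner ℝ (z : Euc n) A.1 = A.2 := by
    have h1 := (mul_eq_zero.mp hΦA).resolve_left (inv_pos.mpr hh).ne'
    simp only [lor, one_mul] at h1
    linarith
  have hc2 : -A.2 / (hfn X.1 z)⁻¹ ^ 2 * (hfn X.1 z)⁻¹ = -(hfn X.1 z * A.2) := by
    field_simp
  rw [hc2] at e1
  have hρv : fderiv ℝ ρ X.1 v = 0 := by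
    have h1 := congrArg (fun y => inner ℝ (z : Euc n) y) e1
    simp only [inner_add_right, real_inner_smul_right, sph_inner, hZA, inner_zero_right] at h1
    linarith
  have hA1 : A = A.2 • (((z : Euc n), 1) : Mink n) := by
    rw [hρv, zero_smul, add_zero] at e1
    refine Prod.ext ?_ (by simp)
    have h1 : hfn X.1 z • (A.1 - A.2 • (z : Euc n)) = 0 := by
      refine Eq.trans ?_ e1.symm
      module
    exact sub_eq_zero.mp ((smul_eq_zero.mp h1).resolve_left hh.ne')
  have hνv : lor (unitNormal ρ X) v = 0 := by
    rw [unitNormal, lor_smul_left, lor_hypGrad ρ hXv, hρv, mul_zero]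
  have hA2 : A.2 = 0 := by
    have h1 : lor X.1 A = 0 := by rw [hA, lor_sub_right, hXv, hD1, hνv]; ring
    rw [hA1, lor_smul_right] at h1
    have h2 : lor X.1 ((z : Euc n), (1 : ℝ)) = -hfn X.1 z := by rw [hfn_eq]; ring
    rw [h2] at h1
    exact (mul_eq_zero.mp h1).resolve_right (neg_ne_zero.mpr hh.ne')
  rw [hA2, zero_smul] at hA1
  have hDv : fderiv ℝ (unitNormal ρ) X v = v := (sub_eq_zero.mp hA1).symm
  have h1 := h.mul_lor_self_le hc hXv hνv
  rw [hDv] at h1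
  have h2 := lor_self_nonneg hXv
  exact eq_zero_of_lor_self hXv (by nlinarith)

end IsLocalDefiningFn

/-! ### Support functions of uniformly h-convex domains -/

section SupportFn

variable {K : Set (Hyp n)}

lemma IsUniformlyHConvex.nonempty (hK : IsUniformlyHConvex K) : K.Nonempty :=
  hK.isSmoothDomain.interior_nonempty.mono interior_subset

lemma subset_horoHull_supportFn (hc : IsCompact K) : K ⊆ horoHull (supportFn K) :=
  fun _ hX z => hfn_le_exp_supportFn hc hX z

lemma mem_frontier_of_isMax {X : Hyp n} (hX : X ∈ K) {z : Sph n}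
    (hmax : ∀ Y ∈ K, hfn Y.1 z ≤ hfn X.1 z) : X ∈ frontier K := by
  refine ⟨subset_closure hX, fun hint => ?_⟩
  obtain ⟨Y, hY, hlt⟩ := exists_hfn_gt X z (mem_interior_iff_mem_nhds.mp hint)
  exact absurd (hmax Y hY) (not_le.mpr hlt)

/-- The maximum points of `h_w` depend continuously on `w`. -/
lemma IsUniformlyHConvex.eventually_isMax (hK : IsUniformlyHConvex K) {z : Sph n} {X : Hyp n}
    (hX : X ∈ K) (hmax : ∀ Y ∈ K, hfn Y.1 z ≤ hfn X.1 z) {P : Hyp n → Prop}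
    (hP : ∀ᶠ Y in 𝓝 X, P Y) :
    ∀ᶠ w : Sph n in 𝓝 z, ∀ Y ∈ K, (∀ W ∈ K, hfn W.1 w ≤ hfn Y.1 w) → P Y := by
  obtain ⟨N, hNP, hNo, hXN⟩ := eventually_nhds_iff.mp hP
  have hcpt : IsCompact (K \ N) := hK.isSmoothDomain.isCompact.diff hNo
  have hfc : Continuous fun Q : Sph n × Hyp n => hfn Q.2.1 (Q.1 : Euc n) :=
    continuous_hfn.comp ((continuous_subtype_val.comp continuous_snd).prodMk
      (continuous_subtype_val.comp continuous_fst))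
  -- By uniqueness h_z is smaller than h_z(X) on the compact set K \ N, and this persists for nearby
  -- w.
  have hfar : ∀ᶠ w : Sph n in 𝓝 z, ∀ Y ∈ K \ N, hfn Y.1 (w : Euc n) < hfn X.1 w := by
    refine hcpt.eventually_forall_of_forall_eventually fun Y hY => ?_
    have h1 : Continuous fun Q : Sph n × Hyp n => hfn X.1 (Q.1 : Euc n) :=
      hfc.comp (continuous_fst.prodMk continuous_const)
    refine hfc.continuousAt.eventually_lt h1.continuousAt ?_
    refine lt_of_le_of_ne (hmax Y hY.1) fun heq => hY.2 ?_
    rwa [← eq_of_isMax hK hX hY.1 hmax heq]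
  filter_upwards [hfar] with w hw Y hY hYmax
  refine hNP Y ?_
  by_contra hYN
  exact absurd (hYmax X hX) (not_le.mpr (hw Y ⟨hY, hYN⟩))

/-- For w near z the maximum point of h_w is the value at (w,-1) of a local inverse of the Gauss
map, so it depends smoothly on w. -/
lemma IsUniformlyHConvex.smoothSph_supportFn (hK : IsUniformlyHConvex K) :
    SmoothSph (supportFn K) := by
  refine smoothSph_of_local fun z => ?_
  obtain ⟨X, hX, hmax⟩ := exists_hfn_max hK.isSmoothDomain.isCompact hK.nonempty z
  have hf := mem_frontier_of_isMax hX hmax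
  obtain ⟨ρ, hρ⟩ := hK.isSmoothDomain.smooth_boundary X hf
  obtain ⟨δ, hδ, hcurv⟩ := hK.curvature
  obtain ⟨g, hgs, hg0, hg⟩ := exists_smooth_localInverse (hρ.eventually_contDiffAt_gaussMap hmax)
    fun v => hρ.fderiv_gaussMap_injective hδ (hcurv X hf) hmax
  rw [hρ.gaussMap_eq hmax] at hgs hg0
  refine ⟨fun w => Real.log (hfn (g (w, -1)) w), ?_, ?_⟩
  · have h1 : ContDiffAt ℝ ∞ (fun w : Euc n => g (w, -1)) (z : Euc n) :=
      ContDiffAt.comp (g := g) (z : Euc n) hgs.self_of_nhds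
        (contDiffAt_id.prodMk contDiffAt_const)
    have h2 : ContDiffAt ℝ ∞ (fun w : Euc n => hfn (g (w, -1)) w) (z : Euc n) :=
      ContDiffAt.comp (g := fun P : Mink n × Euc n => hfn P.1 P.2) (z : Euc n)
        contDiff_hfn.contDiffAt (h1.prodMk contDiffAt_id)
    refine h2.log ?_
    rw [hg0]
    exact (hfn_pos X z).ne'
  · have hval : Tendsto (Subtype.val : Hyp n → Mink n) (𝓝 X) (𝓝 X.1) :=
      continuous_subtype_val.continuousAt
    filter_upwards [hK.eventually_isMax hX hmax (hρ.eventually.and (hval.eventually hg))] with w hw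
    obtain ⟨Y, hY, hYmax⟩ := exists_hfn_max hK.isSmoothDomain.isCompact hK.nonempty w
    obtain ⟨h1, h2⟩ := hw Y hY hYmax
    rw [(h1 (mem_frontier_of_isMax hY hYmax)).gaussMap_eq hYmax] at h2
    rw [supportFn_eq_of_isMax hY hYmax, h2]

lemma IsUniformlyHConvex.hSupport_supportFn (hK : IsUniformlyHConvex K) :
    HSupport (supportFn K) :=
  hSupport_of_touching hK.smoothSph_supportFn fun w => by
    obtain ⟨X, hX, h⟩ := exists_hfn_eq_exp_supportFn hK.isSmoothDomain.isCompact hK.nonempty w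
    exact ⟨X, subset_horoHull_supportFn hK.isSmoothDomain.isCompact hX, h⟩

lemma IsUniformlyHConvex.hessPos_supportFn (hK : IsUniformlyHConvex K) :
    HessPos (supportFn K) := by
  have hsub := subset_horoHull_supportFn hK.isSmoothDomain.isCompact
  have hmem : ∀ z, bptH (supportFn K) z ∈ K := fun z => by
    obtain ⟨X, hX, h⟩ := exists_hfn_eq_exp_supportFn hK.isSmoothDomain.isCompact hK.nonempty z
    rwa [← eq_bptH_of_le (hK.smoothSph_supportFn.differentiableAt z) (hsub hX) h]
  obtain ⟨δ, hδ, hcurv⟩ := hK.curvature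
  intro z ζ hζ hζ0
  have hf : bptH (supportFn K) z ∈ frontier K :=
    mem_frontier_of_hfn_eq hsub (hmem z) (hfn_bpt_self _ z)
  obtain ⟨ρ, hρ⟩ := hK.isSmoothDomain.smooth_boundary _ hf
  exact IsLocalDefiningFn.hessForm_pos hK.smoothSph_supportFn hsub hmem hρ hδ (hcurv _ hf) hζ hζ0

lemma hSupport_supportFn (hK : IsUniformlyHConvex K ∨ IsPoint K) : HSupport (supportFn K) := by
  rcases hK with hK | ⟨X, rfl⟩
  · exact hK.hSupport_supportFn
  · rw [supportFn_singleton]; exact hSupport_point X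

lemma eq_bptH_singleton (X : Hyp n) (z : Sph n) : X = bptH (supportFn {X}) z := by
  rw [supportFn_singleton]
  exact eq_bptH_of_le ((smoothSph_log_hfn X).differentiableAt z)
    (fun w => (Real.exp_log (hfn_pos X w)).ge) (Real.exp_log (hfn_pos X z)).symm

end SupportFn

/-! ### The theorem on p-sums -/

lemma pSumExp_eq {p a b : ℝ} (ha : 0 ≤ a) (hb : 0 ≤ b) (hab : 1 ≤ a + b) (K L : Set (Hyp n)) :
    pSumExp p a b K L = fun z => Real.exp (pSumFn p a b K L z) := by
  funext z
  have h1 : 0 < a * Real.exp (p * supportFn K z) + b * Real.exp (p * supportFn L z) :=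
    pLog_arg_pos ha hb hab _ _
  rw [pSumExp, pSumFn, ← Real.exp_mul, ← Real.exp_mul, mul_comm _ p, mul_comm _ p,
    Real.rpow_def_of_pos h1, mul_comm]

end HypSum

end

theorem mainTheorem1 (n : ℕ) (hn : 1 ≤ n) (p a b : ℝ) (hp₁ : 1 / 2 ≤ p) (hp₂ : p ≤ 2)
    (ha : 0 ≤ a) (hb : 0 ≤ b) (hab : 1 ≤ a + b) (K L : Set (HypSum.Hyp n))
    (hK : HypSum.IsUniformlyHConvex K ∨ HypSum.IsPoint K)
    (hL : HypSum.IsUniformlyHConvex L ∨ HypSum.IsPoint L) :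
    ContMDiff (𝓡 n) 𝓘(ℝ, ℝ) ∞ (HypSum.pSumFn p a b K L) ∧
    (∃! Ω : Set (HypSum.Hyp n),
      HypSum.IsHConvexDomain Ω ∧ HypSum.supportFn Ω = HypSum.pSumFn p a b K L) ∧
    ∀ Ω : Set (HypSum.Hyp n),
      HypSum.IsHConvexDomain Ω → HypSum.supportFn Ω = HypSum.pSumFn p a b K L →
      (Subtype.val '' frontier Ω = Set.range (HypSum.boundaryMap (HypSum.pSumExp p a b K L))) ∧
      (¬ (a = 1 ∧ b = 0 ∧ HypSum.IsPoint K) →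
        ¬ (a = 0 ∧ b = 1 ∧ HypSum.IsPoint L) →
        ¬ ((p = 1 / 2 ∨ p = 2) ∧ 0 < a ∧ 0 < b ∧ a + b = 1 ∧
            HypSum.IsPoint K ∧ HypSum.IsPoint L) →
        ¬ (0 < a ∧ 0 < b ∧ a + b = 1 ∧ HypSum.IsPoint K ∧ K = L) →
        HypSum.IsUniformlyHConvex Ω) := by
  open HypSum in
  have hSK := hSupport_supportFn hK
  have hSL := hSupport_supportFn hL
  have hu : HSupport (pSumFn p a b K L) := hSupport_pLog hp₁ hp₂ ha hb hab hSK hSL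
  refine ⟨hu.smooth.contMDiff, ⟨horoHull (pSumFn p a b K L),
    ⟨isHConvexDomain_horoHull hu, supportFn_horoHull hu⟩, fun Ω hΩ => ?_⟩, fun Ω hΩ hΩu => ?_⟩
  · rw [← hΩ.2]; exact eq_horoHull hΩ.1
  obtain rfl : Ω = horoHull (pSumFn p a b K L) := by rw [← hΩu]; exact eq_horoHull hΩ
  refine ⟨?_, fun h1 h2 h3 h4 => isUniformlyHConvex_horoHull hn hu fun z ζ hζ hζ0 => ?_⟩
  · rw [frontier_horoHull hu, ← Set.range_comp, pSumExp_eq ha hb hab]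
    congr 1
    funext z
    exact (boundaryMap_exp (hu.smooth.differentiableAt z)).symm
  refine hessForm_pLog_pos hp₁ hp₂ ha hb hab hSK hSL hζ hζ0 ?_
  rcases hab.lt_or_eq with hlt | heq
  · exact .inr (.inr (.inl hlt))
  -- Now a + b = 1. A uniformly h-convex summand with positive weight suffices; otherwise every
  -- summand with positive weight is a point.
  rcases ha.lt_or_eq with ha' | ha'
  · rcases hK with hK | hK
    · exact .inl ⟨ha', hK.hessPos_supportFn z ζ hζ hζ0⟩
    rcases hb.lt_or_eq with hb' | hb'
    · rcases hL with hL | hL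
      · exact .inr (.inl ⟨hb', hL.hessPos_supportFn z ζ hζ hζ0⟩)
      refine .inr (.inr (.inr ⟨ha', hb', lt_of_le_of_ne hp₁ fun h => ?_,
        lt_of_le_of_ne hp₂ fun h => ?_, ?_⟩))
      · exact h3 ⟨.inl h.symm, ha', hb', heq.symm, hK, hL⟩
      · exact h3 ⟨.inr h, ha', hb', heq.symm, hK, hL⟩
      -- For two points, equal 1-jets at a single z already force the points to coincide.
      · by_contra! hne
        have hpK := hK
        obtain ⟨X, rfl⟩ := hK
        obtain ⟨Y, rfl⟩ := hL
        refine h4 ⟨ha', hb', heq.symm, hpK, ?_⟩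
        rw [eq_bptH_singleton X z, eq_bptH_singleton Y z]
        congr 1
        exact Subtype.ext (by simp only [bptH, bpt, hne.1, hne.2])
    · exact absurd ⟨by linarith, hb'.symm, hK⟩ h1
  · rcases hL with hL | hL
    · exact .inr (.inl ⟨by linarith, hL.hessPos_supportFn z ζ hζ hζ0⟩)
    · exact absurd ⟨ha'.symm, by linarith, hL⟩ h2
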